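/- Let $\Bbbk$ be a commutative ring, $G$ a group and $d\in\Bbbk$. **The category $\mathrm{Par}(G,d)$.** A $G$-partition of type $\binom lk$ is a pair $(P,\mathbf g)$ of a partition $P$ of the set of $k$ bottom vertices $1,\dots,k$ and $l$ top vertices $1',\dots,l'$ and a labelling $\mathbf g$ of these vertices by elements of $G$; $(P,\mathbf g)\sim(P,\mathbf h)$ if on every part of $P$ the labels $\mathbf h$ arise from $\mathbf g$ by left multiplication by one element of $G$ (depending on the part). For $P$ of type $\binom lk$ and $Q$ of type $\binom ml$, stack $Q$ on top of $P$, identifying the middle rows; let $\alpha(Q,P)$ be the number of connected components contained in the middle row, and let $Q\star P$ be the partition of the bottom and top rows by connectedness. The pair $((Q,\mathbf h),(P,\mathbf g))$ is compatible if the elements $g_{i'}h_i^{-1}$ are equal for all $i\in\{1,\dots,l\}$ whose middle vertices lie in a common part of $Q$; then $\mathbf h\star_{Q,P}\mathbf g$ has the label $g_i$ at the bottom vertex $i$, and at the top vertex $j'$ the label $g_{i'}h_i^{-1}h_{j'}$ if some middle vertex $i$ lies in the part of $Q$ containing $j'$, and $h_{j'}$ otherwise. $\mathrm{Par}(G,d)$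 is the strict $\Bbbk$-linear monoidal category with objects $\mathbb N$ and $k\otimes l=k+l$, whose morphisms $k\to l$ are the formal $\Bbbk$-linear combinations of the equivalence classes $[P,\mathbf g]$ of $G$-partitions of type $\binom lk$ ("$G$-partition diagrams"), with $[Q,\mathbf h]\circ[P,\mathbf g]=d^{\alpha(Q,P)}[Q\star P,\mathbf h\star_{Q,P}\mathbf g]$ if the two classes have compatible representatives, taken here to be $(Q,\mathbf h)$ and $(P,\mathbf g)$, and $0$ otherwise, and with tensor product given by horizontal juxtaposition. **The category $\mathrm{Par}(G)$.** It is the strict $\Bbbk$-linear monoidal category generated by one object $\mathsf g$ and morphisms $\mu:\mathsf g\otimes\mathsf g\to\mathsf g$ (merge), $\Delta:\mathsf g\to\mathsf g\otimes\mathsf g$ (split), $s:\mathsf g\otimes\mathsf g\to\mathsf g\otimes\mathsf g$ (crossing), $\eta:\mathbf 1\to\mathsf g$ and $\varepsilon:\mathsf g\to\mathbf 1$ (pins), and $t_g:\mathsf g\to\mathsf g$ for $g\in G$ (tokens), subject to the following relations, where $1=1_{\mathsf g}$ except in $t_1$, the token of the identity element of $G$: 1. $\mu(1\otimes\eta)=1$,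 $\ (1\otimes\varepsilon)\Delta=1=(\varepsilon\otimes1)\Delta$, $\ (\mu\otimes1)(1\otimes\Delta)=\Delta\mu=(1\otimes\mu)(\Delta\otimes1)$; 2. $s^2=1_{\mathsf g\otimes\mathsf g}$, $\ (s\otimes1)(1\otimes s)(s\otimes1)=(1\otimes s)(s\otimes1)(1\otimes s)$; 3. $s(1\otimes\eta)=\eta\otimes1$, $\ (1\otimes\varepsilon)s=\varepsilon\otimes1$, $\ (1\otimes\mu)(s\otimes1)(1\otimes s)=s(\mu\otimes1)$, $\ (1\otimes s)(s\otimes1)(1\otimes\Delta)=(\Delta\otimes1)s$; 4. $\mu s=\mu$, $\ \mu(t_g\otimes t_h)\Delta=\delta_{g,h}t_g$; 5. $t_gt_h=t_{gh}$, $\ t_1=1$, $\ s(t_g\otimes1)=(1\otimes t_g)s$, $\ \Delta t_g=(t_g\otimes t_g)\Delta$, $\ t_g\eta=\eta$ (for all $g,h\in G$). **Theorem.** Let $\mathrm{Par}'(G,d)$ be the quotient of the $\Bbbk$-linear monoidal category $\mathrm{Par}(G)$ by the relation $\varepsilon\circ\eta=d\,1_{\mathbf 1}$. There is an isomorphism of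 $\Bbbk$-linear monoidal categories $F:\mathrm{Par}'(G,d)\to\mathrm{Par}(G,d)$, strictly monoidal, with $F(\mathsf g^{\otimes n})=n$ for all $n\in\mathbb N$, sending $\mu$, $\Delta$, $\eta$, $\varepsilon$ to the diagrams of types $\binom12,\binom21,\binom10,\binom01$ with a single part and all labels $1$, sending $s$ to the diagram of type $\binom22$ with parts $\{1,2'\},\{2,1'\}$ and all labels $1$, and $t_g$ to the diagram of type $\binom11$ with a single part, bottom label $g$ and top label $1$. Consequently, for all $k,l\in\mathbb N$, the $\Bbbk$-module $\mathrm{Hom}_{\mathrm{Par}'(G,d)}(\mathsf g^{\otimes k},\mathsf g^{\otimes l})$ has a basis indexed by the $G$-partition diagrams of type $\binom lk$, the basis element of index $[P,\mathbf g]$ being sent by $F$ to $[P,\mathbf g]$. -/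

import Mathlib

namespace GroupPartition

universe u v w

/-! ### `G`-partitions and their equivalence classes -/

/-- A `G`-partition of a set `V` of vertices: a partition of `V` (given by the equivalence relation
"lie in the same part") together with a label in `G` on every vertex. -/
structure GPartition (G : Type v) (V : Type w) where
  part : Setoid V
  label : V → G

/-- Two `G`-partitions are equivalent if they have the same parts and the labels of the second are
obtained from those of the first by multiplying, on every part, all labels on the left by one
element of `G`. -/
instance GPartition.setoid (G : Type v) [Group G] (V : Type w) : Setoid (GPartition G V) where
  r x y := x.part = y.part ∧ ∃ t : V → G, (∀ a b, x.part a b → t a = t b) ∧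
    ∀ a, y.label a = t a * x.label a
  iseqv :=
    { refl := fun x => ⟨rfl, fun _ => 1, fun _ _ _ => rfl, fun a => by simp⟩
      symm := by
        rintro x y ⟨h, t, ht, e⟩
        exact ⟨h.symm, fun a => (t a)⁻¹, fun a b hab => congrArg (·⁻¹) (ht a b (by rw [h]; exact hab)),
          fun a => by simp [e]⟩
      trans := by
        rintro x y z ⟨h, t, ht, e⟩ ⟨h', t', ht', e'⟩
        exact ⟨h.trans h', fun a => t' a * t a,
          fun a b hab => congrArg₂ (· * ·) (ht' a b (by rw [← h]; exact hab)) (ht a b hab),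
          fun a => by rw [e', e, mul_assoc]⟩ }

/-- Equivalence classes of `G`-partitions of the vertex set `V`. -/
def GDiagram (G : Type v) [Group G] (V : Type w) : Type (max v w) :=
  Quotient (GPartition.setoid G V)

/-- The class `[P, g]`. -/
def GDiagram.mk {G : Type v} [Group G] {V : Type w} (P : Setoid V) (g : V → G) : GDiagram G V :=
  Quotient.mk _ ⟨P, g⟩

section Stack

variable {A B C : Type w}

/-- The inclusion of the two lower rows `A` (bottom) and `B` (middle) into the three rows. -/
def lower : A ⊕ B → A ⊕ (B ⊕ C) := Sum.map id Sum.inl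

/-- The inclusion of the two upper rows `B` (middle) and `C` (top) into the three rows. -/
def upper : B ⊕ C → A ⊕ (B ⊕ C) := Sum.inr

/-- The inclusion of the bottom row `A` and the top row `C` into the three rows. -/
def outer : A ⊕ C → A ⊕ (B ⊕ C) := Sum.map id Sum.inr

/-- Connectedness in the three-row diagram obtained by placing `Q` on top of `P` and identifying
the middle rows. -/
def stack (P : Setoid (A ⊕ B)) (Q : Setoid (B ⊕ C)) : Setoid (A ⊕ (B ⊕ C)) :=
  P.map lower ⊔ Q.map upper

/-- `Q ⋆ P`: two vertices of the bottom and top rows are in the same part if they are connected in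
the three-row diagram. -/
def starPart (P : Setoid (A ⊕ B)) (Q : Setoid (B ⊕ C)) : Setoid (A ⊕ C) :=
  (stack P Q).comap outer

/-- For a setoid `S` on `V` and `e : U → V`: the classes of `S` containing no vertex of the form
`e x`. -/
def Missed {U V : Type*} (S : Setoid V) (e : U → V) : Type _ :=
  {c : Quotient S // ∀ x, Quotient.mk S (e x) ≠ c}

/-- `α(Q, P)`: the number of components of the three-row diagram that contain only vertices of the
middle row, i.e. no vertex of the bottom or the top row. -/
noncomputable def alpha (P : Setoid (A ⊕ B)) (Q : Setoid (B ⊕ C)) : ℕ :=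
  Nat.card (Missed (stack P Q) outer)

variable {G : Type v} [Group G]

/-- The label `g_{i'} h_i⁻¹` of the `i`-th vertex of the middle row when `(Q, h)` is placed on top
of `(P, g)`. -/
def midLabel (p : GPartition G (A ⊕ B)) (q : GPartition G (B ⊕ C)) (i : B) : G :=
  p.label (Sum.inr i) * (q.label (Sum.inl i))⁻¹

/-- Any two vertices of the middle row in the same part of `Q` have the same middle label. -/
def Compatible (p : GPartition G (A ⊕ B)) (q : GPartition G (B ⊕ C)) : Prop :=
  ∀ i j : B, q.part (Sum.inl i) (Sum.inl j) → midLabel p q i = midLabel p q j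

open Classical in
/-- The middle label of some (for a compatible pair: any) middle vertex in the same part of `Q` as
the top vertex `c`, and `1` if there is no such middle vertex. -/
noncomputable def topFactor (p : GPartition G (A ⊕ B)) (q : GPartition G (B ⊕ C)) (c : C) : G :=
  if h : ∃ i : B, q.part (Sum.inl i) (Sum.inr c) then midLabel p q h.choose else 1

/-- The `G`-partition `(Q ⋆ P, h ⋆ g)`. -/
noncomputable def star (p : GPartition G (A ⊕ B)) (q : GPartition G (B ⊕ C)) :
    GPartition G (A ⊕ C) where
  part := starPart p.part q.part
  label := Sum.elim (fun a => p.label (Sum.inl a))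
    (fun c => topFactor p q c * q.label (Sum.inr c))

variable {k : Type u} [CommRing k]

open Classical in
/-- The composite `Y ∘ X` of two diagrams, `X` at the bottom and `Y` on top: if there are
compatible representatives `p` of `X` and `q` of `Y`, it is `d ^ α` times the class of
`star p q`, and otherwise it is `0`. -/
noncomputable def compDiagram (d : k) (X : GDiagram G (A ⊕ B)) (Y : GDiagram G (B ⊕ C)) :
    GDiagram G (A ⊕ C) →₀ k :=
  if h : ∃ pq : GPartition G (A ⊕ B) × GPartition G (B ⊕ C),
      Quotient.mk _ pq.1 = X ∧ Quotient.mk _ pq.2 = Y ∧ Compatible pq.1 pq.2 then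
    Finsupp.single (Quotient.mk _ (star h.choose.1 h.choose.2))
      (d ^ alpha h.choose.1.part h.choose.2.part)
  else 0

end Stack

/-! #### Auxiliary facts on labels and classes -/

section Aux

variable {G : Type v} [Group G] {V : Type w}

/-- The partition underlying a class. -/
def GDiagram.part (X : GDiagram G V) : Setoid V :=
  Quotient.lift GPartition.part (fun _ _ (h : _ ∧ _) => h.1) X

/-- `g` labels a representative of the class `X`. -/
def GDiagram.IsLabel (X : GDiagram G V) (g : V → G) : Prop := X = GDiagram.mk X.part g

theorem GDiagram.exists_label (X : GDiagram G V) : ∃ g, X.IsLabel g := by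
  induction X using Quotient.inductionOn with
  | h x => exact ⟨x.label, rfl⟩

@[simp] theorem GDiagram.part_mk (P : Setoid V) (g : V → G) : (GDiagram.mk P g).part = P := rfl

theorem GDiagram.mk_eq_mk {P P' : Setoid V} {g g' : V → G} :
    GDiagram.mk P g = GDiagram.mk P' g' ↔ P = P' ∧ ∃ t : V → G,
      (∀ a b, P a b → t a = t b) ∧ ∀ a, g' a = t a * g a :=
  ⟨fun h => Quotient.exact h, fun h => Quotient.sound h⟩

theorem GDiagram.isLabel_mk {P : Setoid V} {g g' : V → G} :
    (GDiagram.mk P g).IsLabel g' ↔ ∃ t : V → G,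
      (∀ a b, P a b → t a = t b) ∧ ∀ a, g' a = t a * g a := by
  unfold GDiagram.IsLabel
  rw [GDiagram.part_mk, GDiagram.mk_eq_mk]
  simp

theorem GDiagram.isLabel_mk_self (P : Setoid V) (g : V → G) : (GDiagram.mk P g).IsLabel g := rfl

theorem GDiagram.ext_label {X Y : GDiagram G V} (h : X.part = Y.part) {g : V → G}
    (hX : X.IsLabel g) (hY : Y.IsLabel g) : X = Y := by
  unfold GDiagram.IsLabel at hX hY
  rw [hX, hY, h]

theorem GDiagram.IsLabel.iff {X : GDiagram G V} {g : V → G} (h : X.IsLabel g) {g' : V → G} :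
    X.IsLabel g' ↔ ∃ t : V → G, (∀ a b, X.part a b → t a = t b) ∧ ∀ a, g' a = t a * g a := by
  conv_lhs => rw [h]
  exact GDiagram.isLabel_mk

theorem GDiagram.IsLabel.twist {X : GDiagram G V} {g : V → G} (h : X.IsLabel g) (t : V → G)
    (ht : ∀ a b, X.part a b → t a = t b) : X.IsLabel (fun a => t a * g a) :=
  h.iff.2 ⟨t, ht, fun _ => rfl⟩

theorem map_le_iff {U V : Type*} {P : Setoid U} {e : U → V} {S : Setoid V} :
    P.map e ≤ S ↔ ∀ a b, P a b → S (e a) (e b) := by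
  constructor
  · intro h a b hab
    exact h (Relation.EqvGen.rel _ _ ⟨a, b, hab, rfl, rfl⟩)
  · intro h
    refine Setoid.eqvGen_le ?_
    rintro _ _ ⟨a, b, hab, rfl, rfl⟩
    exact h a b hab

theorem map_rel {U V : Type*} {P : Setoid U} {e : U → V} {a b : U} (h : P a b) :
    P.map e (e a) (e b) := Relation.EqvGen.rel _ _ ⟨a, b, h, rfl, rfl⟩

theorem map_map {U V W : Type*} (P : Setoid U) (e : U → V) (f : V → W) :
    (P.map e).map f = P.map (f ∘ e) := by
  apply le_antisymm
  · rw [map_le_iff]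
    intro a b hab
    have : P.map e ≤ (P.map (f ∘ e)).comap f := by
      rw [map_le_iff]; intro a b hab; exact map_rel (e := f ∘ e) hab
    exact this hab
  · rw [map_le_iff]
    intro a b hab
    exact map_rel (map_rel hab)

theorem map_sup {U V : Type*} (P Q : Setoid U) (e : U → V) :
    (P ⊔ Q).map e = P.map e ⊔ Q.map e := by
  apply le_antisymm
  · rw [map_le_iff]
    have : P ⊔ Q ≤ (P.map e ⊔ Q.map e).comap e := by
      refine sup_le ?_ ?_
      · intro a b hab; exact (le_sup_left : P.map e ≤ _) (map_rel hab)
      · intro a b hab; exact (le_sup_right : Q.map e ≤ _) (map_rel hab)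
    exact fun a b hab => this hab
  · refine sup_le ?_ ?_
    · rw [map_le_iff]; intro a b hab; exact map_rel ((le_sup_left : P ≤ P ⊔ Q) hab)
    · rw [map_le_iff]; intro a b hab; exact map_rel ((le_sup_right : Q ≤ P ⊔ Q) hab)

/-- A function constant on the classes of `S ∘ t` extends to one constant on the classes of `S`. -/
theorem exists_extension {T W : Type*} (S : Setoid W) (t : T → W) (s : T → G)
    (hs : ∀ x y, S (t x) (t y) → s x = s y) :
    ∃ s' : W → G, (∀ a b, S a b → s' a = s' b) ∧ ∀ x, s' (t x) = s x := by
  classical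
  refine ⟨fun a => if h : ∃ x, S (t x) a then s h.choose else 1, ?_, ?_⟩
  · intro a b hab
    by_cases h : ∃ x, S (t x) a
    · have h' : ∃ x, S (t x) b := ⟨h.choose, S.trans h.choose_spec hab⟩
      simp only [h, h', dif_pos]
      exact hs _ _ (S.trans (S.trans h.choose_spec hab) (S.symm h'.choose_spec))
    · have h' : ¬ ∃ x, S (t x) b := fun ⟨x, hx⟩ => h ⟨x, S.trans hx (S.symm hab)⟩
      simp only [h, h', dif_neg, not_false_eq_true]
  · intro x
    have h : ∃ y, S (t y) (t x) := ⟨x, S.refl _⟩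
    simp only [h, dif_pos]
    exact hs _ _ h.choose_spec

/-- Gluing a partition `S` of `W` and a partition `R` of `U` along `T`. -/
theorem glue_equiv {T W U V : Type*} (tW : T → W) (tU : T → U) (j : W → V) (i : U → V)
    (hcomm : ∀ x, j (tW x) = i (tU x))
    (hi : Function.Injective i) (hj : Function.Injective j)
    (hcov : ∀ x, (∃ a, x = i a) ∨ ∃ b, x = j b)
    (hpb : ∀ a b, i a = j b → ∃ x, a = tU x ∧ b = tW x)
    (S : Setoid W) (R : Setoid U) (K : Setoid V) (hK : K = S.map j ⊔ R.map i) :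
    ∃ E : Quotient K ≃ Quotient ((S.comap tW).map tU ⊔ R) ⊕ Missed S tW,
      ∀ a, E (Quotient.mk K (i a)) = Sum.inl (Quotient.mk _ a) := by
  classical
  set N := (S.comap tW).map tU ⊔ R with hN
  have hSK : ∀ a b, S a b → K (j a) (j b) := fun a b h => by
    rw [hK]; exact (le_sup_left : S.map j ≤ _) (map_rel h)
  have hRK : ∀ a b, R a b → K (i a) (i b) := fun a b h => by
    rw [hK]; exact (le_sup_right : R.map i ≤ _) (map_rel h)
  have hNK : ∀ a b, N a b → K (i a) (i b) := by
    have : N ≤ K.comap i := by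
      refine sup_le ?_ ?_
      · rw [map_le_iff]; intro a b h
        change K (i _) (i _)
        rw [← hcomm, ← hcomm]; exact hSK _ _ h
      · intro a b h; exact hRK _ _ h
    exact fun a b h => this h
  have hTN : ∀ x y, S (tW x) (tW y) → N (tU x) (tU y) := fun x y h =>
    (le_sup_left : (S.comap tW).map tU ≤ N) (map_rel (P := S.comap tW) h)
  let ψ : W → Quotient N ⊕ Missed S tW := fun c =>
    if h : ∃ x, S (tW x) c then Sum.inl (Quotient.mk N (tU h.choose))
    else Sum.inr ⟨Quotient.mk S c, fun x hx => h ⟨x, Quotient.exact hx⟩⟩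
  have hψS : ∀ a b, S a b → ψ a = ψ b := by
    intro a b hab
    by_cases h : ∃ x, S (tW x) a
    · have h' : ∃ x, S (tW x) b := ⟨h.choose, S.trans h.choose_spec hab⟩
      simp only [ψ, h, h', dif_pos]
      exact congrArg Sum.inl (Quotient.sound (hTN _ _
        (S.trans (S.trans h.choose_spec hab) (S.symm h'.choose_spec))))
    · have h' : ¬ ∃ x, S (tW x) b := fun ⟨x, hx⟩ => h ⟨x, S.trans hx (S.symm hab)⟩
      simp only [ψ, h, h', dif_neg, not_false_eq_true]
      exact congrArg Sum.inr (Subtype.ext (Quotient.sound hab))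
  have hψT : ∀ x, ψ (tW x) = Sum.inl (Quotient.mk N (tU x)) := by
    intro x
    have h : ∃ y, S (tW y) (tW x) := ⟨x, S.refl _⟩
    simp only [ψ, h, dif_pos]
    exact congrArg Sum.inl (Quotient.sound (hTN _ _ h.choose_spec))
  let φ : V → Quotient N ⊕ Missed S tW := fun x =>
    if h : ∃ a, x = i a then Sum.inl (Quotient.mk N h.choose)
    else ψ ((hcov x).resolve_left h).choose
  have hφi : ∀ a, φ (i a) = Sum.inl (Quotient.mk N a) := by
    intro a
    have h : ∃ b, i a = i b := ⟨a, rfl⟩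
    simp only [φ, h, dif_pos]
    rw [← hi h.choose_spec]
  have hφj : ∀ b, φ (j b) = ψ b := by
    intro b
    by_cases h : ∃ a, j b = i a
    · obtain ⟨a, ha⟩ := h
      obtain ⟨x, rfl, rfl⟩ := hpb a b ha.symm
      rw [ha, hφi, hψT]
    · simp only [φ, h, dif_neg, not_false_eq_true]
      rw [← hj ((hcov (j b)).resolve_left h).choose_spec]
  have hφK : ∀ x y, K x y → φ x = φ y := by
    have : K ≤ Setoid.ker φ := by
      rw [hK]
      refine sup_le ?_ ?_
      · rw [map_le_iff]; intro a b h
        change φ _ = φ _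
        rw [hφj, hφj, hψS _ _ h]
      · rw [map_le_iff]; intro a b h
        change φ _ = φ _
        rw [hφi, hφi]
        exact congrArg Sum.inl (Quotient.sound ((le_sup_right : R ≤ N) h))
    exact fun x y h => this h
  let F : Quotient K → Quotient N ⊕ Missed S tW := Quotient.lift φ hφK
  let H : Quotient N ⊕ Missed S tW → Quotient K :=
    Sum.elim (Quotient.lift (fun a => Quotient.mk K (i a)) (fun a b h => Quotient.sound (hNK a b h)))
      (fun c => Quotient.lift (fun b => Quotient.mk K (j b))
        (fun a b h => Quotient.sound (hSK a b h)) c.1)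
  have hHψ : ∀ b, H (ψ b) = Quotient.mk K (j b) := by
    intro b
    by_cases h : ∃ x, S (tW x) b
    · simp only [ψ, h, dif_pos]
      change Quotient.mk K (i _) = _
      rw [← hcomm]
      exact Quotient.sound (hSK _ _ h.choose_spec)
    · simp only [ψ, h, dif_neg, not_false_eq_true]
      rfl
  have hψm : ∀ c : W, ∀ h : ∀ x, Quotient.mk S (tW x) ≠ Quotient.mk S c,
      ψ c = Sum.inr ⟨Quotient.mk S c, h⟩ := by
    intro c h
    have h' : ¬ ∃ x, S (tW x) c := fun ⟨x, hx⟩ => h x (Quotient.sound hx)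
    simp only [ψ, h', dif_neg, not_false_eq_true]
  refine ⟨⟨F, H, ?_, ?_⟩, fun a => hφi a⟩
  · intro q
    induction q using Quotient.inductionOn with
    | h x =>
      change H (φ x) = _
      rcases hcov x with ⟨a, rfl⟩ | ⟨b, rfl⟩
      · rw [hφi]; rfl
      · rw [hφj, hHψ]
  · rintro (q | ⟨q, hq⟩)
    · induction q using Quotient.inductionOn with
      | h a => exact hφi a
    · induction q using Quotient.inductionOn with
      | h b =>
        change φ (j b) = _
        rw [hφj, hψm b hq]

end Aux

section CompAux

variable {A B C D : Type w} {G : Type v} [Group G] {k : Type u} [CommRing k]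

/-- `f` labels the three rows so that it restricts to labels of `X` (bottom) and `Y` (top). -/
def Glued (X : GDiagram G (A ⊕ B)) (Y : GDiagram G (B ⊕ C)) (f : A ⊕ (B ⊕ C) → G) : Prop :=
  X.IsLabel (f ∘ lower) ∧ Y.IsLabel (f ∘ upper)

theorem stack_lower {P : Setoid (A ⊕ B)} {Q : Setoid (B ⊕ C)} {a b : A ⊕ B} (h : P a b) :
    stack P Q (lower a) (lower b) := (le_sup_left : P.map lower ≤ _) (map_rel h)

theorem stack_upper {P : Setoid (A ⊕ B)} {Q : Setoid (B ⊕ C)} {a b : B ⊕ C} (h : Q a b) :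
    stack P Q (upper a) (upper b) := (le_sup_right : Q.map upper ≤ _) (map_rel h)

theorem stack_const {T : Type*} {P : Setoid (A ⊕ B)} {Q : Setoid (B ⊕ C)}
    (t : A ⊕ (B ⊕ C) → T) (hP : ∀ a b, P a b → t (lower a) = t (lower b))
    (hQ : ∀ a b, Q a b → t (upper a) = t (upper b)) :
    ∀ a b, stack P Q a b → t a = t b := by
  have : stack P Q ≤ Setoid.ker t :=
    sup_le (map_le_iff.2 fun a b h => hP a b h) (map_le_iff.2 fun a b h => hQ a b h)
  exact fun a b h => this h

theorem topFactor_of_rel {p : GPartition G (A ⊕ B)} {q : GPartition G (B ⊕ C)}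
    (h : Compatible p q) {i : B} {c : C} (hi : q.part (Sum.inl i) (Sum.inr c)) :
    topFactor p q c = midLabel p q i := by
  have h' : ∃ i : B, q.part (Sum.inl i) (Sum.inr c) := ⟨i, hi⟩
  simp only [topFactor, h', dif_pos]
  exact h _ _ (q.part.trans h'.choose_spec (q.part.symm hi))

theorem topFactor_congr {p : GPartition G (A ⊕ B)} {q : GPartition G (B ⊕ C)}
    (h : Compatible p q) {c c' : C} (hc : q.part (Sum.inr c) (Sum.inr c')) :
    topFactor p q c = topFactor p q c' := by
  by_cases h' : ∃ i : B, q.part (Sum.inl i) (Sum.inr c)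
  · obtain ⟨i, hi⟩ := h'
    rw [topFactor_of_rel h hi, topFactor_of_rel h (q.part.trans hi hc)]
  · have h'' : ¬ ∃ i : B, q.part (Sum.inl i) (Sum.inr c') :=
      fun ⟨i, hi⟩ => h' ⟨i, q.part.trans hi (q.part.symm hc)⟩
    simp only [topFactor, h', h'', dif_neg, not_false_eq_true]

/-- A compatible pair of representatives gives a labelling of the three rows, whose restriction to
the outer rows is the label of the composite. -/
theorem glued_of_compatible (p : GPartition G (A ⊕ B)) (q : GPartition G (B ⊕ C))
    (h : Compatible p q) : ∃ f : A ⊕ (B ⊕ C) → G,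
      Glued (Quotient.mk _ p : GDiagram G _) (Quotient.mk _ q : GDiagram G _) f ∧
      f ∘ outer = (star p q).label := by
  refine ⟨Sum.elim (fun a => p.label (Sum.inl a)) (Sum.elim (fun b => p.label (Sum.inr b))
    (fun c => topFactor p q c * q.label (Sum.inr c))), ⟨?_, ?_⟩, ?_⟩
  · refine (GDiagram.isLabel_mk (P := p.part) (g := p.label)).2
      ⟨fun _ => 1, fun _ _ _ => rfl, ?_⟩
    rintro (a | b) <;> simp [lower]
  · refine (GDiagram.isLabel_mk (P := q.part) (g := q.label)).2
      ⟨Sum.elim (midLabel p q) (topFactor p q), ?_, ?_⟩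
    · rintro (i | c) (j | c') hab
      · exact h i j hab
      · exact (topFactor_of_rel h hab).symm
      · exact topFactor_of_rel h (q.part.symm hab)
      · exact topFactor_congr h hab
    · rintro (i | c)
      · simp [midLabel, upper]
      · rfl
  · funext x
    rcases x with a | b <;> rfl

theorem outer_glued_unique {X : GDiagram G (A ⊕ B)} {Y : GDiagram G (B ⊕ C)}
    {f f' : A ⊕ (B ⊕ C) → G} (h : Glued X Y f) (h' : Glued X Y f') :
    (GDiagram.mk (starPart X.part Y.part) (f ∘ outer)).IsLabel (f' ∘ outer) := by
  obtain ⟨s, hs, es⟩ := h.1.iff.1 h'.1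
  obtain ⟨c, hc, ec⟩ := h.2.iff.1 h'.2
  let t : A ⊕ (B ⊕ C) → G := fun x => f' x * (f x)⁻¹
  have tl : ∀ a, t (lower a) = s a := fun a => by
    have := es a
    simp only [Function.comp] at this
    simp [t, this]
  have tu : ∀ a, t (upper a) = c a := fun a => by
    have := ec a
    simp only [Function.comp] at this
    simp [t, this]
  have ht := stack_const (P := X.part) (Q := Y.part) t
    (fun a b hab => by rw [tl, tl, hs a b hab]) (fun a b hab => by rw [tu, tu, hc a b hab])
  refine GDiagram.isLabel_mk.2 ⟨t ∘ outer, fun a b hab => ht _ _ hab, fun a => ?_⟩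
  simp [t]

theorem compDiagram_of_glued (d : k) {X : GDiagram G (A ⊕ B)} {Y : GDiagram G (B ⊕ C)}
    {f : A ⊕ (B ⊕ C) → G} (h : Glued X Y f) :
    compDiagram d X Y = Finsupp.single (GDiagram.mk (starPart X.part Y.part) (f ∘ outer))
      (d ^ alpha X.part Y.part) := by
  have hex : ∃ pq : GPartition G (A ⊕ B) × GPartition G (B ⊕ C),
      Quotient.mk _ pq.1 = X ∧ Quotient.mk _ pq.2 = Y ∧ Compatible pq.1 pq.2 :=
    ⟨(⟨X.part, f ∘ lower⟩, ⟨Y.part, f ∘ upper⟩), h.1.symm, h.2.symm, fun i j _ => by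
      simp [midLabel, lower, upper]⟩
  simp only [compDiagram, hex, dif_pos]
  obtain ⟨h1, h2, h3⟩ := hex.choose_spec
  generalize hex.choose = pq at h1 h2 h3
  obtain ⟨p, q⟩ := pq
  subst h1 h2
  obtain ⟨f', hf', e⟩ := glued_of_compatible p q h3
  have := outer_glued_unique h hf'
  rw [e] at this
  unfold GDiagram.IsLabel at this
  rw [this]
  rfl

theorem compDiagram_of_not_glued (d : k) {X : GDiagram G (A ⊕ B)} {Y : GDiagram G (B ⊕ C)}
    (h : ¬ ∃ f, Glued X Y f) : compDiagram d X Y = 0 := by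
  have hex : ¬ ∃ pq : GPartition G (A ⊕ B) × GPartition G (B ⊕ C),
      Quotient.mk _ pq.1 = X ∧ Quotient.mk _ pq.2 = Y ∧ Compatible pq.1 pq.2 := by
    rintro ⟨⟨p, q⟩, rfl, rfl, hc⟩
    obtain ⟨f, hf, _⟩ := glued_of_compatible p q hc
    exact h ⟨f, hf⟩
  simp only [compDiagram, hex, dif_neg, not_false_eq_true]

theorem comap_retract {U V : Type*} (S : Setoid V) {r : U → V} {e : V → U} (h : r ∘ e = id) :
    (S.comap r).comap e = S := by
  ext a b
  change S ((r ∘ e) a) ((r ∘ e) b) ↔ S a b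
  rw [h]; rfl

theorem missed_retract {U V : Type*} (S : Setoid V) {r : U → V} {e : V → U} (h : r ∘ e = id) :
    Nat.card (Missed (S.comap r) e) = 0 := by
  have : IsEmpty (Missed (S.comap r) e) := by
    refine ⟨fun ⟨c, hc⟩ => ?_⟩
    induction c using Quotient.inductionOn with
    | h x =>
      refine hc (r x) (Quotient.sound ?_)
      change S ((r ∘ e) (r x)) (r x)
      rw [h]; exact S.refl _
  exact Nat.card_of_isEmpty

/-! Identity diagrams. -/

/-- The identity diagram: parts `{a, a'}`, all labels `1`. -/
def idDiagram (G : Type v) [Group G] (A : Type w) : GDiagram G (A ⊕ A) :=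
  GDiagram.mk (Setoid.ker (Sum.elim id id)) (fun _ => 1)

theorem stack_id_left (P : Setoid (A ⊕ B)) :
    stack (Setoid.ker (Sum.elim id id)) P = P.comap (Sum.elim Sum.inl id) := by
  apply le_antisymm
  · refine sup_le (map_le_iff.2 ?_) (map_le_iff.2 fun a b h => h)
    rintro (a | a) (b | b) h <;> cases (show a = b from h) <;> exact P.refl _
  · have key : ∀ x : A ⊕ (A ⊕ B), stack (Setoid.ker (Sum.elim id id)) P x
        (upper (Sum.elim Sum.inl id x : A ⊕ B)) := by
      rintro (a | x)
      · exact stack_lower (a := Sum.inl a) (b := Sum.inr a) rfl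
      · exact Setoid.refl' _ _
    intro x y h
    exact Setoid.trans' _ (key x) (Setoid.trans' _ (stack_upper h) (Setoid.symm' _ (key y)))

theorem stack_id_right (P : Setoid (A ⊕ B)) :
    stack P (Setoid.ker (Sum.elim id id)) =
      P.comap (Sum.elim Sum.inl (Sum.elim Sum.inr Sum.inr)) := by
  apply le_antisymm
  · refine sup_le (map_le_iff.2 ?_) (map_le_iff.2 ?_)
    · rintro (a | a) (b | b) h <;> exact h
    · rintro (a | a) (b | b) h <;> cases (show a = b from h) <;> exact P.refl _
  · have key : ∀ x : A ⊕ (B ⊕ B), stack P (Setoid.ker (Sum.elim id id)) x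
        (lower (Sum.elim Sum.inl (Sum.elim Sum.inr Sum.inr) x : A ⊕ B)) := by
      rintro (a | a | a)
      · exact Setoid.refl' _ _
      · exact Setoid.refl' _ _
      · exact stack_upper (a := Sum.inr a) (b := Sum.inl a) rfl
    intro x y h
    exact Setoid.trans' _ (key x) (Setoid.trans' _ (stack_lower h) (Setoid.symm' _ (key y)))

theorem id_compDiagram (d : k) (X : GDiagram G (A ⊕ B)) :
    compDiagram d (idDiagram G A) X = Finsupp.single X 1 := by
  obtain ⟨g, hg⟩ := X.exists_label
  have hgl : Glued (idDiagram G A) X (g ∘ Sum.elim Sum.inl id) := by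
    refine ⟨GDiagram.isLabel_mk.2 ⟨g ∘ Sum.inl ∘ Sum.elim id id, ?_, ?_⟩, hg⟩
    · intro a b h
      simp only [Function.comp]
      rw [show Sum.elim id id a = Sum.elim id id b from h]
    · rintro (a | a) <;> simp [lower]
  rw [compDiagram_of_glued d hgl]
  have hs : stack (idDiagram G A).part X.part = X.part.comap (Sum.elim Sum.inl id) :=
    stack_id_left _
  have ho : (Sum.elim Sum.inl id : A ⊕ (A ⊕ B) → A ⊕ B) ∘ outer = id := by
    funext x; rcases x with a | b <;> rfl
  congr 1
  · refine GDiagram.ext_label (g := g) ?_ ?_ hg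
    · rw [GDiagram.part_mk, starPart, hs]
      exact comap_retract _ ho
    · rw [Function.comp_assoc, ho]; exact GDiagram.isLabel_mk_self _ _
  · have : alpha (idDiagram G A).part X.part = 0 := by
      unfold alpha
      rw [hs]
      exact missed_retract _ ho
    rw [this, pow_zero]

theorem compDiagram_id (d : k) (X : GDiagram G (A ⊕ B)) :
    compDiagram d X (idDiagram G B) = Finsupp.single X 1 := by
  obtain ⟨g, hg⟩ := X.exists_label
  have hgl : Glued X (idDiagram G B) (g ∘ Sum.elim Sum.inl (Sum.elim Sum.inr Sum.inr)) := by
    refine ⟨?_, GDiagram.isLabel_mk.2 ⟨g ∘ Sum.inr ∘ Sum.elim id id, ?_, ?_⟩⟩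
    · have : (g ∘ Sum.elim Sum.inl (Sum.elim Sum.inr Sum.inr)) ∘ (lower : A ⊕ B → A ⊕ (B ⊕ B)) =
          g := by
        funext x; rcases x with a | b <;> rfl
      rw [this]; exact hg
    · intro a b h
      simp only [Function.comp]
      rw [show Sum.elim id id a = Sum.elim id id b from h]
    · rintro (a | a) <;> simp [upper]
  rw [compDiagram_of_glued d hgl]
  have hs : stack X.part (idDiagram G B).part =
      X.part.comap (Sum.elim Sum.inl (Sum.elim Sum.inr Sum.inr)) := stack_id_right _
  have ho : (Sum.elim Sum.inl (Sum.elim Sum.inr Sum.inr) : A ⊕ (B ⊕ B) → A ⊕ B) ∘ outer = id := by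
    funext x; rcases x with a | b <;> rfl
  congr 1
  · refine GDiagram.ext_label (g := g) ?_ ?_ hg
    · rw [GDiagram.part_mk, starPart, hs]
      exact comap_retract _ ho
    · rw [Function.comp_assoc, ho]; exact GDiagram.isLabel_mk_self _ _
  · have : alpha X.part (idDiagram G B).part = 0 := by
      unfold alpha
      rw [hs]
      exact missed_retract _ ho
    rw [this, pow_zero]

/-! Associativity. -/

theorem missed_glue {T W U V Z : Type*} [Finite U] [Finite W] {tW : T → W} {tU : T → U}
    {j : W → V} {i : U → V}
    (hcomm : ∀ x, j (tW x) = i (tU x))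
    (hi : Function.Injective i) (hj : Function.Injective j)
    (hcov : ∀ x, (∃ a, x = i a) ∨ ∃ b, x = j b)
    (hpb : ∀ a b, i a = j b → ∃ x, a = tU x ∧ b = tW x)
    {S : Setoid W} {R : Setoid U} {K : Setoid V} (hK : K = S.map j ⊔ R.map i) (e : Z → U) :
    K.comap i = (S.comap tW).map tU ⊔ R ∧
    Nat.card (Missed K (i ∘ e)) =
      Nat.card (Missed S tW) + Nat.card (Missed ((S.comap tW).map tU ⊔ R) e) := by
  obtain ⟨E, hE⟩ := glue_equiv tW tU j i hcomm hi hj hcov hpb S R K hK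
  constructor
  · ext a b
    change K (i a) (i b) ↔ _
    rw [← Quotient.eq (r := K), ← Quotient.eq (r := (S.comap tW).map tU ⊔ R),
      ← E.injective.eq_iff, hE, hE, Sum.inl.injEq]
  · have : Missed K (i ∘ e) ≃ Missed ((S.comap tW).map tU ⊔ R) e ⊕ Missed S tW := by
      refine (E.subtypeEquiv (q := fun c => ∀ x, Sum.inl (Quotient.mk _ (e x)) ≠ c)
        fun c => ?_).trans ⟨fun c => ?_, fun c => ?_, ?_, ?_⟩
      · simp only [Function.comp, ← hE]
        exact forall_congr' fun x => not_congr E.injective.eq_iff.symm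
      · rcases c with ⟨c | c, hc⟩
        · exact Sum.inl ⟨c, fun x hx => hc x (congrArg Sum.inl hx)⟩
        · exact Sum.inr c
      · rcases c with c | c
        · exact ⟨Sum.inl c.1, fun x hx => c.2 x (Sum.inl.inj hx)⟩
        · exact ⟨Sum.inr c, fun x hx => by cases hx⟩
      · rintro ⟨c | c, hc⟩ <;> rfl
      · rintro (c | c) <;> rfl
    have f1 : Finite (Missed S tW) := Subtype.finite
    have f2 : Finite (Missed ((S.comap tW).map tU ⊔ R) e) := Subtype.finite
    rw [Nat.card_congr this, Nat.card_sum, add_comm]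

/-- Connectedness in a four-row diagram. -/
def stack₄ (P : Setoid (A ⊕ B)) (Q : Setoid (B ⊕ C)) (R : Setoid (C ⊕ D)) :
    Setoid (A ⊕ (B ⊕ (C ⊕ D))) :=
  P.map (Sum.map id Sum.inl) ⊔ Q.map (Sum.inr ∘ lower) ⊔ R.map (Sum.inr ∘ Sum.inr)

/-- Rows 1, 2, 3 of four. -/
def rows₁₂₃ : A ⊕ (B ⊕ C) → A ⊕ (B ⊕ (C ⊕ D)) := Sum.map id (Sum.map id Sum.inl)
/-- Rows 1, 3, 4 of four. -/
def rows₁₃₄ : A ⊕ (C ⊕ D) → A ⊕ (B ⊕ (C ⊕ D)) := Sum.map id Sum.inr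
/-- Rows 1, 2, 4 of four. -/
def rows₁₂₄ : A ⊕ (B ⊕ D) → A ⊕ (B ⊕ (C ⊕ D)) := Sum.map id (Sum.map id Sum.inr)
/-- Rows 2, 3, 4 of four. -/
def rows₂₃₄ : B ⊕ (C ⊕ D) → A ⊕ (B ⊕ (C ⊕ D)) := Sum.inr

theorem stack₄_left [Finite A] [Finite B] [Finite C] [Finite D]
    (P : Setoid (A ⊕ B)) (Q : Setoid (B ⊕ C)) (R : Setoid (C ⊕ D)) :
    (stack₄ P Q R).comap rows₁₃₄ = stack (starPart P Q) R ∧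
    Nat.card (Missed (stack₄ P Q R) (rows₁₃₄ ∘ outer)) = alpha P Q + alpha (starPart P Q) R := by
  refine missed_glue (tW := outer) (tU := lower) (j := rows₁₂₃) ?_ ?_ ?_ ?_ ?_ ?_ outer
  · rintro (a | c) <;> rfl
  · exact Sum.map_injective.2 ⟨Function.injective_id, Sum.inr_injective⟩
  · exact Sum.map_injective.2 ⟨Function.injective_id,
      Sum.map_injective.2 ⟨Function.injective_id, Sum.inl_injective⟩⟩
  · rintro (a | b | c | e)
    · exact Or.inl ⟨Sum.inl a, rfl⟩
    · exact Or.inr ⟨Sum.inr (Sum.inl b), rfl⟩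
    · exact Or.inl ⟨Sum.inr (Sum.inl c), rfl⟩
    · exact Or.inl ⟨Sum.inr (Sum.inr e), rfl⟩
  · rintro (a | c | e) (a' | b | c') h <;> simp [rows₁₃₄, rows₁₂₃] at h
    · exact ⟨Sum.inl a, rfl, by simp [outer, h]⟩
    · exact ⟨Sum.inr c, rfl, by simp [outer, h]⟩
  · rw [stack₄, stack, map_sup, map_map, map_map, map_map]
    congr 2
    congr 1; funext x; rcases x with a | b <;> rfl

theorem stack₄_right [Finite A] [Finite B] [Finite C] [Finite D]
    (P : Setoid (A ⊕ B)) (Q : Setoid (B ⊕ C)) (R : Setoid (C ⊕ D)) :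
    (stack₄ P Q R).comap rows₁₂₄ = stack P (starPart Q R) ∧
    Nat.card (Missed (stack₄ P Q R) (rows₁₂₄ ∘ outer)) = alpha Q R + alpha P (starPart Q R) := by
  have := missed_glue (tW := (outer : B ⊕ D → B ⊕ (C ⊕ D))) (tU := (upper : B ⊕ D → A ⊕ (B ⊕ D)))
    (j := rows₂₃₄) (i := rows₁₂₄) (S := stack Q R) (R := P.map lower) (K := stack₄ P Q R)
    ?_ ?_ ?_ ?_ ?_ ?_ outer
  · rw [sup_comm] at this
    exact this
  · rintro (a | c) <;> rfl
  · exact Sum.map_injective.2 ⟨Function.injective_id,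
      Sum.map_injective.2 ⟨Function.injective_id, Sum.inr_injective⟩⟩
  · exact Sum.inr_injective
  · rintro (a | b | c | e)
    · exact Or.inl ⟨Sum.inl a, rfl⟩
    · exact Or.inl ⟨Sum.inr (Sum.inl b), rfl⟩
    · exact Or.inr ⟨Sum.inr (Sum.inl c), rfl⟩
    · exact Or.inl ⟨Sum.inr (Sum.inr e), rfl⟩
  · rintro (a | b | e) (b' | c | e') h <;> simp [rows₁₂₄, rows₂₃₄] at h
    · exact ⟨Sum.inl b, rfl, by simp [outer, h]⟩
    · exact ⟨Sum.inr e, rfl, by simp [outer, h]⟩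
  · rw [stack₄, stack, map_sup, map_map, map_map, map_map, sup_assoc, sup_comm]
    congr 2
    · funext x; rcases x with a | b <;> rfl

/-- A labelling of four rows restricting to labels of three diagrams. -/
def Glued₄ (X : GDiagram G (A ⊕ B)) (Y : GDiagram G (B ⊕ C)) (Z : GDiagram G (C ⊕ D))
    (f : A ⊕ (B ⊕ (C ⊕ D)) → G) : Prop :=
  Glued X Y (f ∘ rows₁₂₃) ∧ Glued Y Z (f ∘ rows₂₃₄)

variable (d : k)

theorem comp_left_eq [Finite A] [Finite B] [Finite C] [Finite D]
    {X : GDiagram G (A ⊕ B)} {Y : GDiagram G (B ⊕ C)} {Z : GDiagram G (C ⊕ D)}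
    {f : A ⊕ (B ⊕ (C ⊕ D)) → G} (h : Glued₄ X Y Z f) :
    (compDiagram d X Y).sum (fun W r => r • compDiagram d W Z) =
      Finsupp.single (GDiagram.mk (((stack₄ X.part Y.part Z.part).comap rows₁₃₄).comap outer)
        (f ∘ rows₁₃₄ ∘ outer))
        (d ^ Nat.card (Missed (stack₄ X.part Y.part Z.part) (rows₁₃₄ ∘ outer))) := by
  rw [compDiagram_of_glued d h.1, Finsupp.sum_single_index (by simp),
    compDiagram_of_glued d (f := f ∘ rows₁₃₄)]
  · rw [Finsupp.smul_single, smul_eq_mul, ← pow_add, GDiagram.part_mk,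
      (stack₄_left X.part Y.part Z.part).1, (stack₄_left X.part Y.part Z.part).2]
    rfl
  · refine ⟨?_, ?_⟩
    · have : (f ∘ rows₁₃₄) ∘ lower = (f ∘ rows₁₂₃) ∘ outer := by
        funext x; rcases x with a | b <;> rfl
      rw [this]; exact GDiagram.isLabel_mk_self _ _
    · exact h.2.2

theorem comp_right_eq [Finite A] [Finite B] [Finite C] [Finite D]
    {X : GDiagram G (A ⊕ B)} {Y : GDiagram G (B ⊕ C)} {Z : GDiagram G (C ⊕ D)}
    {f : A ⊕ (B ⊕ (C ⊕ D)) → G} (h : Glued₄ X Y Z f) :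
    (compDiagram d Y Z).sum (fun W r => r • compDiagram d X W) =
      Finsupp.single (GDiagram.mk (((stack₄ X.part Y.part Z.part).comap rows₁₂₄).comap outer)
        (f ∘ rows₁₂₄ ∘ outer))
        (d ^ Nat.card (Missed (stack₄ X.part Y.part Z.part) (rows₁₂₄ ∘ outer))) := by
  rw [compDiagram_of_glued d h.2, Finsupp.sum_single_index (by simp),
    compDiagram_of_glued d (f := f ∘ rows₁₂₄)]
  · rw [Finsupp.smul_single, smul_eq_mul, ← pow_add, GDiagram.part_mk,
      (stack₄_right X.part Y.part Z.part).1, (stack₄_right X.part Y.part Z.part).2]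
    rfl
  · refine ⟨?_, ?_⟩
    · have : (f ∘ rows₁₂₄) ∘ lower = (f ∘ rows₁₂₃) ∘ lower := by
        funext x; rcases x with a | b <;> rfl
      rw [this]; exact h.1.1
    · have : (f ∘ rows₁₂₄) ∘ upper = (f ∘ rows₂₃₄) ∘ outer := by
        funext x; rcases x with a | b <;> rfl
      rw [this]; exact GDiagram.isLabel_mk_self _ _

/-- If the labels of the outer rows of a composite are changed, the labels inside can be
changed accordingly. -/
theorem exists_glued_of_outer {X : GDiagram G (A ⊕ B)} {Y : GDiagram G (B ⊕ C)}
    {f : A ⊕ (B ⊕ C) → G} (h : Glued X Y f) {g : A ⊕ C → G}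
    (hg : (GDiagram.mk (starPart X.part Y.part) (f ∘ outer)).IsLabel g) :
    ∃ f', Glued X Y f' ∧ f' ∘ outer = g := by
  obtain ⟨s, hs, es⟩ := GDiagram.isLabel_mk.1 hg
  obtain ⟨t, ht, et⟩ := exists_extension (stack X.part Y.part) outer s fun x y hxy => hs x y hxy
  refine ⟨fun a => t a * f a, ⟨?_, ?_⟩, ?_⟩
  · exact h.1.twist (t ∘ lower) fun a b hab => ht _ _ (stack_lower hab)
  · exact h.2.twist (t ∘ upper) fun a b hab => ht _ _ (stack_upper hab)
  · funext x
    simp only [Function.comp, et]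
    exact (es x).symm

theorem comp_assoc_diagram [Finite A] [Finite B] [Finite C] [Finite D]
    (X : GDiagram G (A ⊕ B)) (Y : GDiagram G (B ⊕ C)) (Z : GDiagram G (C ⊕ D)) :
    (compDiagram d X Y).sum (fun W r => r • compDiagram d W Z) =
      (compDiagram d Y Z).sum (fun W r => r • compDiagram d X W) := by
  by_cases hF : ∃ f, Glued₄ X Y Z f
  · obtain ⟨f, hf⟩ := hF
    rw [comp_left_eq d hf, comp_right_eq d hf]
    have : (rows₁₃₄ ∘ outer : A ⊕ D → A ⊕ (B ⊕ (C ⊕ D))) = rows₁₂₄ ∘ outer := by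
      funext x; rcases x with a | b <;> rfl
    have hc : ((stack₄ X.part Y.part Z.part).comap rows₁₃₄).comap outer =
        ((stack₄ X.part Y.part Z.part).comap rows₁₂₄).comap outer := by
      change (stack₄ X.part Y.part Z.part).comap (rows₁₃₄ ∘ outer) =
        (stack₄ X.part Y.part Z.part).comap (rows₁₂₄ ∘ outer)
      rw [this]
    rw [hc, this]
  · have h1 : (compDiagram d X Y).sum (fun W r => r • compDiagram d W Z) = 0 := by
      by_cases h : ∃ f, Glued X Y f
      · obtain ⟨f, hf⟩ := h
        rw [compDiagram_of_glued d hf, Finsupp.sum_single_index (by simp),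
          compDiagram_of_not_glued, smul_zero]
        rintro ⟨f', hf'1, hf'2⟩
        obtain ⟨f'', h'', e''⟩ := exists_glued_of_outer hf hf'1
        refine hF ⟨Sum.elim (f'' ∘ Sum.inl) (Sum.elim (f'' ∘ Sum.inr ∘ Sum.inl) (f' ∘ Sum.inr)),
          ?_, ?_, ?_⟩
        · convert h'' using 1
          funext x; rcases x with a | b | c
          · rfl
          · rfl
          · exact (congrFun e'' (Sum.inr c)).symm
        · convert h''.2 using 1
          funext x; rcases x with b | c
          · rfl
          · exact (congrFun e'' (Sum.inr c)).symm
        · exact hf'2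
      · rw [compDiagram_of_not_glued d h, Finsupp.sum_zero_index]
    have h2 : (compDiagram d Y Z).sum (fun W r => r • compDiagram d X W) = 0 := by
      by_cases h : ∃ f, Glued Y Z f
      · obtain ⟨f, hf⟩ := h
        rw [compDiagram_of_glued d hf, Finsupp.sum_single_index (by simp),
          compDiagram_of_not_glued, smul_zero]
        rintro ⟨f', hf'1, hf'2⟩
        obtain ⟨f'', h'', e''⟩ := exists_glued_of_outer hf hf'2
        refine hF ⟨Sum.elim (f' ∘ Sum.inl) f'', ⟨?_, ?_⟩, h''⟩
        · convert hf'1 using 1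
          funext x; rcases x with a | b
          · rfl
          · exact congrFun e'' (Sum.inl b)
        · exact h''.1
      · rw [compDiagram_of_not_glued d h, Finsupp.sum_zero_index]
    rw [h1, h2]

end CompAux

/-! ### Horizontal juxtaposition of diagrams -/

section Tensor

variable {G : Type v} [Group G] {k : Type u} [CommRing k]

/-- The vertices of the left-hand diagram in a juxtaposition (vertices of a row are numbered
`0, 1, 2, …` from left to right). -/
def leftV {a b : ℕ} (c d : ℕ) : Fin a ⊕ Fin b → Fin (a + c) ⊕ Fin (b + d) :=
  Sum.map (Fin.castAdd c) (Fin.castAdd d)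

/-- The vertices of the right-hand diagram in a juxtaposition. -/
def rightV (a b : ℕ) {c d : ℕ} : Fin c ⊕ Fin d → Fin (a + c) ⊕ Fin (b + d) :=
  Sum.map (Fin.natAdd a) (Fin.natAdd b)

/-- The function on the vertices of a juxtaposition that is `f` on the left and `g` on the right. -/
def juxt {T : Type*} {a b c d : ℕ} (f : Fin a ⊕ Fin b → T) (g : Fin c ⊕ Fin d → T) :
    Fin (a + c) ⊕ Fin (b + d) → T :=
  Sum.elim (Fin.append (f ∘ Sum.inl) (g ∘ Sum.inl)) (Fin.append (f ∘ Sum.inr) (g ∘ Sum.inr))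

section
variable {T : Type*} {a b c d : ℕ}

@[simp] theorem juxt_leftV (f : Fin a ⊕ Fin b → T) (g : Fin c ⊕ Fin d → T) (x) :
    juxt f g (leftV c d x) = f x := by
  rcases x with x | x <;> simp [juxt, leftV]

@[simp] theorem juxt_rightV (f : Fin a ⊕ Fin b → T) (g : Fin c ⊕ Fin d → T) (x) :
    juxt f g (rightV a b x) = g x := by
  rcases x with x | x <;> simp [juxt, rightV]

theorem cover_fin (x : Fin (a + c)) : (∃ y, x = Fin.castAdd c y) ∨ ∃ y, x = Fin.natAdd a y := by
  induction x using Fin.addCases with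
  | left y => exact Or.inl ⟨y, rfl⟩
  | right y => exact Or.inr ⟨y, rfl⟩

theorem cover_juxt (x : Fin (a + c) ⊕ Fin (b + d)) :
    (∃ y, x = leftV c d y) ∨ ∃ y, x = rightV a b y := by
  rcases x with x | x
  · rcases cover_fin x with ⟨y, rfl⟩ | ⟨y, rfl⟩
    · exact Or.inl ⟨Sum.inl y, rfl⟩
    · exact Or.inr ⟨Sum.inl y, rfl⟩
  · rcases cover_fin x with ⟨y, rfl⟩ | ⟨y, rfl⟩
    · exact Or.inl ⟨Sum.inr y, rfl⟩
    · exact Or.inr ⟨Sum.inr y, rfl⟩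

end

/-- The partition obtained by juxtaposing two partitions. -/
def juxtPart {a b c d : ℕ} (P : Setoid (Fin a ⊕ Fin b)) (Q : Setoid (Fin c ⊕ Fin d)) :
    Setoid (Fin (a + c) ⊕ Fin (b + d)) :=
  P.map (leftV c d) ⊔ Q.map (rightV a b)

theorem juxtPart_const {T : Type*} {a b c d : ℕ} {P : Setoid (Fin a ⊕ Fin b)}
    {Q : Setoid (Fin c ⊕ Fin d)} (t : Fin (a + c) ⊕ Fin (b + d) → T)
    (hP : ∀ x y, P x y → t (leftV c d x) = t (leftV c d y))
    (hQ : ∀ x y, Q x y → t (rightV a b x) = t (rightV a b y)) :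
    ∀ x y, juxtPart P Q x y → t x = t y := by
  have : juxtPart P Q ≤ Setoid.ker t :=
    sup_le (map_le_iff.2 fun a b h => hP a b h) (map_le_iff.2 fun a b h => hQ a b h)
  exact fun a b h => this h

theorem juxtPart_left {a b c d : ℕ} {P : Setoid (Fin a ⊕ Fin b)} {Q : Setoid (Fin c ⊕ Fin d)}
    {x y : Fin a ⊕ Fin b} (h : P x y) : juxtPart P Q (leftV c d x) (leftV c d y) :=
  (le_sup_left : P.map _ ≤ _) (map_rel h)

theorem juxtPart_right {a b c d : ℕ} {P : Setoid (Fin a ⊕ Fin b)} {Q : Setoid (Fin c ⊕ Fin d)}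
    {x y : Fin c ⊕ Fin d} (h : Q x y) : juxtPart P Q (rightV a b x) (rightV a b y) :=
  (le_sup_right : Q.map _ ≤ _) (map_rel h)

/-- Horizontal juxtaposition `X ⊗ Y` of diagrams, `X` on the left and `Y` on the right. -/
def tensorDiagram {a b c d : ℕ} (X : GDiagram G (Fin a ⊕ Fin b)) (Y : GDiagram G (Fin c ⊕ Fin d)) :
    GDiagram G (Fin (a + c) ⊕ Fin (b + d)) :=
  Quotient.map₂ (fun x y => ⟨juxtPart x.part y.part, juxt x.label y.label⟩) (by
    rintro x x' ⟨hx, s, hs, es⟩ y y' ⟨hy, t, ht, et⟩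
    refine ⟨by rw [hx, hy], juxt s t, ?_, ?_⟩
    · exact juxtPart_const _ (fun _ _ h => by simpa using hs _ _ h)
        (fun _ _ h => by simpa using ht _ _ h)
    · intro v
      rcases cover_juxt v with ⟨y, rfl⟩ | ⟨y, rfl⟩ <;> simp [es, et]) X Y

theorem tensorDiagram_part {a b c d : ℕ} (X : GDiagram G (Fin a ⊕ Fin b))
    (Y : GDiagram G (Fin c ⊕ Fin d)) :
    (tensorDiagram X Y).part = juxtPart X.part Y.part := by
  induction X using Quotient.inductionOn
  induction Y using Quotient.inductionOn
  rfl

theorem tensorDiagram_isLabel {a b c d : ℕ} {X : GDiagram G (Fin a ⊕ Fin b)}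
    {Y : GDiagram G (Fin c ⊕ Fin d)} {f : Fin (a + c) ⊕ Fin (b + d) → G} :
    (tensorDiagram X Y).IsLabel f ↔ X.IsLabel (f ∘ leftV c d) ∧ Y.IsLabel (f ∘ rightV a b) := by
  obtain ⟨g, hg⟩ := X.exists_label
  obtain ⟨h, hh⟩ := Y.exists_label
  have hT : (tensorDiagram X Y).IsLabel (juxt g h) := by
    unfold GDiagram.IsLabel
    rw [tensorDiagram_part]
    conv_lhs => rw [hg, hh]
    rfl
  rw [hT.iff, hg.iff, hh.iff, tensorDiagram_part]
  constructor
  · rintro ⟨t, ht, et⟩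
    exact ⟨⟨t ∘ leftV c d, fun x y hxy => ht _ _ (juxtPart_left hxy), fun x => by simp [et]⟩,
      ⟨t ∘ rightV a b, fun x y hxy => ht _ _ (juxtPart_right hxy), fun x => by simp [et]⟩⟩
  · rintro ⟨⟨s, hs, es⟩, ⟨t, ht, et⟩⟩
    refine ⟨juxt s t, juxtPart_const _ (fun _ _ h => by simpa using hs _ _ h)
        (fun _ _ h => by simpa using ht _ _ h), ?_⟩
    intro v
    rcases cover_juxt v with ⟨y, rfl⟩ | ⟨y, rfl⟩
    · simpa using es y
    · simpa using et y

/-! Disjoint unions of partitions. -/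

theorem disjoint_rel {U U' V : Type*} {l : U → V} {r : U' → V}
    (hl : Function.Injective l) (hr : Function.Injective r)
    (hcov : ∀ x, (∃ a, x = l a) ∨ ∃ b, x = r b) (hd : ∀ a b, l a ≠ r b)
    (S : Setoid U) (S' : Setoid U') :
    (∀ a b, (S.map l ⊔ S'.map r) (l a) (l b) ↔ S a b) ∧
    (∀ a b, (S.map l ⊔ S'.map r) (r a) (r b) ↔ S' a b) ∧
    (∀ a b, ¬ (S.map l ⊔ S'.map r) (l a) (r b)) := by
  classical
  let φ : V → Quotient S ⊕ Quotient S' := fun x =>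
    if h : ∃ a, x = l a then Sum.inl (Quotient.mk S h.choose)
    else Sum.inr (Quotient.mk S' ((hcov x).resolve_left h).choose)
  have hφl : ∀ a, φ (l a) = Sum.inl (Quotient.mk S a) := by
    intro a
    have h : ∃ b, l a = l b := ⟨a, rfl⟩
    simp only [φ, h, dif_pos]
    rw [← hl h.choose_spec]
  have hφr : ∀ a, φ (r a) = Sum.inr (Quotient.mk S' a) := by
    intro a
    have h : ¬ ∃ b, r a = l b := fun ⟨b, hb⟩ => hd b a hb.symm
    simp only [φ, h, dif_neg, not_false_eq_true]
    rw [← hr ((hcov (r a)).resolve_left h).choose_spec]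
  have hK : S.map l ⊔ S'.map r ≤ Setoid.ker φ := by
    refine sup_le (map_le_iff.2 fun a b h => ?_) (map_le_iff.2 fun a b h => ?_)
    · change φ _ = φ _
      rw [hφl, hφl, Quotient.sound h]
    · change φ _ = φ _
      rw [hφr, hφr, Quotient.sound h]
  refine ⟨fun a b => ⟨fun h => ?_, fun h => (le_sup_left : S.map l ≤ _) (map_rel h)⟩,
    fun a b => ⟨fun h => ?_, fun h => (le_sup_right : S'.map r ≤ _) (map_rel h)⟩,
    fun a b h => ?_⟩
  · have := hK h
    change φ _ = φ _ at this
    rw [hφl, hφl, Sum.inl.injEq] at this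
    exact Quotient.exact this
  · have := hK h
    change φ _ = φ _ at this
    rw [hφr, hφr, Sum.inr.injEq] at this
    exact Quotient.exact this
  · have := hK h
    change φ _ = φ _ at this
    rw [hφl, hφr] at this
    cases this

/-- Restriction of a disjoint union, and the number of missed classes. -/
theorem disjoint_restrict {U U' V Z Z' Y : Type*} [Finite U] [Finite U'] {l : U → V} {r : U' → V}
    (hl : Function.Injective l) (hr : Function.Injective r)
    (hcov : ∀ x, (∃ a, x = l a) ∨ ∃ b, x = r b) (hd : ∀ a b, l a ≠ r b)
    {lY : Z → Y} {rY : Z' → Y} (hcovY : ∀ x, (∃ a, x = lY a) ∨ ∃ b, x = rY b)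
    (hlY : Function.Injective lY) (hrY : Function.Injective rY) (hdY : ∀ a b, lY a ≠ rY b)
    {e : Y → V} {eU : Z → U} {eU' : Z' → U'} (he : ∀ x, e (lY x) = l (eU x))
    (he' : ∀ x, e (rY x) = r (eU' x)) (S : Setoid U) (S' : Setoid U') :
    (S.map l ⊔ S'.map r).comap e = (S.comap eU).map lY ⊔ (S'.comap eU').map rY ∧
    Nat.card (Missed (S.map l ⊔ S'.map r) e) =
      Nat.card (Missed S eU) + Nat.card (Missed S' eU') := by
  obtain ⟨h1, h2, h3⟩ := disjoint_rel hl hr hcov hd S S'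
  obtain ⟨g1, g2, g3⟩ := disjoint_rel hlY hrY hcovY hdY (S.comap eU) (S'.comap eU')
  constructor
  · ext x y
    change (S.map l ⊔ S'.map r) (e x) (e y) ↔ _
    rcases hcovY x with ⟨x, rfl⟩ | ⟨x, rfl⟩ <;> rcases hcovY y with ⟨y, rfl⟩ | ⟨y, rfl⟩
    · rw [he, he, h1, g1]; rfl
    · rw [he, he']; exact iff_of_false (h3 _ _) (g3 _ _)
    · rw [he, he']
      exact iff_of_false (fun h => h3 _ _ (Setoid.symm' _ h)) (fun h => g3 _ _ (Setoid.symm' _ h))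
    · rw [he', he', h2, g2]; rfl
  · have f1 : Finite (Missed S eU) := Subtype.finite
    have f2 : Finite (Missed S' eU') := Subtype.finite
    rw [← Nat.card_sum]
    symm
    refine Nat.card_congr (Equiv.ofBijective (Sum.elim
      (fun c => ⟨Quotient.lift (fun a => Quotient.mk (S.map l ⊔ S'.map r) (l a))
        (fun a b h => Quotient.sound ((h1 a b).2 h)) c.1, ?_⟩)
      (fun c => ⟨Quotient.lift (fun a => Quotient.mk (S.map l ⊔ S'.map r) (r a))
        (fun a b h => Quotient.sound ((h2 a b).2 h)) c.1, ?_⟩)) ⟨?_, ?_⟩)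
    · obtain ⟨c, hc⟩ := c
      induction c using Quotient.inductionOn with
      | h c =>
        intro x hx
        have hx : (S.map l ⊔ S'.map r) (e x) (l c) := Quotient.exact hx
        rcases hcovY x with ⟨x, rfl⟩ | ⟨x, rfl⟩
        · rw [he, h1] at hx
          exact hc x (Quotient.sound hx)
        · rw [he'] at hx
          exact h3 _ _ (Setoid.symm' _ hx)
    · obtain ⟨c, hc⟩ := c
      induction c using Quotient.inductionOn with
      | h c =>
        intro x hx
        have hx : (S.map l ⊔ S'.map r) (e x) (r c) := Quotient.exact hx
        rcases hcovY x with ⟨x, rfl⟩ | ⟨x, rfl⟩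
        · rw [he] at hx
          exact h3 _ _ hx
        · rw [he', h2] at hx
          exact hc x (Quotient.sound hx)
    · rintro (⟨c, hc⟩ | ⟨c, hc⟩) (⟨c', hc'⟩ | ⟨c', hc'⟩) h <;>
        induction c using Quotient.inductionOn <;> induction c' using Quotient.inductionOn
      · exact congrArg Sum.inl (Subtype.ext (Quotient.sound
          ((h1 _ _).1 (Quotient.exact (Subtype.ext_iff.1 h)))))
      · exact (h3 _ _ (Quotient.exact (Subtype.ext_iff.1 h))).elim
      · exact (h3 _ _ (Setoid.symm' _ (Quotient.exact (Subtype.ext_iff.1 h)))).elim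
      · exact congrArg Sum.inr (Subtype.ext (Quotient.sound
          ((h2 _ _).1 (Quotient.exact (Subtype.ext_iff.1 h)))))
    · rintro ⟨c, hc⟩
      induction c using Quotient.inductionOn with
      | h c =>
        rcases hcov c with ⟨c, rfl⟩ | ⟨c, rfl⟩
        · refine ⟨Sum.inl ⟨Quotient.mk _ c, fun x hx => hc (lY x) ?_⟩, rfl⟩
          rw [he]
          exact Quotient.sound ((h1 _ _).2 (Quotient.exact hx))
        · refine ⟨Sum.inr ⟨Quotient.mk _ c, fun x hx => hc (rY x) ?_⟩, rfl⟩
          rw [he']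
          exact Quotient.sound ((h2 _ _).2 (Quotient.exact hx))

section Interchange

variable {a b c a' b' c' : ℕ}

/-- The left-hand half of a juxtaposition of three-row diagrams. -/
def leftV₃ (a' b' c' : ℕ) : Fin a ⊕ (Fin b ⊕ Fin c) → Fin (a + a') ⊕ (Fin (b + b') ⊕ Fin (c + c')) :=
  Sum.map (Fin.castAdd a') (leftV b' c')

/-- The right-hand half of a juxtaposition of three-row diagrams. -/
def rightV₃ (a b c : ℕ) :
    Fin a' ⊕ (Fin b' ⊕ Fin c') → Fin (a + a') ⊕ (Fin (b + b') ⊕ Fin (c + c')) :=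
  Sum.map (Fin.natAdd a) (rightV b c)

theorem leftV_injective : Function.Injective (leftV a' b' : Fin a ⊕ Fin b → _) :=
  Sum.map_injective.2 ⟨Fin.castAdd_injective _ _, Fin.castAdd_injective _ _⟩

theorem rightV_injective : Function.Injective (rightV a b : Fin a' ⊕ Fin b' → _) :=
  Sum.map_injective.2 ⟨Fin.natAdd_injective _ _, Fin.natAdd_injective _ _⟩

theorem castAdd_ne_natAdd (x : Fin a) (y : Fin a') : Fin.castAdd a' x ≠ Fin.natAdd a y := by
  intro h
  have := congrArg Fin.val h
  simp at this
  omega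

theorem leftV_ne_rightV (x : Fin a ⊕ Fin b) (y : Fin a' ⊕ Fin b') :
    leftV a' b' x ≠ rightV a b y := by
  rcases x with x | x <;> rcases y with y | y <;> simp [leftV, rightV, castAdd_ne_natAdd]

theorem stack_juxt (P : Setoid (Fin a ⊕ Fin b)) (Q : Setoid (Fin b ⊕ Fin c))
    (P' : Setoid (Fin a' ⊕ Fin b')) (Q' : Setoid (Fin b' ⊕ Fin c')) :
    stack (juxtPart P P') (juxtPart Q Q') =
      (stack P Q).map (leftV₃ a' b' c') ⊔ (stack P' Q').map (rightV₃ a b c) := by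
  have e1 : lower ∘ leftV a' b' =
      leftV₃ a' b' c' ∘ (lower : Fin a ⊕ Fin b → Fin a ⊕ (Fin b ⊕ Fin c)) := by
    funext x; rcases x with x | x <;> rfl
  have e2 : lower ∘ rightV a b =
      rightV₃ a b c ∘ (lower : Fin a' ⊕ Fin b' → Fin a' ⊕ (Fin b' ⊕ Fin c')) := by
    funext x; rcases x with x | x <;> rfl
  simp only [stack, juxtPart, map_sup, map_map]
  rw [sup_sup_sup_comm, e1, e2]
  rfl

theorem star_juxt (P : Setoid (Fin a ⊕ Fin b)) (Q : Setoid (Fin b ⊕ Fin c))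
    (P' : Setoid (Fin a' ⊕ Fin b')) (Q' : Setoid (Fin b' ⊕ Fin c')) :
    starPart (juxtPart P P') (juxtPart Q Q') = juxtPart (starPart P Q) (starPart P' Q') ∧
    alpha (juxtPart P P') (juxtPart Q Q') = alpha P Q + alpha P' Q' := by
  unfold starPart alpha
  rw [stack_juxt]
  refine disjoint_restrict ?_ ?_ ?_ ?_ ?_ ?_ ?_ ?_ ?_ ?_ _ _
  · exact Sum.map_injective.2 ⟨Fin.castAdd_injective _ _, leftV_injective⟩
  · exact Sum.map_injective.2 ⟨Fin.natAdd_injective _ _, rightV_injective⟩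
  · rintro (x | x)
    · rcases cover_fin x with ⟨y, rfl⟩ | ⟨y, rfl⟩
      · exact Or.inl ⟨Sum.inl y, rfl⟩
      · exact Or.inr ⟨Sum.inl y, rfl⟩
    · rcases cover_juxt x with ⟨y, rfl⟩ | ⟨y, rfl⟩
      · exact Or.inl ⟨Sum.inr y, rfl⟩
      · exact Or.inr ⟨Sum.inr y, rfl⟩
  · rintro (x | x) (y | y) <;> simp [leftV₃, rightV₃, castAdd_ne_natAdd, leftV_ne_rightV]
  · exact cover_juxt
  · exact leftV_injective
  · exact rightV_injective
  · exact leftV_ne_rightV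
  · rintro (x | x) <;> rfl
  · rintro (x | x) <;> rfl

theorem glued_tensor {X : GDiagram G (Fin a ⊕ Fin b)} {Y : GDiagram G (Fin b ⊕ Fin c)}
    {X' : GDiagram G (Fin a' ⊕ Fin b')} {Y' : GDiagram G (Fin b' ⊕ Fin c')}
    {f : Fin (a + a') ⊕ (Fin (b + b') ⊕ Fin (c + c')) → G} :
    Glued (tensorDiagram X X') (tensorDiagram Y Y') f ↔
      Glued X Y (f ∘ leftV₃ a' b' c') ∧ Glued X' Y' (f ∘ rightV₃ a b c) := by
  unfold Glued
  rw [tensorDiagram_isLabel, tensorDiagram_isLabel]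
  have e1 : (f ∘ lower) ∘ leftV a' b' = (f ∘ leftV₃ a' b' c') ∘ (lower : Fin a ⊕ Fin b → _) := by
    funext x; rcases x with x | x <;> rfl
  have e2 : (f ∘ lower) ∘ rightV a b = (f ∘ rightV₃ a b c) ∘ (lower : Fin a' ⊕ Fin b' → _) := by
    funext x; rcases x with x | x <;> rfl
  have e3 : (f ∘ upper) ∘ leftV b' c' = (f ∘ leftV₃ a' b' c') ∘ (upper : Fin b ⊕ Fin c → _) := rfl
  have e4 : (f ∘ upper) ∘ rightV b c = (f ∘ rightV₃ a b c) ∘ (upper : Fin b' ⊕ Fin c' → _) := rfl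
  rw [e1, e2, e3, e4]
  tauto

/-- Juxtaposition, extended bilinearly. -/
noncomputable def tensorLin {a b c d : ℕ} : (GDiagram G (Fin a ⊕ Fin b) →₀ k) →ₗ[k]
    (GDiagram G (Fin c ⊕ Fin d) →₀ k) →ₗ[k] (GDiagram G (Fin (a + c) ⊕ Fin (b + d)) →₀ k) :=
  Finsupp.linearCombination k fun X => Finsupp.linearCombination k fun Y =>
    Finsupp.single (tensorDiagram X Y) 1

/-- Composition, extended bilinearly. -/
noncomputable def compLin {A B C : Type w} (d : k) : (GDiagram G (A ⊕ B) →₀ k) →ₗ[k]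
    (GDiagram G (B ⊕ C) →₀ k) →ₗ[k] (GDiagram G (A ⊕ C) →₀ k) :=
  Finsupp.linearCombination k fun X => Finsupp.linearCombination k fun Y => compDiagram d X Y

@[simp] theorem tensorLin_single {a b c d : ℕ} (X : GDiagram G (Fin a ⊕ Fin b))
    (Y : GDiagram G (Fin c ⊕ Fin d)) (r s : k) :
    tensorLin (Finsupp.single X r) (Finsupp.single Y s) =
      Finsupp.single (tensorDiagram X Y) (r * s) := by
  simp [tensorLin]

@[simp] theorem compLin_single {A B C : Type w} (d : k) (X : GDiagram G (A ⊕ B))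
    (Y : GDiagram G (B ⊕ C)) (r s : k) :
    compLin d (Finsupp.single X r) (Finsupp.single Y s) = (r * s) • compDiagram d X Y := by
  simp [compLin, mul_smul]

theorem compLin_right {A B C : Type w} (d : k) (F : GDiagram G (A ⊕ B) →₀ k)
    (Z : GDiagram G (B ⊕ C)) :
    compLin d F (Finsupp.single Z 1) = F.sum (fun W r => r • compDiagram d W Z) := by
  rw [compLin, Finsupp.linearCombination_apply, Finsupp.sum, LinearMap.sum_apply]
  simp only [LinearMap.smul_apply]
  refine Finset.sum_congr rfl fun W _ => ?_
  congr 1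
  exact (Finsupp.linearCombination_single k 1 Z).trans (one_smul _ _)

theorem compLin_left {A B C : Type w} (d : k) (X : GDiagram G (A ⊕ B))
    (F : GDiagram G (B ⊕ C) →₀ k) :
    compLin d (Finsupp.single X 1) F = F.sum (fun W r => r • compDiagram d X W) := by
  simp only [compLin, Finsupp.linearCombination_single, one_smul]
  exact Finsupp.linearCombination_apply k F

theorem interchange_diagram (d : k) (X : GDiagram G (Fin a ⊕ Fin b)) (Y : GDiagram G (Fin b ⊕ Fin c))
    (X' : GDiagram G (Fin a' ⊕ Fin b')) (Y' : GDiagram G (Fin b' ⊕ Fin c')) :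
    compDiagram d (tensorDiagram X X') (tensorDiagram Y Y') =
      tensorLin (compDiagram d X Y) (compDiagram d X' Y') := by
  by_cases h : ∃ f, Glued X Y f
  · by_cases h' : ∃ f, Glued X' Y' f
    · obtain ⟨f, hf⟩ := h
      obtain ⟨f', hf'⟩ := h'
      let F : Fin (a + a') ⊕ (Fin (b + b') ⊕ Fin (c + c')) → G :=
        Sum.elim (Fin.append (f ∘ Sum.inl) (f' ∘ Sum.inl)) (juxt (f ∘ Sum.inr) (f' ∘ Sum.inr))
      have e1 : F ∘ leftV₃ a' b' c' = f := by
        funext x; rcases x with x | x <;> simp [F, leftV₃]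
      have e2 : F ∘ rightV₃ a b c = f' := by
        funext x; rcases x with x | x <;> simp [F, rightV₃]
      have hF : Glued (tensorDiagram X X') (tensorDiagram Y Y') F := by
        rw [glued_tensor, e1, e2]; exact ⟨hf, hf'⟩
      rw [compDiagram_of_glued d hf, compDiagram_of_glued d hf', compDiagram_of_glued d hF,
        tensorLin_single, tensorDiagram_part, tensorDiagram_part, (star_juxt _ _ _ _).1,
        (star_juxt _ _ _ _).2, pow_add]
      congr 1
      refine GDiagram.ext_label ?_ (GDiagram.isLabel_mk_self _ _) ?_
      · rw [tensorDiagram_part]; rfl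
      · rw [tensorDiagram_isLabel]
        have g1 : (F ∘ outer) ∘ leftV a' c' = (F ∘ leftV₃ a' b' c') ∘ outer := by
          funext x; rcases x with x | x <;> rfl
        have g2 : (F ∘ outer) ∘ rightV a c = (F ∘ rightV₃ a b c) ∘ outer := by
          funext x; rcases x with x | x <;> rfl
        rw [g1, g2, e1, e2]
        exact ⟨GDiagram.isLabel_mk_self _ _, GDiagram.isLabel_mk_self _ _⟩
    · rw [compDiagram_of_not_glued d h', map_zero, compDiagram_of_not_glued]
      rintro ⟨f, hf⟩
      exact h' ⟨_, (glued_tensor.1 hf).2⟩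
  · rw [compDiagram_of_not_glued d h, map_zero, LinearMap.zero_apply, compDiagram_of_not_glued]
    rintro ⟨f, hf⟩
    exact h ⟨_, (glued_tensor.1 hf).1⟩

theorem tensor_idDiagram (a b : ℕ) :
    tensorDiagram (idDiagram G (Fin a)) (idDiagram G (Fin b)) = idDiagram G (Fin (a + b)) := by
  refine GDiagram.ext_label (g := fun _ => 1) ?_ ?_ (GDiagram.isLabel_mk_self _ _)
  · rw [tensorDiagram_part]
    apply le_antisymm
    · refine sup_le (map_le_iff.2 ?_) (map_le_iff.2 ?_)
      · rintro (x | x) (y | y) h <;> exact congrArg (Fin.castAdd b) (show x = y from h)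
      · rintro (x | x) (y | y) h <;> exact congrArg (Fin.natAdd a) (show x = y from h)
    · have key : ∀ x : Fin (a + b), juxtPart (idDiagram G (Fin a)).part (idDiagram G (Fin b)).part
          (Sum.inl x) (Sum.inr x) := by
        intro x
        rcases cover_fin x with ⟨y, rfl⟩ | ⟨y, rfl⟩
        · exact juxtPart_left (x := Sum.inl y) (y := Sum.inr y) rfl
        · exact juxtPart_right (x := Sum.inl y) (y := Sum.inr y) rfl
      rintro (x | x) (y | y) h <;> cases (show x = y from h)
      · exact Setoid.refl' _ _
      · exact key x
      · exact Setoid.symm' _ (key x)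
      · exact Setoid.refl' _ _
  · rw [tensorDiagram_isLabel]
    exact ⟨GDiagram.isLabel_mk_self _ _, GDiagram.isLabel_mk_self _ _⟩

end Interchange

/-- Transport of a morphism along equalities of its source and target. -/
def castHom {H : ℕ → ℕ → Type w} {a b a' b' : ℕ} (ha : a = a') (hb : b = b') (f : H a b) :
    H a' b' := ha ▸ hb ▸ f

theorem cast_part {a b a' b' : ℕ} (ha : a = a') (hb : b = b') (X : GDiagram G (Fin a ⊕ Fin b)) :
    (castHom (H := fun a b => GDiagram G (Fin a ⊕ Fin b)) ha hb X).part =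
      X.part.map (Sum.map (Fin.cast ha) (Fin.cast hb)) := by
  subst ha hb
  apply le_antisymm
  · intro x y h
    have := map_rel (e := Sum.map (Fin.cast rfl) (Fin.cast rfl)) (P := X.part) h
    simpa using this
  · rw [map_le_iff]
    rintro (x | x) (y | y) h <;> exact h

theorem cast_isLabel {a b a' b' : ℕ} (ha : a = a') (hb : b = b') (X : GDiagram G (Fin a ⊕ Fin b))
    (f : Fin a' ⊕ Fin b' → G) :
    (castHom (H := fun a b => GDiagram G (Fin a ⊕ Fin b)) ha hb X).IsLabel f ↔
      X.IsLabel (f ∘ Sum.map (Fin.cast ha) (Fin.cast hb)) := by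
  subst ha hb
  have : f ∘ Sum.map (Fin.cast rfl) (Fin.cast rfl) = f := by
    funext x; rcases x with x | x <;> rfl
  rw [this]; rfl

theorem cast_single {a b a' b' : ℕ} (ha : a = a') (hb : b = b') (X : GDiagram G (Fin a ⊕ Fin b))
    (r : k) :
    castHom (H := fun a b => GDiagram G (Fin a ⊕ Fin b) →₀ k) ha hb (Finsupp.single X r) =
      Finsupp.single (castHom (H := fun a b => GDiagram G (Fin a ⊕ Fin b)) ha hb X) r := by
  subst ha hb
  rfl

theorem cast_add {a b a' b' : ℕ} (ha : a = a') (hb : b = b')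
    (f g : GDiagram G (Fin a ⊕ Fin b) →₀ k) :
    castHom (H := fun a b => GDiagram G (Fin a ⊕ Fin b) →₀ k) ha hb (f + g) =
      castHom (H := fun a b => GDiagram G (Fin a ⊕ Fin b) →₀ k) ha hb f +
      castHom (H := fun a b => GDiagram G (Fin a ⊕ Fin b) →₀ k) ha hb g := by
  subst ha hb; rfl

theorem cast_zero {a b a' b' : ℕ} (ha : a = a') (hb : b = b') :
    castHom (H := fun a b => GDiagram G (Fin a ⊕ Fin b) →₀ k) ha hb 0 = 0 := by
  subst ha hb; rfl

theorem tensorDiagram_assoc {a b a' b' a'' b'' : ℕ} (X : GDiagram G (Fin a ⊕ Fin b))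
    (Y : GDiagram G (Fin a' ⊕ Fin b')) (Z : GDiagram G (Fin a'' ⊕ Fin b'')) :
    castHom (H := fun a b => GDiagram G (Fin a ⊕ Fin b)) (add_assoc a a' a'') (add_assoc b b' b'')
      (tensorDiagram (tensorDiagram X Y) Z) = tensorDiagram X (tensorDiagram Y Z) := by
  have e1 : Sum.map (Fin.cast (add_assoc a a' a'')) (Fin.cast (add_assoc b b' b'')) ∘
      leftV a'' b'' ∘ leftV a' b' = leftV (a' + a'') (b' + b'') := by
    funext x; rcases x with x | x <;> rfl
  have e2 : Sum.map (Fin.cast (add_assoc a a' a'')) (Fin.cast (add_assoc b b' b'')) ∘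
      leftV a'' b'' ∘ rightV a b = rightV a b ∘ leftV a'' b'' := by
    funext x; rcases x with x | x <;> rfl
  have e3 : Sum.map (Fin.cast (add_assoc a a' a'')) (Fin.cast (add_assoc b b' b'')) ∘
      rightV (a + a') (b + b') = rightV a b ∘ rightV a' b' := by
    funext x; rcases x with x | x
    · exact congrArg Sum.inl (Fin.ext (Nat.add_assoc _ _ _))
    · exact congrArg Sum.inr (Fin.ext (Nat.add_assoc _ _ _))
  obtain ⟨g, hg⟩ := (tensorDiagram X (tensorDiagram Y Z)).exists_label
  refine GDiagram.ext_label (g := g) ?_ ?_ hg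
  · rw [cast_part]
    simp only [tensorDiagram_part, juxtPart, map_sup, map_map]
    rw [e1, e2, e3, sup_assoc]
  · rw [cast_isLabel]
    simp only [tensorDiagram_isLabel] at hg ⊢
    simp only [Function.comp_assoc] at hg ⊢
    rw [e1, e2, e3]
    exact ⟨⟨hg.1, hg.2.1⟩, hg.2.2⟩

instance : Subsingleton (Setoid (Fin 0 ⊕ Fin 0)) :=
  ⟨fun S T => Setoid.ext fun x => by rcases x with x | x <;> exact x.elim0⟩

instance : Subsingleton (GDiagram G (Fin 0 ⊕ Fin 0)) :=
  ⟨fun X Y => by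
    obtain ⟨f, hf⟩ := X.exists_label
    obtain ⟨g, hg⟩ := Y.exists_label
    have : f = g := by funext x; rcases x with x | x <;> exact x.elim0
    subst this
    exact GDiagram.ext_label (Subsingleton.elim _ _) hf hg⟩

theorem isLabel_zero (X : GDiagram G (Fin 0 ⊕ Fin 0)) (f : Fin 0 ⊕ Fin 0 → G) : X.IsLabel f :=
  Subsingleton.elim _ _

theorem map_zero_le {V : Type*} (S : Setoid (Fin 0 ⊕ Fin 0)) (e : Fin 0 ⊕ Fin 0 → V)
    (T : Setoid V) : S.map e ≤ T :=
  map_le_iff.2 fun x => by rcases x with x | x <;> exact x.elim0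

theorem map_id' {V : Type*} (S : Setoid V) : S.map (fun x => x) = S :=
  le_antisymm (map_le_iff.2 fun _ _ h => h) fun _ _ h => map_rel (e := fun x => x) h

theorem zero_tensorDiagram {a b : ℕ} (X : GDiagram G (Fin a ⊕ Fin b)) :
    castHom (H := fun a b => GDiagram G (Fin a ⊕ Fin b)) (zero_add a) (zero_add b)
      (tensorDiagram (idDiagram G (Fin 0)) X) = X := by
  have e1 : Sum.map (Fin.cast (zero_add a)) (Fin.cast (zero_add b)) ∘ rightV 0 0 =
      (fun x => x) := by
    funext x; rcases x with x | x
    · exact congrArg Sum.inl (Fin.ext (Nat.zero_add _))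
    · exact congrArg Sum.inr (Fin.ext (Nat.zero_add _))
  obtain ⟨g, hg⟩ := X.exists_label
  refine GDiagram.ext_label (g := g) ?_ ?_ hg
  · rw [cast_part, tensorDiagram_part, juxtPart, map_sup, map_map, map_map, e1, map_id']
    exact sup_eq_right.2 (map_zero_le _ _ _)
  · rw [cast_isLabel, tensorDiagram_isLabel, Function.comp_assoc, Function.comp_assoc, e1]
    exact ⟨isLabel_zero _ _, hg⟩

theorem tensorDiagram_zero {a b : ℕ} (X : GDiagram G (Fin a ⊕ Fin b)) :
    castHom (H := fun a b => GDiagram G (Fin a ⊕ Fin b)) (add_zero a) (add_zero b)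
      (tensorDiagram X (idDiagram G (Fin 0))) = X := by
  have e1 : Sum.map (Fin.cast (add_zero a)) (Fin.cast (add_zero b)) ∘ leftV 0 0 =
      (fun x => x) := by
    funext x; rcases x with x | x <;> rfl
  obtain ⟨g, hg⟩ := X.exists_label
  refine GDiagram.ext_label (g := g) ?_ ?_ hg
  · rw [cast_part, tensorDiagram_part, juxtPart, map_sup, map_map, map_map, e1, map_id']
    exact sup_eq_left.2 (map_zero_le _ _ _)
  · rw [cast_isLabel, tensorDiagram_isLabel, Function.comp_assoc, Function.comp_assoc, e1]
    exact ⟨hg, isLabel_zero _ _⟩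

end Tensor

/-! ### Strict linear monoidal categories whose monoid of objects is `(ℕ, +, 0)` -/

open CategoryTheory MonoidalCategory

/-- The data and laws of a strict `k`-linear monoidal category whose objects are the natural
numbers, with `a ⊗ b = a + b` and unit object `0`. Composition is in diagrammatic order. Strictness:
the associativity and unit laws for `⊗` on morphisms hold on the nose, up to transport along the
equalities of natural numbers between the sources and targets. -/
structure LinPRO (k : Type u) [CommRing k] where
  Hom : ℕ → ℕ → Type w
  [grp : ∀ a b, AddCommGroup (Hom a b)]
  [mod : ∀ a b, Module k (Hom a b)]
  id : ∀ a, Hom a a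
  comp : ∀ {a b c}, Hom a b →ₗ[k] Hom b c →ₗ[k] Hom a c
  tensor : ∀ {a b c d}, Hom a b →ₗ[k] Hom c d →ₗ[k] Hom (a + c) (b + d)
  id_comp : ∀ {a b} (f : Hom a b), comp (id a) f = f
  comp_id : ∀ {a b} (f : Hom a b), comp f (id b) = f
  assoc : ∀ {a b c d} (f : Hom a b) (g : Hom b c) (h : Hom c d),
    comp (comp f g) h = comp f (comp g h)
  tensor_id : ∀ a b, tensor (id a) (id b) = id (a + b)
  interchange : ∀ {a b c a' b' c'} (f : Hom a b) (g : Hom b c) (f' : Hom a' b') (g' : Hom b' c'),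
    comp (tensor f f') (tensor g g') = tensor (comp f g) (comp f' g')
  tensor_assoc : ∀ {a b a' b' a'' b''} (f : Hom a b) (g : Hom a' b') (h : Hom a'' b''),
    castHom (add_assoc a a' a'') (add_assoc b b' b'') (tensor (tensor f g) h) =
      tensor f (tensor g h)
  unit_tensor : ∀ {a b} (f : Hom a b),
    castHom (zero_add a) (zero_add b) (tensor (id 0) f) = f
  tensor_unit : ∀ {a b} (f : Hom a b),
    castHom (add_zero a) (add_zero b) (tensor f (id 0)) = f

namespace LinPRO

variable {k : Type u} [CommRing k] (P : LinPRO.{u, w} k)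

attribute [instance] LinPRO.grp LinPRO.mod

/-- The objects, one for every natural number. -/
@[ext] structure Ob (P : LinPRO.{u, w} k) : Type where
  n : ℕ

instance : Category P.Ob where
  Hom X Y := P.Hom X.n Y.n
  id X := P.id X.n
  comp f g := P.comp f g
  id_comp f := P.id_comp f
  comp_id f := P.comp_id f
  assoc f g h := P.assoc f g h

instance : Preadditive P.Ob where
  homGroup X Y := P.grp X.n Y.n
  add_comp _ _ _ f f' g := LinearMap.map_add₂ P.comp f f' g
  comp_add _ _ _ f g g' := (P.comp f).map_add g g'

instance : Linear k P.Ob where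
  homModule X Y := P.mod X.n Y.n
  smul_comp _ _ _ r f g := LinearMap.map_smul₂ P.comp r f g
  comp_smul _ _ _ f r g := (P.comp f).map_smul r g

instance : MonoidalCategoryStruct P.Ob where
  tensorObj X Y := ⟨X.n + Y.n⟩
  tensorUnit := ⟨0⟩
  tensorHom f g := P.tensor f g
  whiskerLeft X _ _ f := P.tensor (P.id X.n) f
  whiskerRight f Y := P.tensor f (P.id Y.n)
  associator X Y Z := eqToIso (congrArg Ob.mk (add_assoc X.n Y.n Z.n))
  leftUnitor X := eqToIso (congrArg Ob.mk (zero_add X.n))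
  rightUnitor X := eqToIso (congrArg Ob.mk (add_zero X.n))

theorem castHom_eq {a b a' b' : ℕ} (ha : a = a') (hb : b = b') (f : (⟨a⟩ : P.Ob) ⟶ ⟨b⟩) :
    (castHom (H := P.Hom) ha hb f : (⟨a'⟩ : P.Ob) ⟶ ⟨b'⟩) =
      eqToHom (congrArg Ob.mk ha.symm) ≫ f ≫ eqToHom (congrArg Ob.mk hb) := by
  subst ha hb
  simp [castHom]

theorem tensor_eqToHom {X Y X' Y' : P.Ob} (h : X = Y) (h' : X' = Y') :
    (eqToHom h ⊗ₘ eqToHom h') =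
      eqToHom (show MonoidalCategoryStruct.tensorObj X X' =
        MonoidalCategoryStruct.tensorObj Y Y' by rw [h, h']) := by
  subst h h'
  exact P.tensor_id _ _

theorem tensor_eqToHom_id {X Y Z : P.Ob} (h : X = Y) :
    (eqToHom h ⊗ₘ 𝟙 Z) =
      eqToHom (show MonoidalCategoryStruct.tensorObj X Z =
        MonoidalCategoryStruct.tensorObj Y Z by rw [h]) :=
  P.tensor_eqToHom h rfl

theorem tensor_id_eqToHom {X Y Z : P.Ob} (h : X = Y) :
    (𝟙 Z ⊗ₘ eqToHom h) =
      eqToHom (show MonoidalCategoryStruct.tensorObj Z X =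
        MonoidalCategoryStruct.tensorObj Z Y by rw [h]) :=
  P.tensor_eqToHom rfl h

theorem eq_of_castHom {X Y X' Y' : P.Ob} (ha : X.n = X'.n) (hb : Y.n = Y'.n) {f : X ⟶ Y}
    {g : X' ⟶ Y'} (h : castHom (H := P.Hom) ha hb f = g) :
    f ≫ eqToHom (congrArg Ob.mk hb) = eqToHom (congrArg Ob.mk ha) ≫ g := by
  have := P.castHom_eq ha hb f
  rw [← h]
  erw [this]
  simp

instance : MonoidalCategory P.Ob :=
  MonoidalCategory.ofTensorHom
    (id_tensorHom_id := fun X Y => P.tensor_id X.n Y.n)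
    (id_tensorHom := fun _ _ _ _ => rfl)
    (tensorHom_id := fun _ _ => rfl)
    (tensorHom_comp_tensorHom := fun f g f' g' => P.interchange f f' g g')
    (associator_naturality := fun f g h => P.eq_of_castHom _ _ (P.tensor_assoc f g h))
    (leftUnitor_naturality := fun f => P.eq_of_castHom _ _ (P.unit_tensor f))
    (rightUnitor_naturality := fun f => P.eq_of_castHom _ _ (P.tensor_unit f))
    (pentagon := fun W X Y Z => by
      simp only [MonoidalCategoryStruct.associator, eqToIso.hom]
      rw [tensor_eqToHom_id, tensor_id_eqToHom]
      simp)
    (triangle := fun X Y => by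
      simp only [MonoidalCategoryStruct.associator, MonoidalCategoryStruct.leftUnitor,
        MonoidalCategoryStruct.rightUnitor, eqToIso.hom]
      rw [tensor_eqToHom_id, tensor_id_eqToHom]
      simp)

instance : MonoidalPreadditive P.Ob where
  whiskerLeft_zero {X _ _} := (P.tensor (P.id X.n)).map_zero
  zero_whiskerRight {X Y Z} := by
    change P.tensor (0 : P.Hom Y.n Z.n) (P.id X.n) = 0
    rw [map_zero, LinearMap.zero_apply]
  whiskerLeft_add {X _ _} f g := (P.tensor (P.id X.n)).map_add f g
  add_whiskerRight {X Y Z} f g := by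
    change P.tensor (f + g) (P.id X.n) = P.tensor f (P.id X.n) + P.tensor g (P.id X.n)
    rw [map_add, LinearMap.add_apply]

instance : MonoidalLinear k P.Ob where
  whiskerLeft_smul X _ _ r f := (P.tensor (P.id X.n)).map_smul r f
  smul_whiskerRight r Y Z f X := by
    change P.tensor (r • f) (P.id X.n) = r • P.tensor f (P.id X.n)
    rw [map_smul, LinearMap.smul_apply]

end LinPRO

/-! ### The category of `G`-partition diagrams -/

/-- `G`-partition diagrams with bottom row of `a` and top row of `b` vertices. -/
abbrev Diagram (G : Type v) [Group G] (a b : ℕ) : Type v := GDiagram G (Fin a ⊕ Fin b)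

/-- The `G`-partition category `Par(G, d)`, as a strict linear monoidal category on `ℕ`: morphisms
`a ⟶ b` are `k`-linear combinations of diagrams with `a` bottom and `b` top vertices. -/
noncomputable def parPRO (k : Type u) [CommRing k] (G : Type v) [Group G] (d : k) :
    LinPRO.{u, max u v} k where
  Hom a b := Diagram G a b →₀ k
  id a := Finsupp.single (idDiagram G (Fin a)) 1
  comp := compLin d
  tensor := tensorLin
  id_comp {a b} f := by
    induction f using Finsupp.induction_linear with
    | zero => simp
    | add f g hf hg => rw [map_add, hf, hg]
    | single X r => simp [id_compDiagram]
  comp_id {a b} f := by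
    induction f using Finsupp.induction_linear with
    | zero => simp
    | add f g hf hg => rw [map_add, LinearMap.add_apply, hf, hg]
    | single X r => simp [compDiagram_id]
  assoc {a b c e} f g h := by
    induction f using Finsupp.induction_linear with
    | zero => simp
    | add f f' hf hf' => simp only [map_add, LinearMap.add_apply, hf, hf']
    | single X r =>
    induction g using Finsupp.induction_linear with
    | zero => simp
    | add f f' hf hf' => simp only [map_add, LinearMap.add_apply, hf, hf']
    | single Y s =>
    induction h using Finsupp.induction_linear with
    | zero => simp
    | add f f' hf hf' => simp only [map_add, hf, hf']
    | single Z t =>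
      have e1 : compLin d (compDiagram d X Y) (Finsupp.single Z 1) =
          compLin d (Finsupp.single X 1) (compDiagram d Y Z) := by
        rw [compLin_right, compLin_left]
        exact comp_assoc_diagram d X Y Z
      have e2 : (Finsupp.single Z t : Diagram G c e →₀ k) = t • Finsupp.single Z 1 := by simp
      have e3 : (Finsupp.single X r : Diagram G a b →₀ k) = r • Finsupp.single X 1 := by simp
      rw [compLin_single, compLin_single, e2, e3]
      simp only [map_smul, LinearMap.smul_apply]
      rw [e1]
      simp only [smul_smul]
      congr 1
      ring
  tensor_id a b := by rw [tensorLin_single, tensor_idDiagram, mul_one]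
  interchange {a b c a' b' c'} f g f' g' := by
    induction f using Finsupp.induction_linear with
    | zero => simp
    | add f₁ f₂ h₁ h₂ => simp only [map_add, LinearMap.add_apply, h₁, h₂]
    | single X r =>
    induction g using Finsupp.induction_linear with
    | zero => simp
    | add f₁ f₂ h₁ h₂ => simp only [map_add, LinearMap.add_apply, h₁, h₂]
    | single Y s =>
    induction f' using Finsupp.induction_linear with
    | zero => simp
    | add f₁ f₂ h₁ h₂ => simp only [map_add, LinearMap.add_apply, h₁, h₂]
    | single X' r' =>
    induction g' using Finsupp.induction_linear with
    | zero => simp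
    | add f₁ f₂ h₁ h₂ => simp only [map_add, h₁, h₂]
    | single Y' s' =>
      simp only [tensorLin_single, compLin_single, interchange_diagram, map_smul,
        LinearMap.smul_apply, smul_smul]
      congr 1
      ring
  tensor_assoc {a b a' b' a'' b''} f g h := by
    induction f using Finsupp.induction_linear with
    | zero => simp [cast_zero]
    | add f₁ f₂ h₁ h₂ => simp only [map_add, LinearMap.add_apply, cast_add, h₁, h₂]
    | single X r =>
    induction g using Finsupp.induction_linear with
    | zero => simp [cast_zero]
    | add f₁ f₂ h₁ h₂ => simp only [map_add, LinearMap.add_apply, cast_add, h₁, h₂]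
    | single Y s =>
    induction h using Finsupp.induction_linear with
    | zero => simp [cast_zero]
    | add f₁ f₂ h₁ h₂ => simp only [map_add, cast_add, h₁, h₂]
    | single Z t =>
      rw [tensorLin_single, tensorLin_single, tensorLin_single, tensorLin_single, cast_single,
        tensorDiagram_assoc, mul_assoc]
  unit_tensor {a b} f := by
    induction f using Finsupp.induction_linear with
    | zero => simp [cast_zero]
    | add f₁ f₂ h₁ h₂ => rw [map_add, cast_add, h₁, h₂]
    | single X r => rw [tensorLin_single, cast_single, zero_tensorDiagram, one_mul]
  tensor_unit {a b} f := by
    induction f using Finsupp.induction_linear with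
    | zero => simp [cast_zero]
    | add f₁ f₂ h₁ h₂ => rw [map_add, LinearMap.add_apply, cast_add, h₁, h₂]
    | single X r => rw [tensorLin_single, cast_single, tensorDiagram_zero, mul_one]

/-! ### The presented category -/

/-- Formal `k`-linear string diagrams: the morphisms `a ⟶ b` generated, under composition (`comp f g`
is `f` at the bottom followed by `g` on top), tensor product (`tensor f g` is `f` to the left of
`g`) and `k`-linear combinations, by the merge, the split, the crossing, the bottom pin (with source
the unit object), the top pin (with target the unit object) and the tokens. -/
inductive Term (k : Type u) (G : Type v) : ℕ → ℕ → Type (max u v)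
  | strand (a : ℕ) : Term k G a a
  | comp {a b c : ℕ} : Term k G a b → Term k G b c → Term k G a c
  | tensor {a b c d : ℕ} : Term k G a b → Term k G c d → Term k G (a + c) (b + d)
  | zero {a b : ℕ} : Term k G a b
  | add {a b : ℕ} : Term k G a b → Term k G a b → Term k G a b
  | smul {a b : ℕ} : k → Term k G a b → Term k G a b
  | merge : Term k G 2 1
  | split : Term k G 1 2
  | cross : Term k G 2 2
  | bpin : Term k G 0 1
  | tpin : Term k G 1 0
  | token : G → Term k G 1 1

section Presentation

variable (k : Type u) [CommRing k] (G : Type v) [Group G]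

open Term in
/-- The defining relations between the generators. -/
inductive GenRel : ∀ {a b : ℕ}, Term k G a b → Term k G a b → Prop
  -- Frobenius object
  | unit : GenRel (((strand 1).tensor bpin).comp merge) (strand 1)
  | counit_right : GenRel (split.comp ((strand 1).tensor tpin)) (strand 1)
  | counit_left : GenRel (split.comp (tpin.tensor (strand 1))) (strand 1)
  | frobenius_left :
      GenRel (((strand 1).tensor split).comp (merge.tensor (strand 1))) (merge.comp split)
  | frobenius_right :
      GenRel ((split.tensor (strand 1)).comp ((strand 1).tensor merge)) (merge.comp split)
  -- symmetric group relations
  | cross_cross : GenRel (cross.comp cross) (strand 2)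
  | braid : GenRel
      (((cross.tensor (strand 1)).comp ((strand 1).tensor cross)).comp (cross.tensor (strand 1)))
      ((((strand 1).tensor cross).comp (cross.tensor (strand 1))).comp ((strand 1).tensor cross))
  -- naturality of the crossing
  | bpin_cross : GenRel (((strand 1).tensor bpin).comp cross) (bpin.tensor (strand 1))
  | cross_tpin : GenRel (cross.comp ((strand 1).tensor tpin)) (tpin.tensor (strand 1))
  | cross_merge : GenRel
      ((((strand 1).tensor cross).comp (cross.tensor (strand 1))).comp ((strand 1).tensor merge))
      ((merge.tensor (strand 1)).comp cross)
  | split_cross : GenRel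
      ((((strand 1).tensor split).comp (cross.tensor (strand 1))).comp ((strand 1).tensor cross))
      (cross.comp (split.tensor (strand 1)))
  -- commutativity, and a bubble with tokens `g` and `h` is `δ_{g,h}` times the token `g`
  | comm : GenRel (cross.comp merge) merge
  | bubble_eq (g : G) : GenRel ((split.comp ((token g).tensor (token g))).comp merge) (token g)
  | bubble_ne (g h : G) (hgh : g ≠ h) :
      GenRel ((split.comp ((token g).tensor (token h))).comp merge) zero
  -- tokens
  | token_mul (g h : G) : GenRel ((token h).comp (token g)) (token (g * h))
  | token_one : GenRel (token 1) (strand 1)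
  | token_cross (g : G) :
      GenRel (((token g).tensor (strand 1)).comp cross) (cross.comp ((strand 1).tensor (token g)))
  | token_split (g : G) :
      GenRel ((token g).comp split) (split.comp ((token g).tensor (token g)))
  | bpin_token (g : G) : GenRel (bpin.comp (token g)) bpin

open Term in
/-- The congruence on formal string diagrams generated by the axioms of a strict `k`-linear monoidal
category and the defining relations. -/
inductive Rel : ∀ {a b : ℕ}, Term k G a b → Term k G a b → Prop
  | gen {a b} {f g : Term k G a b} : GenRel k G f g → Rel f g
  -- equivalence relation, compatible with all operations
  | refl {a b} (f : Term k G a b) : Rel f f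
  | symm {a b} {f g : Term k G a b} : Rel f g → Rel g f
  | trans {a b} {f g h : Term k G a b} : Rel f g → Rel g h → Rel f h
  | congr_comp {a b c} {f f' : Term k G a b} {g g' : Term k G b c} :
      Rel f f' → Rel g g' → Rel (f.comp g) (f'.comp g')
  | congr_tensor {a b c d} {f f' : Term k G a b} {g g' : Term k G c d} :
      Rel f f' → Rel g g' → Rel (f.tensor g) (f'.tensor g')
  | congr_add {a b} {f f' g g' : Term k G a b} : Rel f f' → Rel g g' → Rel (f.add g) (f'.add g')
  | congr_smul {a b} (r : k) {f f' : Term k G a b} : Rel f f' → Rel (smul r f) (smul r f')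
  -- `k`-modules
  | add_assoc {a b} (f g h : Term k G a b) : Rel ((f.add g).add h) (f.add (g.add h))
  | add_comm {a b} (f g : Term k G a b) : Rel (f.add g) (g.add f)
  | zero_add {a b} (f : Term k G a b) : Rel (zero.add f) f
  | one_smul {a b} (f : Term k G a b) : Rel (smul 1 f) f
  | zero_smul {a b} (f : Term k G a b) : Rel (smul 0 f) zero
  | mul_smul {a b} (r s : k) (f : Term k G a b) : Rel (smul (r * s) f) (smul r (smul s f))
  | smul_add {a b} (r : k) (f g : Term k G a b) : Rel (smul r (f.add g)) ((smul r f).add (smul r g))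
  | add_smul {a b} (r s : k) (f : Term k G a b) : Rel (smul (r + s) f) ((smul r f).add (smul s f))
  -- bilinearity of composition and of the tensor product
  | add_comp {a b c} (f f' : Term k G a b) (g : Term k G b c) :
      Rel ((f.add f').comp g) ((f.comp g).add (f'.comp g))
  | comp_add {a b c} (f : Term k G a b) (g g' : Term k G b c) :
      Rel (f.comp (g.add g')) ((f.comp g).add (f.comp g'))
  | smul_comp {a b c} (r : k) (f : Term k G a b) (g : Term k G b c) :
      Rel ((smul r f).comp g) (smul r (f.comp g))
  | comp_smul {a b c} (r : k) (f : Term k G a b) (g : Term k G b c) :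
      Rel (f.comp (smul r g)) (smul r (f.comp g))
  | add_tensor {a b c d} (f f' : Term k G a b) (g : Term k G c d) :
      Rel ((f.add f').tensor g) ((f.tensor g).add (f'.tensor g))
  | tensor_add {a b c d} (f : Term k G a b) (g g' : Term k G c d) :
      Rel (f.tensor (g.add g')) ((f.tensor g).add (f.tensor g'))
  | smul_tensor {a b c d} (r : k) (f : Term k G a b) (g : Term k G c d) :
      Rel ((smul r f).tensor g) (smul r (f.tensor g))
  | tensor_smul {a b c d} (r : k) (f : Term k G a b) (g : Term k G c d) :
      Rel (f.tensor (smul r g)) (smul r (f.tensor g))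
  -- category
  | id_comp {a b} (f : Term k G a b) : Rel ((strand a).comp f) f
  | comp_id {a b} (f : Term k G a b) : Rel (f.comp (strand b)) f
  | comp_assoc {a b c d} (f : Term k G a b) (g : Term k G b c) (h : Term k G c d) :
      Rel ((f.comp g).comp h) (f.comp (g.comp h))
  -- strict monoidal category
  | tensor_id (a b : ℕ) : Rel ((strand a).tensor (strand b)) (strand (a + b))
  | interchange {a b c a' b' c'} (f : Term k G a b) (g : Term k G b c) (f' : Term k G a' b')
      (g' : Term k G b' c') :
      Rel ((f.tensor f').comp (g.tensor g')) ((f.comp g).tensor (f'.comp g'))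
  | tensor_assoc {a b a' b' a'' b''} (f : Term k G a b) (g : Term k G a' b')
      (h : Term k G a'' b'') :
      Rel (castHom (Nat.add_assoc a a' a'') (Nat.add_assoc b b' b'') ((f.tensor g).tensor h))
        (f.tensor (g.tensor h))
  | unit_tensor {a b} (f : Term k G a b) :
      Rel (castHom (Nat.zero_add a) (Nat.zero_add b) ((strand 0).tensor f)) f
  | tensor_unit {a b} (f : Term k G a b) :
      Rel (castHom (Nat.add_zero a) (Nat.add_zero b) (f.tensor (strand 0))) f

/-- Formal string diagrams modulo the congruence. -/
instance termSetoid (a b : ℕ) : Setoid (Term k G a b) where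
  r := Rel k G
  iseqv := ⟨Rel.refl, Rel.symm, Rel.trans⟩

/-- The morphisms `a ⟶ b` of the presented category. -/
def PresHom (a b : ℕ) : Type (max u v) := Quotient (termSetoid k G a b)

variable {k G}

/-- The morphism represented by a formal string diagram. -/
def PresHom.mk {a b : ℕ} (f : Term k G a b) : PresHom k G a b := Quotient.mk _ f

theorem PresHom.sound {a b : ℕ} {f g : Term k G a b} (h : Rel k G f g) :
    PresHom.mk f = PresHom.mk g := Quotient.sound h

theorem PresHom.castHom_mk {a b a' b' : ℕ} (ha : a = a') (hb : b = b') (f : Term k G a b) :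
    castHom (H := PresHom k G) ha hb (PresHom.mk f) = PresHom.mk (castHom ha hb f) := by
  subst ha hb; rfl

instance (a b : ℕ) : Add (PresHom k G a b) :=
  ⟨Quotient.map₂ Term.add fun _ _ h _ _ h' => Rel.congr_add h h'⟩

instance (a b : ℕ) : Zero (PresHom k G a b) := ⟨PresHom.mk Term.zero⟩

instance (a b : ℕ) : SMul k (PresHom k G a b) :=
  ⟨fun r => Quotient.map (Term.smul r) fun _ _ h => Rel.congr_smul r h⟩

instance (a b : ℕ) : Neg (PresHom k G a b) := ⟨fun f => (-1 : k) • f⟩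

instance (a b : ℕ) : AddCommGroup (PresHom k G a b) where
  nsmul := nsmulRec
  zsmul := zsmulRec
  add_assoc := by rintro ⟨f⟩ ⟨g⟩ ⟨h⟩; exact PresHom.sound (Rel.add_assoc f g h)
  zero_add := by rintro ⟨f⟩; exact PresHom.sound (Rel.zero_add f)
  add_zero := by rintro ⟨f⟩; exact PresHom.sound ((Rel.add_comm _ _).trans (Rel.zero_add f))
  add_comm := by rintro ⟨f⟩ ⟨g⟩; exact PresHom.sound (Rel.add_comm f g)
  neg_add_cancel := by
    rintro ⟨f⟩
    refine PresHom.sound (((Rel.congr_add (Rel.refl _) (Rel.one_smul f).symm).trans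
      (Rel.add_smul (-1) 1 f).symm).trans ?_)
    rw [neg_add_cancel]
    exact Rel.zero_smul f

instance (a b : ℕ) : Module k (PresHom k G a b) where
  one_smul := by rintro ⟨f⟩; exact PresHom.sound (Rel.one_smul f)
  mul_smul := by rintro r s ⟨f⟩; exact PresHom.sound (Rel.mul_smul r s f)
  smul_zero r := PresHom.sound (((Rel.congr_smul r (Rel.zero_smul Term.zero).symm).trans
    (Rel.mul_smul r 0 Term.zero).symm).trans (by rw [mul_zero]; exact Rel.zero_smul _))
  smul_add := by rintro r ⟨f⟩ ⟨g⟩; exact PresHom.sound (Rel.smul_add r f g)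
  add_smul := by rintro r s ⟨f⟩; exact PresHom.sound (Rel.add_smul r s f)
  zero_smul := by rintro ⟨f⟩; exact PresHom.sound (Rel.zero_smul f)

variable (k G)

/-- `Par(G)`: the strict `k`-linear monoidal category with one generating object presented by the
generators and relations above. The object `n` is the `n`-th tensor power of the
generating object. -/
def presPRO : LinPRO.{u, max u v} k where
  Hom := PresHom k G
  id a := PresHom.mk (Term.strand a)
  comp := LinearMap.mk₂ k
    (Quotient.map₂ Term.comp fun _ _ h _ _ h' => Rel.congr_comp h h')
    (by rintro ⟨f⟩ ⟨f'⟩ ⟨g⟩; exact PresHom.sound (Rel.add_comp f f' g))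
    (by rintro r ⟨f⟩ ⟨g⟩; exact PresHom.sound (Rel.smul_comp r f g))
    (by rintro ⟨f⟩ ⟨g⟩ ⟨g'⟩; exact PresHom.sound (Rel.comp_add f g g'))
    (by rintro r ⟨f⟩ ⟨g⟩; exact PresHom.sound (Rel.comp_smul r f g))
  tensor := LinearMap.mk₂ k
    (Quotient.map₂ Term.tensor fun _ _ h _ _ h' => Rel.congr_tensor h h')
    (by rintro ⟨f⟩ ⟨f'⟩ ⟨g⟩; exact PresHom.sound (Rel.add_tensor f f' g))
    (by rintro r ⟨f⟩ ⟨g⟩; exact PresHom.sound (Rel.smul_tensor r f g))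
    (by rintro ⟨f⟩ ⟨g⟩ ⟨g'⟩; exact PresHom.sound (Rel.tensor_add f g g'))
    (by rintro r ⟨f⟩ ⟨g⟩; exact PresHom.sound (Rel.tensor_smul r f g))
  id_comp := by rintro a b ⟨f⟩; exact PresHom.sound (Rel.id_comp f)
  comp_id := by rintro a b ⟨f⟩; exact PresHom.sound (Rel.comp_id f)
  assoc := by rintro a b c d ⟨f⟩ ⟨g⟩ ⟨h⟩; exact PresHom.sound (Rel.comp_assoc f g h)
  tensor_id a b := PresHom.sound (Rel.tensor_id a b)
  interchange := by
    rintro a b c a' b' c' ⟨f⟩ ⟨g⟩ ⟨f'⟩ ⟨g'⟩; exact PresHom.sound (Rel.interchange f g f' g')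
  tensor_assoc := by
    rintro a b a' b' a'' b'' ⟨f⟩ ⟨g⟩ ⟨h⟩
    exact (PresHom.castHom_mk _ _ _).trans (PresHom.sound (Rel.tensor_assoc f g h))
  unit_tensor := by
    rintro a b ⟨f⟩
    exact (PresHom.castHom_mk _ _ _).trans (PresHom.sound (Rel.unit_tensor f))
  tensor_unit := by
    rintro a b ⟨f⟩
    exact (PresHom.castHom_mk _ _ _).trans (PresHom.sound (Rel.tensor_unit f))

/-- The category `Par(G)`. -/
abbrev Par : Type := (presPRO k G).Ob

/-- The category `Par(G, d)`. -/
abbrev ParD (d : k) : Type := (parPRO k G d).Ob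

variable {k G}

/-- The morphism of `Par(G)` represented by a formal string diagram. -/
def Par.mk {a b : ℕ} (f : Term k G a b) : (⟨a⟩ : Par k G) ⟶ ⟨b⟩ := PresHom.mk f

/-- A linear combination of diagrams as a morphism of `Par(G, d)`. -/
def ParD.mk {d : k} {a b : ℕ} (f : Diagram G a b →₀ k) : (⟨a⟩ : ParD k G d) ⟶ ⟨b⟩ := f

variable (k G)

/-- The lolly: the bottom pin followed by the top pin, an endomorphism of the unit object. -/
def lolly : 𝟙_ (Par k G) ⟶ 𝟙_ (Par k G) := Par.mk (Term.bpin.comp Term.tpin)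

/-- The relation `lolly = d`. -/
inductive LollyRel (d : k) : HomRel (Par k G)
  | lolly : LollyRel d (lolly k G) (d • 𝟙 (𝟙_ (Par k G)))

end Presentation

/-! ### Quotients of linear monoidal categories -/

section Quot

variable (k : Type u) [CommRing k] {C : Type*} [Category C] [Preadditive C]
  [Linear k C] [MonoidalCategory C]

/-- The congruence of `k`-linear monoidal categories generated by a family of relations between
morphisms. -/
inductive TensorClosure (S : HomRel C) : HomRel C
  | of {X Y} {f g : X ⟶ Y} : S f g → TensorClosure S f g
  | refl {X Y} (f : X ⟶ Y) : TensorClosure S f f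
  | symm {X Y} {f g : X ⟶ Y} : TensorClosure S f g → TensorClosure S g f
  | trans {X Y} {f g h : X ⟶ Y} :
      TensorClosure S f g → TensorClosure S g h → TensorClosure S f h
  | precomp {X Y Z} (f : X ⟶ Y) {g g' : Y ⟶ Z} :
      TensorClosure S g g' → TensorClosure S (f ≫ g) (f ≫ g')
  | postcomp {X Y Z} {f f' : X ⟶ Y} (g : Y ⟶ Z) :
      TensorClosure S f f' → TensorClosure S (f ≫ g) (f' ≫ g)
  | add {X Y} {f f' g g' : X ⟶ Y} :
      TensorClosure S f f' → TensorClosure S g g' → TensorClosure S (f + g) (f' + g')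
  | smul {X Y} (r : k) {f f' : X ⟶ Y} : TensorClosure S f f' → TensorClosure S (r • f) (r • f')
  | whiskerLeft (X : C) {Y Z} {f f' : Y ⟶ Z} :
      TensorClosure S f f' → TensorClosure S (X ◁ f) (X ◁ f')
  | whiskerRight {Y Z} {f f' : Y ⟶ Z} (X : C) :
      TensorClosure S f f' → TensorClosure S (f ▷ X) (f' ▷ X)

variable (S : HomRel C)

instance : Congruence (TensorClosure k S) where
  comp_left f _ _ h := TensorClosure.precomp f h
  comp_right g h := TensorClosure.postcomp g h
  equivalence := ⟨TensorClosure.refl, TensorClosure.symm, TensorClosure.trans⟩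

/-- The quotient of a `k`-linear monoidal category by a family of relations between morphisms. -/
abbrev TensorQuotient := CategoryTheory.Quotient (TensorClosure k S)

namespace TensorQuotient

/-- The quotient functor. -/
abbrev proj : C ⥤ TensorQuotient k S := CategoryTheory.Quotient.functor (TensorClosure k S)

instance : Preadditive (TensorQuotient k S) :=
  CategoryTheory.Quotient.preadditive _ fun _ _ _ _ _ _ h h' => TensorClosure.add h h'

instance : (proj k S).Additive :=
  CategoryTheory.Quotient.functor_additive _ fun _ _ _ _ _ _ h h' => TensorClosure.add h h'

instance : Linear k (TensorQuotient k S) :=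
  CategoryTheory.Quotient.linear k _ fun r _ _ _ _ h => TensorClosure.smul r h

theorem map_eq {X Y : C} {f g : X ⟶ Y} (h : TensorClosure k S f g) :
    (proj k S).map f = (proj k S).map g := CategoryTheory.Quotient.sound _ h

variable {k S}

/-- Left whiskering in the quotient. -/
def whiskerL (X : TensorQuotient k S) {Y Z : TensorQuotient k S} (f : Y ⟶ Z) :
    (⟨X.as ⊗ Y.as⟩ : TensorQuotient k S) ⟶ ⟨X.as ⊗ Z.as⟩ :=
  Quot.lift (fun f : Y.as ⟶ Z.as => (proj k S).map (X.as ◁ f)) (fun f g h =>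
    map_eq k S (TensorClosure.whiskerLeft _ ((HomRel.compClosure_iff_self _ f g).1 h))) f

/-- Right whiskering in the quotient. -/
def whiskerR {Y Z : TensorQuotient k S} (f : Y ⟶ Z) (X : TensorQuotient k S) :
    (⟨Y.as ⊗ X.as⟩ : TensorQuotient k S) ⟶ ⟨Z.as ⊗ X.as⟩ :=
  Quot.lift (fun f : Y.as ⟶ Z.as => (proj k S).map (f ▷ X.as)) (fun f g h =>
    map_eq k S (TensorClosure.whiskerRight _ ((HomRel.compClosure_iff_self _ f g).1 h))) f

instance : MonoidalCategoryStruct (TensorQuotient k S) where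
  tensorObj X Y := ⟨X.as ⊗ Y.as⟩
  tensorUnit := ⟨𝟙_ C⟩
  whiskerLeft X _ _ f := whiskerL X f
  whiskerRight f X := whiskerR f X
  tensorHom {_ Y X' _} f g := whiskerR f X' ≫ whiskerL Y g
  associator X Y Z := (proj k S).mapIso (α_ X.as Y.as Z.as)
  leftUnitor X := (proj k S).mapIso (λ_ X.as)
  rightUnitor X := (proj k S).mapIso (ρ_ X.as)

instance : MonoidalCategory (TensorQuotient k S) where
  tensorHom_def _ _ := rfl
  id_tensorHom_id X Y := congrArg (proj k S).map (by simp : (𝟙 X.as ▷ Y.as) ≫ (X.as ◁ 𝟙 Y.as) = 𝟙 _)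
  tensorHom_comp_tensorHom := by
    rintro X Y Z X' Y' Z' ⟨f⟩ ⟨g⟩ ⟨f'⟩ ⟨g'⟩
    refine congrArg (proj k S).map (?_ : ((f ▷ _) ≫ (_ ◁ g)) ≫ ((f' ▷ _) ≫ (_ ◁ g')) =
      ((f ≫ f') ▷ _) ≫ (_ ◁ (g ≫ g')))
    simp only [← MonoidalCategory.tensorHom_def, tensorHom_comp_tensorHom]
  whiskerLeft_id X Y := congrArg (proj k S).map (whiskerLeft_id X.as Y.as)
  id_whiskerRight X Y := congrArg (proj k S).map (id_whiskerRight X.as Y.as)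
  associator_naturality := by
    rintro X Y Z X' Y' Z' ⟨f⟩ ⟨g⟩ ⟨h⟩
    refine congrArg (proj k S).map
      (?_ : (((((f ▷ _) ≫ (_ ◁ g)) ▷ _) ≫ (_ ◁ h)) ≫ (α_ _ _ _).hom) =
        (α_ _ _ _).hom ≫ ((f ▷ _) ≫ (_ ◁ ((g ▷ _) ≫ (_ ◁ h)))))
    simp only [← MonoidalCategory.tensorHom_def, associator_naturality]
  leftUnitor_naturality := by
    rintro X Y ⟨f⟩
    exact congrArg (proj k S).map (leftUnitor_naturality f)
  rightUnitor_naturality := by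
    rintro X Y ⟨f⟩
    exact congrArg (proj k S).map (rightUnitor_naturality f)
  pentagon W X Y Z := congrArg (proj k S).map (pentagon W.as X.as Y.as Z.as)
  triangle X Y := congrArg (proj k S).map (triangle X.as Y.as)

variable [MonoidalPreadditive C]

instance : MonoidalPreadditive (TensorQuotient k S) where
  whiskerLeft_zero {X Y Z} := congrArg (proj k S).map
    (MonoidalPreadditive.whiskerLeft_zero (X := X.as) (Y := Y.as) (Z := Z.as))
  zero_whiskerRight {X Y Z} := congrArg (proj k S).map
    (MonoidalPreadditive.zero_whiskerRight (X := X.as) (Y := Y.as) (Z := Z.as))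
  whiskerLeft_add {X Y Z} := by
    rintro ⟨f⟩ ⟨g⟩
    exact congrArg (proj k S).map (MonoidalPreadditive.whiskerLeft_add (X := X.as) f g)
  add_whiskerRight {X Y Z} := by
    rintro ⟨f⟩ ⟨g⟩
    exact congrArg (proj k S).map (MonoidalPreadditive.add_whiskerRight (X := X.as) f g)

instance [MonoidalLinear k C] : MonoidalLinear k (TensorQuotient k S) where
  whiskerLeft_smul X Y Z r := by
    rintro ⟨f⟩
    exact congrArg (proj k S).map (MonoidalLinear.whiskerLeft_smul X.as r f)
  smul_whiskerRight r Y Z := by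
    rintro ⟨f⟩ X
    exact congrArg (proj k S).map (MonoidalLinear.smul_whiskerRight r f X.as)

end TensorQuotient

end Quot

/-! ### Isomorphisms of strict linear monoidal categories -/

/-- An isomorphism of `k`-linear monoidal categories that is strict: a `k`-linear functor with a
two-sided inverse functor (an isomorphism, not only an equivalence, of categories), with a monoidal
structure whose structure isomorphisms are identities. -/
structure LinearMonoidalIso (k : Type u) [CommRing k] (C : Type*) [Category C] [Preadditive C]
    [Linear k C] [MonoidalCategory C] (D : Type*) [Category D] [Preadditive D] [Linear k D]
    [MonoidalCategory D] where
  functor : C ⥤ D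
  inverse : D ⥤ C
  functor_inverse : functor ⋙ inverse = 𝟭 C
  inverse_functor : inverse ⋙ functor = 𝟭 D
  additive : functor.Additive
  linear : functor.Linear k
  monoidal : functor.Monoidal
  obj_unit : 𝟙_ D = functor.obj (𝟙_ C)
  obj_tensor : ∀ X Y : C, functor.obj X ⊗ functor.obj Y = functor.obj (X ⊗ Y)
  ε_eq : Functor.LaxMonoidal.ε functor = eqToHom obj_unit
  μ_eq : ∀ X Y : C, Functor.LaxMonoidal.μ functor X Y = eqToHom (obj_tensor X Y)

section Statement

variable (k : Type u) [CommRing k] (G : Type v) [Group G] (d : k)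

/-- The quotient of `Par(G)` by the relation `lolly = d`. -/
abbrev ParLolly : Type := TensorQuotient k (LollyRel k G d)

/-- The `n`-th tensor power of the generating object in the quotient. -/
abbrev ParLolly.go (n : ℕ) : ParLolly k G d := ⟨⟨n⟩⟩

variable {k G d}

/-- The morphism of the quotient represented by a formal string diagram. -/
abbrev ParLolly.mk {a b : ℕ} (f : Term k G a b) : ParLolly.go k G d a ⟶ ParLolly.go k G d b :=
  (TensorQuotient.proj k (LollyRel k G d)).map (Par.mk f)

/-- For a functor sending the `n`-th tensor power of the generating object to `n`: the image of a
morphism, as a linear combination of diagrams. -/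
noncomputable def image {F : ParLolly k G d ⥤ ParD k G d} (hF : ∀ n, F.obj (ParLolly.go k G d n) = ⟨n⟩)
    {a b : ℕ} (f : ParLolly.go k G d a ⟶ ParLolly.go k G d b) : Diagram G a b →₀ k :=
  (eqToHom (hF a).symm ≫ F.map f ≫ eqToHom (hF b) : (⟨a⟩ : ParD k G d) ⟶ ⟨b⟩)

variable (k)

/-- The diagram with a single part and the given labels, as a morphism. -/
noncomputable def onePart {a b : ℕ} (g : Fin a ⊕ Fin b → G) : Diagram G a b →₀ k :=
  Finsupp.single (GDiagram.mk ⊤ g) 1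

variable (G)

/-- The diagram of the transposition: two bottom and two top vertices, each bottom vertex being
joined to the opposite top vertex, all labels `1`. -/
noncomputable def crossDiagram : Diagram G 2 2 →₀ k :=
  Finsupp.single (GDiagram.mk (Setoid.ker (Sum.elim id Fin.rev)) (fun _ => 1)) 1

end Statement

end GroupPartition

open GroupPartition

/-! The prescribed diagrams satisfy all defining relations (`diagram_rel`) and the lolly relation
(`diagramGens_isModel`), so evaluating formal string diagrams in the category of diagrams gives a
linear, strictly monoidal functor F on the quotient that is the identity on the numbers of strands.
What has to be proved is that F is bijective on every space of morphisms.

The Frobenius relations make the generating object self-dual: the cup (a merge followed by a top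
pin) and the cap (a bottom pin followed by a split) satisfy the zigzag identities. Bending the last
top strand down turns a morphism a → b+1 into a morphism a+1 → b, unbending recovers it
(`unbend_bend`), and F commutes with both operations. Induction on b therefore reduces bijectivity
to the case of morphisms n → 0.

For these there is a normal form. A map c from n vertices to m blocks, with labels g, gives a
morphism `psi c g`: put the token g a on strand a, join the strand to the block c a, and close every
block with a top pin. Renumbering the blocks (`psi_perm`) or multiplying the labels of each block on
the left by a group element (`psi_token`) does not change it, so for surjective c it depends only on
the diagram of (c, g) (`psi_eq_of_closedDiagram_eq`).

These elements span. Precomposing `psi c g` with a generator at the right end, or with a crossing of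
adjacent strands, gives another `psi` or 0: a bottom pin deletes a vertex, a top pin adds a
singleton block, a merge doubles a vertex, a crossing permutes vertices, a token changes a label.
The decisive case is the split (`del_psi`): if its two halves end in one block, the bubble relation
gives 0 or one token, otherwise the two blocks fuse. An empty block is a lolly, hence a factor d
(`psi_mem_span`). Starting from the identity of the unit object one reaches every morphism n → 0
(`eval_mem_span`).

Finally F sends `psi c g`, for surjective c, to the basis vector of its diagram (`diagram_psi`). So
the linear map S from the free module on diagrams to the morphisms n → 0 that sends each diagram to
its `psi` is surjective and satisfies F ∘ S = 1; hence S and F are bijective (`bijective_zero`).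

The calculus is carried out for an arbitrary family of generators satisfying the relations
(`IsModel`), because it is used twice: in the quotient, and, for unbending, in the category of
diagrams. Most of it is organised so that generators act at the right end of a row of strands and
everything else is obtained by adding strands on the right. -/

namespace GroupPartition

universe u v w

/-! ### Calculus in a strict linear monoidal category on the natural numbers -/

namespace LinPRO

variable {k : Type u} [CommRing k] {P : LinPRO.{u, w} k}

/-- Composition in diagrammatic order. -/
def cmp {a b c : ℕ} (f : P.Hom a b) (g : P.Hom b c) : P.Hom a c := P.comp f g

infixr:80 " ⊚ " => LinPRO.cmp

/-- The morphism `f ⊗ 1`, with one additional strand on the right. -/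
def widen {a b : ℕ} (f : P.Hom a b) : P.Hom (a + 1) (b + 1) := P.tensor f (P.id 1)

/-- The morphism `1 ⊗ f`, with `m` additional strands on the left. -/
def pad (m : ℕ) {a b : ℕ} (f : P.Hom a b) : P.Hom (m + a) (m + b) := P.tensor (P.id m) f

theorem cmp_assoc {a b c e : ℕ} (f : P.Hom a b) (g : P.Hom b c) (h : P.Hom c e) :
    (f ⊚ g) ⊚ h = f ⊚ g ⊚ h := P.assoc f g h

theorem id_cmp {a b : ℕ} (f : P.Hom a b) : P.id a ⊚ f = f := P.id_comp f

theorem cmp_id {a b : ℕ} (f : P.Hom a b) : f ⊚ P.id b = f := P.comp_id f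

theorem cmp_smul {a b c : ℕ} (r : k) (f : P.Hom a b) (g : P.Hom b c) :
    f ⊚ (r • g) = r • (f ⊚ g) := (P.comp f).map_smul r g

theorem smul_cmp {a b c : ℕ} (r : k) (f : P.Hom a b) (g : P.Hom b c) :
    (r • f) ⊚ g = r • (f ⊚ g) := LinearMap.map_smul₂ P.comp r f g

theorem cmp_zero {a b c : ℕ} (f : P.Hom a b) : f ⊚ (0 : P.Hom b c) = 0 := (P.comp f).map_zero

theorem zero_cmp {a b c : ℕ} (g : P.Hom b c) : (0 : P.Hom a b) ⊚ g = 0 :=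
  LinearMap.map_zero₂ P.comp g

theorem cmp_add {a b c : ℕ} (f : P.Hom a b) (g g' : P.Hom b c) :
    f ⊚ (g + g') = f ⊚ g + f ⊚ g' := (P.comp f).map_add g g'

theorem add_cmp {a b c : ℕ} (f f' : P.Hom a b) (g : P.Hom b c) :
    (f + f') ⊚ g = f ⊚ g + f' ⊚ g := LinearMap.map_add₂ P.comp f f' g

/-- Composing both sides of an equation between composites with a further morphism. -/
theorem cmp_congr {a b b' c : ℕ} {f : P.Hom a b} {g : P.Hom b c} {f' : P.Hom a b'}
    {g' : P.Hom b' c} (h : f ⊚ g = f' ⊚ g') {e : ℕ} (x : P.Hom c e) :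
    f ⊚ g ⊚ x = f' ⊚ g' ⊚ x := by
  rw [← cmp_assoc, h, cmp_assoc]

theorem cmp_congr' {a b c : ℕ} {f : P.Hom a b} {g : P.Hom b c} {y : P.Hom a c}
    (h : f ⊚ g = y) {e : ℕ} (x : P.Hom c e) : f ⊚ g ⊚ x = y ⊚ x := by
  rw [← cmp_assoc, h]

theorem widen_id (a : ℕ) : widen (P.id a) = P.id (a + 1) := P.tensor_id a 1

theorem pad_id (m a : ℕ) : pad m (P.id a) = P.id (m + a) := P.tensor_id m a

theorem widen_cmp {a b c : ℕ} (f : P.Hom a b) (g : P.Hom b c) :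
    widen (f ⊚ g) = widen f ⊚ widen g := by
  have := P.interchange f g (P.id 1) (P.id 1)
  rw [P.id_comp] at this
  exact this.symm

theorem pad_cmp (m : ℕ) {a b c : ℕ} (f : P.Hom a b) (g : P.Hom b c) :
    pad m (f ⊚ g) = pad m f ⊚ pad m g := by
  have := P.interchange (P.id m) (P.id m) f g
  rw [P.id_comp] at this
  exact this.symm

theorem widen_smul {a b : ℕ} (r : k) (f : P.Hom a b) : widen (r • f) = r • widen f :=
  LinearMap.map_smul₂ P.tensor r f _

theorem widen_zero {a b : ℕ} : widen (0 : P.Hom a b) = 0 := LinearMap.map_zero₂ P.tensor _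

theorem widen_add {a b : ℕ} (f g : P.Hom a b) : widen (f + g) = widen f + widen g :=
  LinearMap.map_add₂ P.tensor f g _

theorem pad_smul (m : ℕ) {a b : ℕ} (r : k) (f : P.Hom a b) : pad m (r • f) = r • pad m f :=
  (P.tensor (P.id m)).map_smul r f

theorem pad_zero (m : ℕ) {a b : ℕ} : pad m (0 : P.Hom a b) = 0 := (P.tensor (P.id m)).map_zero

theorem pad_add (m : ℕ) {a b : ℕ} (f g : P.Hom a b) : pad m (f + g) = pad m f + pad m g :=
  (P.tensor (P.id m)).map_add f g

theorem pad_widen (m : ℕ) {a b : ℕ} (f : P.Hom a b) : pad m (widen f) = widen (pad m f) :=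
  (P.tensor_assoc (P.id m) f (P.id 1)).symm

theorem tensor_eq_cmp {a b c d : ℕ} (f : P.Hom a b) (g : P.Hom c d) :
    P.tensor f g = P.tensor f (P.id c) ⊚ pad b g := by
  have := P.interchange f (P.id b) (P.id c) g
  rw [P.id_comp, P.comp_id] at this
  exact this.symm

theorem tensor_eq_cmp' {a b c d : ℕ} (f : P.Hom a b) (g : P.Hom c d) :
    P.tensor f g = pad a g ⊚ P.tensor f (P.id d) := by
  have := P.interchange (P.id a) f g (P.id d)
  rw [P.id_comp, P.comp_id] at this
  exact this.symm

theorem tensor_id_succ {a b : ℕ} (f : P.Hom a b) (c : ℕ) :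
    P.tensor f (P.id (c + 1)) = widen (P.tensor f (P.id c)) := by
  rw [← P.tensor_id c 1]
  exact (P.tensor_assoc f (P.id c) (P.id 1)).symm

theorem tensor_id_zero {a b : ℕ} (f : P.Hom a b) : P.tensor f (P.id 0) = f := P.tensor_unit f

theorem tensor_id_two {a b : ℕ} (f : P.Hom a b) : P.tensor f (P.id 2) = widen (widen f) :=
  tensor_id_succ f 1

theorem castHom_heq {H : ℕ → ℕ → Type w} {a b a' b' : ℕ} (ha : a = a') (hb : b = b')
    (f : H a b) : castHom ha hb f ≍ f := by
  subst ha hb; rfl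

/-- The two sides have sources and targets that agree only up to associativity of addition. For the
generators, whose sources and targets are numerals, these types are definitionally equal and
`eq_of_heq` applies. -/
theorem pad_pad_heq (m n : ℕ) {a b : ℕ} (f : P.Hom a b) : pad m (pad n f) ≍ pad (m + n) f := by
  have h := P.tensor_assoc (P.id m) (P.id n) f
  rw [P.tensor_id] at h
  exact (heq_of_eq h.symm).trans (castHom_heq _ _ _)

theorem pad_zero_heq {a b : ℕ} (f : P.Hom a b) : pad 0 f ≍ f :=
  (castHom_heq _ _ _).symm.trans (heq_of_eq (P.unit_tensor f))

/-- The interchange law: morphisms on disjoint groups of strands may be applied in either order. -/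
theorem slide {a b c d : ℕ} (f : P.Hom a b) (g : P.Hom c d) :
    P.tensor f (P.id c) ⊚ pad b g = pad a g ⊚ P.tensor f (P.id d) := by
  rw [← tensor_eq_cmp, ← tensor_eq_cmp']

end LinPRO

open LinPRO

/-! ### Families of generators -/

/-- Values of the generators in a strict linear monoidal category. -/
structure Gens {k : Type u} [CommRing k] (P : LinPRO.{u, w} k) (G : Type v) where
  merge : P.Hom 2 1
  split : P.Hom 1 2
  cross : P.Hom 2 2
  bpin : P.Hom 0 1
  tpin : P.Hom 1 0
  token : G → P.Hom 1 1

namespace Gens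

variable {k : Type u} [CommRing k] {P : LinPRO.{u, w} k} {G : Type v}

/-- The value of a formal string diagram. -/
def eval (E : Gens P G) : ∀ {a b : ℕ}, Term k G a b → P.Hom a b
  | _, _, .strand a => P.id a
  | _, _, .comp f g => P.comp (E.eval f) (E.eval g)
  | _, _, .tensor f g => P.tensor (E.eval f) (E.eval g)
  | _, _, .zero => 0
  | _, _, .add f g => E.eval f + E.eval g
  | _, _, .smul r f => r • E.eval f
  | _, _, .merge => E.merge
  | _, _, .split => E.split
  | _, _, .cross => E.cross
  | _, _, .bpin => E.bpin
  | _, _, .tpin => E.tpin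
  | _, _, .token g => E.token g

/-- The generators satisfy the defining relations, and the lolly equals `d`. -/
structure IsModel [Group G] (E : Gens P G) (d : k) : Prop where
  rel : ∀ {a b : ℕ} {f g : Term k G a b}, GenRel k G f g → E.eval f = E.eval g
  lolly : E.bpin ⊚ E.tpin = d • P.id 0

variable (E : Gens P G)

/-- The merge to the right of `m` strands. -/
def mu (m : ℕ) : P.Hom (m + 2) (m + 1) := pad m E.merge
/-- The split to the right of `m` strands. -/
def del (m : ℕ) : P.Hom (m + 1) (m + 2) := pad m E.split
/-- The crossing to the right of `m` strands. -/
def cr (m : ℕ) : P.Hom (m + 2) (m + 2) := pad m E.cross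
/-- The bottom pin to the right of `m` strands. -/
def eta (m : ℕ) : P.Hom m (m + 1) := pad m E.bpin
/-- The top pin to the right of `m` strands. -/
def eps (m : ℕ) : P.Hom (m + 1) m := pad m E.tpin
/-- The token to the right of `m` strands. -/
def tok (m : ℕ) (g : G) : P.Hom (m + 1) (m + 1) := pad m (E.token g)

/-! ### Sliding a morphism past a generator on strands to its right -/

section Slide

variable {a b : ℕ} (f : P.Hom a b)

theorem slide_mu : widen (widen f) ⊚ E.mu b = E.mu a ⊚ widen f := by
  rw [← tensor_id_two]; exact slide f E.merge

theorem slide_del : widen f ⊚ E.del b = E.del a ⊚ widen (widen f) := by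
  rw [← tensor_id_two]; exact slide f E.split

theorem slide_cr : widen (widen f) ⊚ E.cr b = E.cr a ⊚ widen (widen f) := by
  rw [← tensor_id_two]; exact slide f E.cross

theorem slide_eta : f ⊚ E.eta b = E.eta a ⊚ widen f := by
  have := slide f E.bpin
  rw [tensor_id_zero] at this
  exact this

theorem slide_eps : widen f ⊚ E.eps b = E.eps a ⊚ f := by
  have := slide f E.tpin
  rw [tensor_id_zero] at this
  exact this

theorem slide_tok (g : G) : widen f ⊚ E.tok b g = E.tok a g ⊚ widen f := slide f (E.token g)

end Slide

theorem pad_mu (m : ℕ) : pad m (pad 1 E.merge) = E.mu (m + 1) := eq_of_heq (pad_pad_heq _ _ _)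
theorem pad_del (m : ℕ) : pad m (pad 1 E.split) = E.del (m + 1) := eq_of_heq (pad_pad_heq _ _ _)
theorem pad_cr (m : ℕ) : pad m (pad 1 E.cross) = E.cr (m + 1) := eq_of_heq (pad_pad_heq _ _ _)
theorem pad_eta (m : ℕ) : pad m (pad 1 E.bpin) = E.eta (m + 1) := eq_of_heq (pad_pad_heq _ _ _)
theorem pad_eps (m : ℕ) : pad m (pad 1 E.tpin) = E.eps (m + 1) := eq_of_heq (pad_pad_heq _ _ _)
theorem pad_tok (m : ℕ) (g : G) : pad m (pad 1 (E.token g)) = E.tok (m + 1) g :=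
  eq_of_heq (pad_pad_heq _ _ _)

/-! ### The defining relations to the right of `m` strands -/

namespace IsModel

variable {E} [Group G] {d : k} (h : E.IsModel d) (m : ℕ)

include h

theorem unit : E.eta (m + 1) ⊚ E.mu m = P.id (m + 1) := by
  have e : pad m (pad 1 E.bpin ⊚ E.merge) = pad m (P.id 1) :=
    congrArg (pad m) (h.rel GenRel.unit)
  rwa [pad_cmp, pad_eta, pad_id] at e

theorem counit_right : E.del m ⊚ E.eps (m + 1) = P.id (m + 1) := by
  have e : pad m (E.split ⊚ pad 1 E.tpin) = pad m (P.id 1) :=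
    congrArg (pad m) (h.rel GenRel.counit_right)
  rwa [pad_cmp, pad_eps, pad_id] at e

theorem counit_left : E.del m ⊚ widen (E.eps m) = P.id (m + 1) := by
  have e : pad m (E.split ⊚ widen E.tpin) = pad m (P.id 1) :=
    congrArg (pad m) (h.rel GenRel.counit_left)
  rwa [pad_cmp, pad_widen, pad_id] at e

theorem frobenius_left : E.del (m + 1) ⊚ widen (E.mu m) = E.mu m ⊚ E.del m := by
  have e : pad m (pad 1 E.split ⊚ widen E.merge) = pad m (E.merge ⊚ E.split) :=
    congrArg (pad m) (h.rel GenRel.frobenius_left)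
  rwa [pad_cmp, pad_widen, pad_del, pad_cmp] at e

theorem frobenius_right : widen (E.del m) ⊚ E.mu (m + 1) = E.mu m ⊚ E.del m := by
  have e : pad m (widen E.split ⊚ pad 1 E.merge) = pad m (E.merge ⊚ E.split) :=
    congrArg (pad m) (h.rel GenRel.frobenius_right)
  rwa [pad_cmp, pad_widen, pad_mu, pad_cmp] at e

theorem cross_cross : E.cr m ⊚ E.cr m = P.id (m + 2) := by
  have e : pad m (E.cross ⊚ E.cross) = pad m (P.id 2) :=
    congrArg (pad m) (h.rel GenRel.cross_cross)
  rwa [pad_cmp, pad_id] at e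

theorem braid : widen (E.cr m) ⊚ E.cr (m + 1) ⊚ widen (E.cr m) =
    E.cr (m + 1) ⊚ widen (E.cr m) ⊚ E.cr (m + 1) := by
  have e : pad m ((widen E.cross ⊚ pad 1 E.cross) ⊚ widen E.cross) =
      pad m ((pad 1 E.cross ⊚ widen E.cross) ⊚ pad 1 E.cross) :=
    congrArg (pad m) (h.rel GenRel.braid)
  simp only [pad_cmp, pad_widen, pad_cr, cmp_assoc] at e
  exact e

theorem bpin_cross : E.eta (m + 1) ⊚ E.cr m = widen (E.eta m) := by
  have e : pad m (pad 1 E.bpin ⊚ E.cross) = pad m (widen E.bpin) :=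
    congrArg (pad m) (h.rel GenRel.bpin_cross)
  rwa [pad_cmp, pad_widen, pad_eta] at e

theorem cross_tpin : E.cr m ⊚ E.eps (m + 1) = widen (E.eps m) := by
  have e : pad m (E.cross ⊚ pad 1 E.tpin) = pad m (widen E.tpin) :=
    congrArg (pad m) (h.rel GenRel.cross_tpin)
  rwa [pad_cmp, pad_widen, pad_eps] at e

theorem cross_merge : E.cr (m + 1) ⊚ widen (E.cr m) ⊚ E.mu (m + 1) = widen (E.mu m) ⊚ E.cr m := by
  have e : pad m ((pad 1 E.cross ⊚ widen E.cross) ⊚ pad 1 E.merge) =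
      pad m (widen E.merge ⊚ E.cross) :=
    congrArg (pad m) (h.rel GenRel.cross_merge)
  simp only [pad_cmp, pad_widen, pad_cr, pad_mu, cmp_assoc] at e
  exact e

theorem split_cross : E.del (m + 1) ⊚ widen (E.cr m) ⊚ E.cr (m + 1) =
    E.cr m ⊚ widen (E.del m) := by
  have e : pad m ((pad 1 E.split ⊚ widen E.cross) ⊚ pad 1 E.cross) =
      pad m (E.cross ⊚ widen E.split) :=
    congrArg (pad m) (h.rel GenRel.split_cross)
  simp only [pad_cmp, pad_widen, pad_cr, pad_del, cmp_assoc] at e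
  exact e

theorem comm : E.cr m ⊚ E.mu m = E.mu m := by
  have e : pad m (E.cross ⊚ E.merge) = pad m E.merge := congrArg (pad m) (h.rel GenRel.comm)
  rwa [pad_cmp] at e

theorem bubble_eq (g : G) :
    E.del m ⊚ widen (E.tok m g) ⊚ E.tok (m + 1) g ⊚ E.mu m = E.tok m g := by
  have e : pad m ((E.split ⊚ P.tensor (E.token g) (E.token g)) ⊚ E.merge) = pad m (E.token g) :=
    congrArg (pad m) (h.rel (GenRel.bubble_eq g))
  rw [tensor_eq_cmp] at e
  change pad m ((E.split ⊚ (widen (E.token g) ⊚ _)) ⊚ E.merge) = _ at e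
  simp only [pad_cmp, pad_widen, pad_tok, cmp_assoc] at e
  exact e

theorem bubble_ne {g g' : G} (hg : g ≠ g') :
    E.del m ⊚ widen (E.tok m g) ⊚ E.tok (m + 1) g' ⊚ E.mu m = 0 := by
  have e : pad m ((E.split ⊚ P.tensor (E.token g) (E.token g')) ⊚ E.merge) = pad m 0 :=
    congrArg (pad m) (h.rel (GenRel.bubble_ne g g' hg))
  rw [tensor_eq_cmp] at e
  change pad m ((E.split ⊚ (widen (E.token g) ⊚ _)) ⊚ E.merge) = _ at e
  simp only [pad_cmp, pad_widen, pad_tok, cmp_assoc, pad_zero] at e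
  exact e

theorem token_mul (g g' : G) : E.tok m g' ⊚ E.tok m g = E.tok m (g * g') := by
  have e : pad m (E.token g' ⊚ E.token g) = pad m (E.token (g * g')) :=
    congrArg (pad m) (h.rel (GenRel.token_mul g g'))
  rwa [pad_cmp] at e

theorem token_one : E.tok m 1 = P.id (m + 1) :=
  (congrArg (pad m) (h.rel GenRel.token_one) : pad m (E.token 1) = pad m (P.id 1)).trans
    (pad_id _ _)

theorem token_cross (g : G) : widen (E.tok m g) ⊚ E.cr m = E.cr m ⊚ E.tok (m + 1) g := by
  have e : pad m (widen (E.token g) ⊚ E.cross) = pad m (E.cross ⊚ pad 1 (E.token g)) :=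
    congrArg (pad m) (h.rel (GenRel.token_cross g))
  rwa [pad_cmp, pad_cmp, pad_widen, pad_tok] at e

theorem token_split (g : G) :
    E.tok m g ⊚ E.del m = E.del m ⊚ widen (E.tok m g) ⊚ E.tok (m + 1) g := by
  have e : pad m (E.token g ⊚ E.split) =
      pad m (E.split ⊚ P.tensor (E.token g) (E.token g)) :=
    congrArg (pad m) (h.rel (GenRel.token_split g))
  rw [tensor_eq_cmp] at e
  change _ = pad m (E.split ⊚ (widen (E.token g) ⊚ _)) at e
  simp only [pad_cmp, pad_widen, pad_tok] at e
  exact e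

theorem bpin_token (g : G) : E.eta m ⊚ E.tok m g = E.eta m := by
  have e : pad m (E.bpin ⊚ E.token g) = pad m E.bpin :=
    congrArg (pad m) (h.rel (GenRel.bpin_token g))
  rwa [pad_cmp] at e

theorem eta_eps : E.eta m ⊚ E.eps m = d • P.id m := by
  have e : pad m (E.bpin ⊚ E.tpin) = pad m (d • P.id 0) := congrArg (pad m) h.lolly
  rwa [pad_cmp, pad_smul, pad_id] at e

/-! ### Consequences of the relations -/

/-- The presentation contains the unit law on one side only; pulling the pin through the crossing
and commutativity give the other side. -/
theorem unit_left : widen (E.eta m) ⊚ E.mu m = P.id (m + 1) := by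
  rw [← h.bpin_cross, cmp_assoc, h.comm, h.unit]

/-- This is `cross_merge` multiplied by inverse crossings on both ends, since the crossing is an
involution. -/
theorem merge_cross : E.mu (m + 1) ⊚ E.cr m = widen (E.cr m) ⊚ E.cr (m + 1) ⊚ widen (E.mu m) := by
  have e := congrArg (fun x => widen (E.cr m) ⊚ E.cr (m + 1) ⊚ x ⊚ E.cr m) (h.cross_merge m)
  simp only [cmp_assoc] at e
  rw [cmp_congr' (h.cross_cross (m + 1)), id_cmp, ← cmp_assoc (widen (E.cr m)) (widen (E.cr m)),
    ← widen_cmp, h.cross_cross, widen_id, id_cmp, cmp_id] at e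
  exact e

theorem split_cross' : E.del (m + 1) ⊚ widen (E.cr m) =
    E.cr m ⊚ widen (E.del m) ⊚ E.cr (m + 1) := by
  have e := congrArg (fun x => x ⊚ E.cr (m + 1)) (h.split_cross m)
  simp only [cmp_assoc] at e
  rwa [h.cross_cross, cmp_id] at e

end IsModel

/-- The cup to the right of `m` strands. -/
def cup (m : ℕ) : P.Hom (m + 2) m := E.mu m ⊚ E.eps m
/-- The cap to the right of `m` strands. -/
def cap (m : ℕ) : P.Hom m (m + 2) := E.eta m ⊚ E.del m

theorem slide_cup {a b : ℕ} (f : P.Hom a b) : widen (widen f) ⊚ E.cup b = E.cup a ⊚ f := by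
  rw [cup, cup, cmp_congr (E.slide_mu f), slide_eps, cmp_assoc]

theorem slide_cap {a b : ℕ} (f : P.Hom a b) : f ⊚ E.cap b = E.cap a ⊚ widen (widen f) := by
  rw [cap, cap, cmp_congr (E.slide_eta f), slide_del, cmp_assoc]

namespace IsModel

variable {E} [Group G] {d : k} (h : E.IsModel d) (m : ℕ)

include h

/-- `μ = (Δ ⊗ 1)(1 ⊗ cup)` -/
theorem mu_eq : E.mu m = widen (E.del m) ⊚ E.cup (m + 1) := by
  rw [cup, ← cmp_assoc, h.frobenius_right, cmp_assoc, h.counit_right, cmp_id]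

/-- `μ = (1 ⊗ Δ)(cup ⊗ 1)` -/
theorem mu_eq' : E.mu m = E.del (m + 1) ⊚ widen (E.cup m) := by
  rw [cup, widen_cmp, ← cmp_assoc, h.frobenius_left, cmp_assoc, h.counit_left, cmp_id]

/-- By `mu_eq` the split of the cap and the cup form a merge, so the zigzag is the unit law. -/
theorem zigzag : widen (E.cap m) ⊚ E.cup (m + 1) = P.id (m + 1) := by
  rw [cap, widen_cmp, cmp_assoc, ← h.mu_eq, h.unit_left]

theorem zigzag' : E.cap (m + 1) ⊚ widen (E.cup m) = P.id (m + 1) := by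
  rw [cap, cmp_assoc, ← h.mu_eq', h.unit]

/-- Expand the merge by `mu_eq'` on one side and by `mu_eq` on the other: both become the split of
the middle strand followed by cups on two disjoint pairs of strands, which slide past each other. -/
theorem cup_assoc : widen (E.mu m) ⊚ E.cup m = E.mu (m + 1) ⊚ E.cup m := by
  have e1 : widen (E.mu m) ⊚ E.cup m =
      widen (E.del (m + 1)) ⊚ widen (widen (E.cup m)) ⊚ E.cup m := by
    rw [h.mu_eq', widen_cmp, cmp_assoc]
  have e2 : E.mu (m + 1) ⊚ E.cup m = widen (E.del (m + 1)) ⊚ E.cup (m + 2) ⊚ E.cup m := by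
    rw [h.mu_eq (m + 1), cmp_assoc]
  rw [e1, e2, slide_cup]

/-- Associativity is not among the relations. By the Frobenius relation and `mu_eq`, both composites
start with a split of the first of the three strands and continue with one of the two sides of
`cup_assoc`. -/
theorem assoc : widen (E.mu m) ⊚ E.mu m = E.mu (m + 1) ⊚ E.mu m := by
  have e1 : widen (E.mu m) ⊚ E.mu m =
      widen (widen (E.del m)) ⊚ widen (E.mu (m + 1)) ⊚ E.cup (m + 1) := by
    rw [h.mu_eq m, ← cmp_assoc, ← widen_cmp, ← h.mu_eq, ← h.frobenius_right, widen_cmp, cmp_assoc]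
  have e2 : E.mu (m + 1) ⊚ E.mu m =
      widen (widen (E.del m)) ⊚ E.mu (m + 2) ⊚ E.cup (m + 1) := by
    rw [h.mu_eq m, cmp_congr (E.slide_mu (E.del m))]
  rw [e1, e2, h.cup_assoc]

theorem merge_comm : E.cr (m + 1) ⊚ widen (E.mu m) ⊚ E.mu m = widen (E.mu m) ⊚ E.mu m := by
  rw [h.assoc, cmp_congr' (h.comm (m + 1))]

theorem cross_cup : E.cr m ⊚ E.cup m = E.cup m := by
  rw [cup, cmp_congr' (h.comm m)]

theorem cap_token (g : G) : E.cap m ⊚ widen (E.tok m g) ⊚ E.tok (m + 1) g = E.cap m := by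
  rw [cap, cmp_assoc, ← h.token_split, cmp_congr' (h.bpin_token m g)]

theorem token_inv (g : G) : E.tok m g ⊚ E.tok m g⁻¹ = P.id (m + 1) := by
  rw [h.token_mul, inv_mul_cancel, h.token_one]

end IsModel

end Gens

end GroupPartition

namespace GroupPartition

universe u v w

open LinPRO

namespace Gens

variable {k : Type u} [CommRing k] {P : LinPRO.{u, w} k} {G : Type v}

/-! ### Tokens at cups, top pins and merges -/

namespace IsModel

variable {E : Gens P G} [Group G] {d : k} (h : E.IsModel d) (m : ℕ)

include h

/-- The transpose of a token, obtained by carrying it around a cap and a cup, cancels against the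
same token by `cap_token`; hence it is the token of the inverse element. The zigzag turns this into
a statement about the cup alone. -/
theorem token_cup (g : G) : E.tok (m + 1) g ⊚ E.cup m = widen (E.tok m g⁻¹) ⊚ E.cup m := by
  have e : E.tok m g⁻¹ = E.cap (m + 1) ⊚ widen (E.tok (m + 1) g) ⊚ widen (E.cup m) := by
    have e1 : E.cap (m + 1) ⊚ widen (E.tok (m + 1) g) ⊚ widen (E.cup m) ⊚ E.tok m g =
        P.id (m + 1) := by
      have e0 := congrArg (fun x => x ⊚ widen (E.cup m)) (h.cap_token (m + 1) g)
      simp only [cmp_assoc] at e0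
      rw [h.zigzag'] at e0
      rw [slide_tok]
      exact e0
    have e2 := congrArg (fun x => x ⊚ E.tok m g⁻¹) e1
    simp only [cmp_assoc] at e2
    rw [h.token_inv, cmp_id, id_cmp] at e2
    exact e2.symm
  rw [e, ← widen_cmp, widen_cmp, cmp_assoc, slide_cup, cmp_congr' (h.zigzag (m + 1)), id_cmp]

theorem eta_cup : E.eta (m + 1) ⊚ E.cup m = E.eps m := by
  rw [cup, cmp_congr' (h.unit m), id_cmp]

/-- Only the bottom pin is assumed to absorb tokens. A top pin is a cup with a bottom pin on its
second leg, and the token travels around the cup to that pin. -/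
theorem token_tpin (g : G) : E.tok m g ⊚ E.eps m = E.eps m := by
  have e := h.token_cup m g⁻¹
  rw [inv_inv] at e
  rw [← h.eta_cup, cmp_congr (E.slide_eta (E.tok m g)), ← e, cmp_congr' (h.bpin_token (m + 1) _)]

/-- Write the merge as a split followed by a cup. On the right-hand side, the token on the first
strand is doubled by the split, and one copy cancels against the other token, which arrives inverted
around the cup. -/
theorem merge_token (g : G) :
    E.mu m ⊚ E.tok m g = widen (E.tok m g) ⊚ E.tok (m + 1) g ⊚ E.mu m := by
  have e1 : E.mu m ⊚ E.tok m g =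
      widen (E.del m) ⊚ widen (widen (E.tok m g)) ⊚ E.cup (m + 1) := by
    rw [h.mu_eq, cmp_assoc, slide_cup]
  have e2 : widen (E.tok m g) ⊚ E.tok (m + 1) g ⊚ E.mu m =
      widen (E.tok m g ⊚ E.del m) ⊚ E.tok (m + 2) g ⊚ E.cup (m + 1) := by
    rw [h.mu_eq, ← cmp_congr (E.slide_tok (E.del m) g), widen_cmp, cmp_assoc]
  rw [e1, e2, h.token_cup (m + 1), h.token_split, ← cmp_assoc (widen _) (widen _) (E.cup _),
    ← widen_cmp, ← cmp_assoc (widen _) (widen _) (E.cup _), ← widen_cmp, cmp_assoc, cmp_assoc,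
    h.token_inv, cmp_id]

theorem token_cross' (g : G) : E.cr m ⊚ widen (E.tok m g) = E.tok (m + 1) g ⊚ E.cr m := by
  have e := congrArg (fun x => E.cr m ⊚ x ⊚ E.cr m) (h.token_cross m g)
  simp only [cmp_assoc] at e
  rwa [h.cross_cross, cmp_id, cmp_congr' (h.cross_cross m), id_cmp] at e

/-- Splitting a strand and merging the two halves into different blocks that are then closed off
amounts to merging the two blocks and the strand. -/
theorem split_join :
    E.del (m + 2) ⊚ widen (E.cr (m + 1)) ⊚ widen (widen (E.mu m)) ⊚ E.mu (m + 1) ⊚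
      E.eps (m + 1) ⊚ E.eps m = widen (E.mu m) ⊚ E.mu m ⊚ E.eps m := by
  have e1 : widen (widen (E.mu m)) ⊚ E.mu (m + 1) ⊚ E.eps (m + 1) ⊚ E.eps m =
      E.cup (m + 2) ⊚ E.cup m := by
    rw [← cmp_assoc (E.mu (m + 1)), ← cup, cmp_congr (E.slide_cup (E.mu m)), ← cup]
  -- The crossings are absorbed by the cup and by the merge through commutativity, and the split
  -- with the adjacent cup is a merge by `mu_eq`.
  rw [e1, cmp_congr' (h.split_cross' (m + 1)), cmp_assoc, cmp_assoc,
    cmp_congr' (h.cross_cup (m + 2)), ← cmp_assoc (widen _), ← h.mu_eq,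
    cmp_congr' (h.comm (m + 1)), ← h.cup_assoc, cup]

end IsModel

/-! ### Joining a strand to a block -/

variable (E : Gens P G)

/-- Merging the last strand into the strand `i`. -/
def join : ∀ {m : ℕ}, Fin m → P.Hom (m + 1) m
  | 0, i => i.elim0
  | m + 1, i => Fin.lastCases (motive := fun _ => P.Hom (m + 2) (m + 1)) (E.mu m)
      (fun j => E.cr m ⊚ widen (join j)) i

@[simp] theorem join_last (m : ℕ) : E.join (Fin.last m) = E.mu m := by
  simp [join]

@[simp] theorem join_castSucc {m : ℕ} (i : Fin m) :
    E.join i.castSucc = E.cr m ⊚ widen (E.join i) := by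
  simp [join]

/-- The crossing of two adjacent strands. -/
def swp : ∀ {m : ℕ}, Fin m → P.Hom (m + 1) (m + 1)
  | 0, i => i.elim0
  | m + 1, i => Fin.lastCases (motive := fun _ => P.Hom (m + 2) (m + 2)) (E.cr m)
      (fun j => widen (swp j)) i

@[simp] theorem swp_last (m : ℕ) : E.swp (Fin.last m) = E.cr m := by
  simp [swp]

@[simp] theorem swp_castSucc {m : ℕ} (i : Fin m) : E.swp i.castSucc = widen (E.swp i) := by
  simp [swp]

/-- A pin at the top of every strand. -/
def pins : ∀ m : ℕ, P.Hom m 0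
  | 0 => P.id 0
  | m + 1 => E.eps m ⊚ pins m

/-- A pin at the bottom of every strand. -/
def bpins : ∀ m : ℕ, P.Hom 0 m
  | 0 => P.id 0
  | m + 1 => bpins m ⊚ E.eta m

/-- A token on every strand. -/
def toks : ∀ {m : ℕ}, (Fin m → G) → P.Hom m m
  | 0, _ => P.id 0
  | m + 1, t => widen (toks (t ∘ Fin.castSucc)) ⊚ E.tok m (t (Fin.last m))

theorem slide_pins {a b : ℕ} (f : P.Hom a b) : widen f ⊚ E.pins (b + 1) =
    E.eps a ⊚ f ⊚ E.pins b := by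
  rw [pins, cmp_congr (E.slide_eps f)]

/-! ### How joins, pins, tokens and crossings of blocks interact -/

namespace IsModel

variable {E} [Group G] {d : k} (h : E.IsModel d)

include h

theorem eta_join {m : ℕ} (i : Fin m) : E.eta m ⊚ E.join i = P.id m := by
  induction m with
  | zero => exact i.elim0
  | succ m ih =>
    induction i using Fin.lastCases with
    | last => rw [join_last, h.unit]
    | cast i => rw [join_castSucc, cmp_congr' (h.bpin_cross m), ← widen_cmp, ih, widen_id]

theorem mu_join {m : ℕ} (i : Fin m) : E.mu m ⊚ E.join i = widen (E.join i) ⊚ E.join i := by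
  induction m with
  | zero => exact i.elim0
  | succ m ih =>
    induction i using Fin.lastCases with
    | last => rw [join_last, h.assoc]
    | cast i =>
      rw [join_castSucc, cmp_congr' (h.merge_cross m), cmp_assoc, cmp_assoc, ← widen_cmp, ih,
        widen_cmp, widen_cmp, cmp_assoc, cmp_congr (E.slide_cr (E.join i))]

theorem cross_join_last {m : ℕ} (i : Fin m) :
    E.cr (m + 1) ⊚ widen (E.join (Fin.last m)) ⊚ E.join i.castSucc =
      widen (E.join i.castSucc) ⊚ E.join (Fin.last m) := by
  rw [join_last, join_castSucc, widen_cmp, cmp_assoc, slide_mu, ← cmp_congr (h.cross_merge m),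
    cmp_congr' (h.cross_cross (m + 1)), id_cmp, cmp_assoc]

/-- The order in which two strands are joined to blocks is irrelevant. If both blocks are last this
is commutativity and associativity, if one is last it is naturality of the crossing for the merge,
and if neither is last the braid relation reduces to fewer blocks. -/
theorem cross_join {m : ℕ} (i j : Fin m) :
    E.cr m ⊚ widen (E.join i) ⊚ E.join j = widen (E.join j) ⊚ E.join i := by
  induction m with
  | zero => exact i.elim0
  | succ m ih =>
    induction i using Fin.lastCases with
    | last =>
      induction j using Fin.lastCases with
      | last => rw [join_last, h.merge_comm]
      | cast j => exact h.cross_join_last j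
    | cast i =>
      induction j using Fin.lastCases with
      | last => rw [← h.cross_join_last, cmp_congr' (h.cross_cross (m + 1)), id_cmp]
      | cast j =>
        have e1 : E.cr (m + 1) ⊚ widen (E.join i.castSucc) ⊚ E.join j.castSucc =
            (E.cr (m + 1) ⊚ widen (E.cr m) ⊚ E.cr (m + 1)) ⊚
              widen (widen (E.join i) ⊚ E.join j) := by
          rw [join_castSucc, join_castSucc, widen_cmp, widen_cmp, cmp_assoc, cmp_assoc, cmp_assoc,
            cmp_congr (E.slide_cr (E.join i))]
        have e2 : widen (E.join j.castSucc) ⊚ E.join i.castSucc =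
            widen (E.cr m) ⊚ E.cr (m + 1) ⊚ widen (widen (E.join j) ⊚ E.join i) := by
          rw [join_castSucc, join_castSucc, widen_cmp, widen_cmp, cmp_assoc,
            cmp_congr (E.slide_cr (E.join j))]
        rw [e1, e2, ← ih i j, ← h.braid, widen_cmp (E.cr m)]
        simp only [cmp_assoc]

/-- Pulling tokens from the blocks down through the join doubles the token of block `i`, by
`merge_token`; those of the other blocks slide past the joined strand. -/
theorem join_token {m : ℕ} (i : Fin m) (t : Fin m → G) :
    E.join i ⊚ E.toks t = widen (E.toks t) ⊚ E.tok m (t i) ⊚ E.join i := by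
  induction m with
  | zero => exact i.elim0
  | succ m ih =>
    induction i using Fin.lastCases with
    | last =>
      rw [join_last, toks, ← cmp_congr (E.slide_mu _), h.merge_token, widen_cmp, cmp_assoc]
    | cast i =>
      rw [join_castSucc, toks, cmp_assoc, ← cmp_assoc (widen _) (widen _), ← widen_cmp, ih]
      simp only [Function.comp, widen_cmp, cmp_assoc]
      rw [slide_tok, ← cmp_congr (E.slide_cr _), cmp_congr (h.token_cross' m _),
        ← cmp_congr (h.token_cross m _), ← cmp_congr (E.slide_tok (E.tok m _) _)]

theorem toks_pins {m : ℕ} (t : Fin m → G) : E.toks t ⊚ E.pins m = E.pins m := by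
  induction m with
  | zero => exact id_cmp _
  | succ m ih =>
    rw [toks, pins, cmp_assoc, cmp_congr' (h.token_tpin m _), cmp_congr (E.slide_eps _), ih]

theorem bpins_toks {m : ℕ} (t : Fin m → G) : E.bpins m ⊚ E.toks t = E.bpins m := by
  induction m with
  | zero => exact id_cmp _
  | succ m ih =>
    rw [toks, bpins, cmp_assoc, ← cmp_congr (E.slide_eta _), h.bpin_token, ← cmp_assoc, ih]

theorem swp_pins {m : ℕ} (j : Fin m) : E.swp j ⊚ E.pins (m + 1) = E.pins (m + 1) := by
  induction m with
  | zero => exact j.elim0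
  | succ m ih =>
    induction j using Fin.lastCases with
    | last => rw [swp_last, pins, pins, cmp_congr' (h.cross_tpin m), cmp_congr (E.slide_eps _)]
    | cast j => rw [swp_castSucc, slide_pins, ih]; rfl

theorem bpins_swp {m : ℕ} (j : Fin m) : E.bpins (m + 1) ⊚ E.swp j = E.bpins (m + 1) := by
  induction m with
  | zero => exact j.elim0
  | succ m ih =>
    induction j using Fin.lastCases with
    | last =>
      rw [swp_last, bpins, bpins, cmp_assoc, cmp_assoc, h.bpin_cross, ← slide_eta, cmp_assoc]
    | cast j => rw [swp_castSucc, bpins, cmp_assoc, ← slide_eta, ← cmp_assoc, ih]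

/-- Crossing two neighbouring blocks after a join. If the joined block is one of the two, this is
naturality of the crossing for the merge; if it lies to the left of both, the braid relation; if to
the right, sliding. -/
theorem join_swp {m : ℕ} (i : Fin (m + 1)) (j : Fin m) :
    E.join i ⊚ E.swp j = widen (E.swp j) ⊚ E.join (Equiv.swap j.castSucc j.succ i) := by
  induction m with
  | zero => exact j.elim0
  | succ m ih =>
    induction j using Fin.lastCases with
    | last =>
      rw [swp_last, Fin.succ_last]
      induction i using Fin.lastCases with
      | last => rw [Equiv.swap_apply_right, join_last, join_castSucc, join_last, h.merge_cross]
      | cast i =>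
        induction i using Fin.lastCases with
        | last =>
          rw [Equiv.swap_apply_left, join_last, join_castSucc, join_last, cmp_assoc,
            ← h.cross_merge, cmp_congr' (h.cross_cross (m + 1)), id_cmp]
        | cast i =>
          rw [Equiv.swap_apply_of_ne_of_ne (by simp)
            (Fin.castSucc_lt_last _).ne, join_castSucc, join_castSucc, widen_cmp, cmp_assoc,
            cmp_assoc, slide_cr]
          have e := congrArg (fun x => x ⊚ widen (widen (E.join i))) (h.braid m)
          simp only [cmp_assoc] at e
          exact e.symm
    | cast j =>
      rw [swp_castSucc, Fin.succ_castSucc]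
      induction i using Fin.lastCases with
      | last =>
        rw [Equiv.swap_apply_of_ne_of_ne (Fin.castSucc_lt_last _).ne'
          (Fin.castSucc_lt_last _).ne', join_last, slide_mu]
      | cast i =>
        rw [← (Fin.castSucc_injective _).map_swap, join_castSucc, join_castSucc, cmp_assoc,
          ← widen_cmp, ih, widen_cmp, cmp_congr (E.slide_cr _)]

end IsModel

end Gens

end GroupPartition

namespace GroupPartition

universe u v w

open LinPRO

namespace Gens

variable {k : Type u} [CommRing k] {P : LinPRO.{u, w} k} {G : Type v}

/-! ### Morphisms given by labelled maps of finite sets -/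

variable (E : Gens P G)

/-- The morphism joining every strand `a`, with token `g a`, to the block `c a`. -/
def arr : ∀ {n m : ℕ}, (Fin n → Fin m) → (Fin n → G) → P.Hom n m
  -- Every block begins with a bottom pin, so a block outside the image of `c` remains as a bare
  -- pin.
  | 0, m, _, _ => E.bpins m
  | n + 1, m, c, g => widen (arr (Fin.init c : Fin n → Fin m) (Fin.init g : Fin n → G)) ⊚
      E.tok m (g (Fin.last n)) ⊚ E.join (c (Fin.last n))

/-- The morphism to the unit object joining the strands with the same value of `c`. -/
def psi {n m : ℕ} (c : Fin n → Fin m) (g : Fin n → G) : P.Hom n 0 := E.arr c g ⊚ E.pins m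

theorem arr_snoc {n m : ℕ} (c : Fin n → Fin m) (g : Fin n → G) (i : Fin m) (x : G) :
    E.arr (Fin.snoc c i : Fin (n + 1) → Fin m) (Fin.snoc g x : Fin (n + 1) → G) =
      widen (E.arr c g) ⊚ E.tok m x ⊚ E.join i := by
  rw [arr, Fin.snoc_last, Fin.snoc_last, Fin.init_snoc, Fin.init_snoc]

theorem arr_snoc_cmp {n m r : ℕ} (c : Fin n → Fin m) (g : Fin n → G) (i : Fin m) (x : G)
    (f : P.Hom m r) :
    E.arr (Fin.snoc c i : Fin (n + 1) → Fin m) (Fin.snoc g x : Fin (n + 1) → G) ⊚ f =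
      widen (E.arr c g) ⊚ E.tok m x ⊚ E.join i ⊚ f := by
  rw [arr_snoc, cmp_assoc, cmp_assoc]

theorem exists_snoc {T : Type*} {n : ℕ} (c : Fin (n + 1) → T) :
    ∃ (c' : Fin n → T) (i : T), c = (Fin.snoc c' i : Fin (n + 1) → T) :=
  ⟨Fin.init c, c (Fin.last n), (Fin.snoc_init_self c).symm⟩

theorem comp_snoc {S T : Type*} {n : ℕ} (f : S → T) (c : Fin n → S) (i : S) :
    f ∘ (Fin.snoc c i : Fin (n + 1) → S) = (Fin.snoc (f ∘ c) (f i) : Fin (n + 1) → T) :=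
  Fin.comp_snoc f c i

theorem comp₂_snoc {R S T : Type*} {n : ℕ} (f : R → S → T) (c : Fin n → R) (g : Fin n → S)
    (i : R) (x : S) :
    (fun a => f ((Fin.snoc c i : Fin (n + 1) → R) a) ((Fin.snoc g x : Fin (n + 1) → S) a)) =
      (Fin.snoc (fun a => f (c a) (g a)) (f i x) : Fin (n + 1) → T) := by
  funext a
  induction a using Fin.lastCases <;> simp

/-- The map identifying the last two elements. -/
def collapse {m : ℕ} : Fin (m + 2) → Fin (m + 1) :=
  Fin.lastCases (motive := fun _ => Fin (m + 1)) (Fin.last m) id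

@[simp] theorem collapse_last {m : ℕ} : collapse (Fin.last (m + 1)) = Fin.last m := by
  simp [collapse]

@[simp] theorem collapse_castSucc {m : ℕ} (i : Fin (m + 1)) : collapse i.castSucc = i := by
  simp [collapse]

/-- Brings two distinct blocks into the last two positions, where they can be merged. -/
theorem exists_perm {m : ℕ} {i j : Fin (m + 2)} (hij : i ≠ j) :
    ∃ σ : Equiv.Perm (Fin (m + 2)), σ i = (Fin.last m).castSucc ∧ σ j = Fin.last (m + 1) := by
  have h1 : Equiv.swap j (Fin.last (m + 1)) i ≠ Fin.last (m + 1) := by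
    intro e
    exact hij ((Equiv.swap j (Fin.last (m + 1))).injective (e.trans (Equiv.swap_apply_left _ _).symm))
  refine ⟨Equiv.swap (Equiv.swap j (Fin.last (m + 1)) i) (Fin.last m).castSucc *
    Equiv.swap j (Fin.last (m + 1)), ?_, ?_⟩
  · simp
  · rw [Equiv.Perm.mul_apply, Equiv.swap_apply_left,
      Equiv.swap_apply_of_ne_of_ne h1.symm (Fin.castSucc_lt_last _).ne']

/-! ### Effect of the generators on labelled maps -/

namespace IsModel

variable {E} [Group G] {d : k} (h : E.IsModel d)

include h

theorem join_mu {m : ℕ} (i : Fin (m + 2)) :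
    E.join i ⊚ E.mu m = widen (E.mu m) ⊚ E.join (collapse i) := by
  induction i using Fin.lastCases with
  | last => rw [collapse_last, join_last, join_last, h.assoc]
  | cast i =>
    rw [collapse_castSucc, join_castSucc, cmp_assoc]
    induction i using Fin.lastCases with
    | last => rw [join_last, h.merge_comm]
    | cast i =>
      rw [join_castSucc, widen_cmp, cmp_assoc, slide_mu, ← cmp_congr (h.cross_merge m),
        cmp_assoc]

theorem join_eta {m : ℕ} (i : Fin m) :
    E.join i ⊚ E.eta m = widen (E.eta m) ⊚ E.join i.castSucc := by
  rw [join_castSucc, ← h.bpin_cross, cmp_assoc, cmp_congr' (h.cross_cross m), id_cmp, slide_eta]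

/-- Morphisms composed above `arr` act on the blocks: tokens multiply labels on the left, crossings
renumber blocks, merges fuse them, bottom pins add empty ones. In each case the vertices are removed
one at a time by the corresponding rule for a single `join`. -/
theorem arr_toks {n m : ℕ} (c : Fin n → Fin m) (g : Fin n → G) (t : Fin m → G) :
    E.arr c g ⊚ E.toks t = E.arr c (fun a => t (c a) * g a) := by
  induction n with
  | zero => exact h.bpins_toks t
  | succ n ih =>
    obtain ⟨c, i, rfl⟩ := exists_snoc c
    obtain ⟨g, x, rfl⟩ := exists_snoc g
    rw [comp₂_snoc (fun c g => t c * g), arr_snoc, arr_snoc, cmp_assoc, cmp_assoc, h.join_token,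
      ← cmp_congr (E.slide_tok _ _), ← ih, widen_cmp, cmp_assoc, cmp_congr' (h.token_mul m _ _)]

theorem arr_swp {n m : ℕ} (c : Fin n → Fin (m + 1)) (g : Fin n → G) (j : Fin m) :
    E.arr c g ⊚ E.swp j = E.arr (Equiv.swap j.castSucc j.succ ∘ c) g := by
  induction n with
  | zero => exact h.bpins_swp j
  | succ n ih =>
    obtain ⟨c, i, rfl⟩ := exists_snoc c
    obtain ⟨g, x, rfl⟩ := exists_snoc g
    rw [comp_snoc, arr_snoc, arr_snoc, cmp_assoc, cmp_assoc, h.join_swp,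
      ← cmp_congr (E.slide_tok _ _), ← ih, widen_cmp, cmp_assoc]

theorem arr_mu {n m : ℕ} (c : Fin n → Fin (m + 2)) (g : Fin n → G) :
    E.arr c g ⊚ E.mu m = E.arr (collapse ∘ c) g := by
  induction n with
  | zero =>
    change (E.bpins (m + 1) ⊚ _) ⊚ _ = E.bpins (m + 1)
    rw [cmp_assoc, h.unit, cmp_id]
  | succ n ih =>
    obtain ⟨c, i, rfl⟩ := exists_snoc c
    obtain ⟨g, x, rfl⟩ := exists_snoc g
    rw [comp_snoc, arr_snoc, arr_snoc, cmp_assoc, cmp_assoc, h.join_mu,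
      ← cmp_congr (E.slide_tok _ _), ← ih, widen_cmp, cmp_assoc]

theorem arr_eta {n m : ℕ} (c : Fin n → Fin m) (g : Fin n → G) :
    E.arr c g ⊚ E.eta m = E.arr (Fin.castSucc ∘ c) g := by
  induction n with
  | zero => rfl
  | succ n ih =>
    obtain ⟨c, i, rfl⟩ := exists_snoc c
    obtain ⟨g, x, rfl⟩ := exists_snoc g
    rw [comp_snoc, arr_snoc, arr_snoc, cmp_assoc, cmp_assoc, h.join_eta,
      ← cmp_congr (E.slide_tok _ _), ← ih, widen_cmp, cmp_assoc]

/-- Tokens inserted just below the top pins are absorbed by the pins, but pulled down they multiply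
the labels of their blocks. This is the equivalence of labellings. -/
theorem psi_token {n m : ℕ} (c : Fin n → Fin m) (g : Fin n → G) (t : Fin m → G) :
    E.psi c (fun a => t (c a) * g a) = E.psi c g := by
  rw [psi, psi, ← h.arr_toks, cmp_assoc, h.toks_pins]

/-- A row of top pins absorbs a crossing of neighbours, and adjacent transpositions generate the
symmetric group. -/
theorem psi_perm {n m : ℕ} (c : Fin n → Fin m) (g : Fin n → G) (σ : Equiv.Perm (Fin m)) :
    E.psi (σ ∘ c) g = E.psi c g := by
  cases m with
  | zero =>
    congr 1
    funext a
    exact (c a).elim0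
  | succ m =>
    have hσ : σ ∈ Submonoid.closure (Set.range fun i : Fin m ↦ Equiv.swap i.castSucc i.succ) := by
      rw [Equiv.Perm.mclosure_swap_castSucc_succ]; trivial
    induction hσ using Submonoid.closure_induction generalizing c with
    | mem σ hσ =>
      obtain ⟨j, rfl⟩ := hσ
      rw [psi, psi, ← h.arr_swp, cmp_assoc, h.swp_pins]
    | one => rfl
    | mul σ τ _ _ hσ hτ => exact (hσ (τ ∘ c)).trans (hτ c)

/-- A block without vertices is a lolly, a bottom pin closed by a top pin. -/
theorem psi_castSucc {n m : ℕ} (c : Fin n → Fin m) (g : Fin n → G) :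
    E.psi (Fin.castSucc ∘ c) g = d • E.psi c g := by
  rw [psi, psi, ← h.arr_eta, cmp_assoc, pins, cmp_congr' (h.eta_eps m), smul_cmp, id_cmp, cmp_smul]

/-- Morphisms composed below `psi` act on the vertices. A bottom pin deletes the last vertex; this
may leave its block empty, which is why `c` is not required to be surjective. -/
theorem eta_psi {n m : ℕ} (c : Fin (n + 1) → Fin m) (g : Fin (n + 1) → G) :
    E.eta n ⊚ E.psi c g = E.psi (Fin.init c : Fin n → Fin m) (Fin.init g : Fin n → G) := by
  obtain ⟨c, i, rfl⟩ := exists_snoc c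
  obtain ⟨g, x, rfl⟩ := exists_snoc g
  rw [Fin.init_snoc, Fin.init_snoc, psi, psi, arr_snoc_cmp, ← cmp_congr (E.slide_eta _),
    cmp_congr' (h.bpin_token m x), cmp_congr' (h.eta_join i), id_cmp]

/-- A strand ending in its own top pin is a new block with one vertex; the unit law inserts the
bottom pin and the join that the normal form requires. -/
theorem eps_psi {n m : ℕ} (c : Fin n → Fin m) (g : Fin n → G) :
    E.eps n ⊚ E.psi c g =
      E.psi (Fin.snoc (Fin.castSucc ∘ c) (Fin.last m) : Fin (n + 1) → Fin (m + 1))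
        (Fin.snoc g 1 : Fin (n + 1) → G) := by
  rw [psi, psi, arr_snoc_cmp, h.token_one, id_cmp, join_last, ← h.arr_eta, widen_cmp, cmp_assoc,
    cmp_congr' (h.unit_left m), id_cmp, slide_pins]

theorem tok_psi {n m : ℕ} (c : Fin (n + 1) → Fin m) (g : Fin (n + 1) → G) (t : G) :
    E.tok n t ⊚ E.psi c g = E.psi c
      (Fin.snoc (Fin.init g : Fin n → G) (g (Fin.last n) * t) : Fin (n + 1) → G) := by
  obtain ⟨c, i, rfl⟩ := exists_snoc c
  obtain ⟨g, x, rfl⟩ := exists_snoc g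
  rw [Fin.init_snoc, Fin.snoc_last, psi, psi, arr_snoc_cmp, arr_snoc_cmp,
    ← cmp_congr (E.slide_tok _ _), cmp_congr' (h.token_mul _ _ _)]

theorem mu_psi {n m : ℕ} (c : Fin (n + 1) → Fin m) (g : Fin (n + 1) → G) :
    E.mu n ⊚ E.psi c g = E.psi (Fin.snoc c (c (Fin.last n)) : Fin (n + 2) → Fin m)
      (Fin.snoc g (g (Fin.last n)) : Fin (n + 2) → G) := by
  obtain ⟨c, i, rfl⟩ := exists_snoc c
  obtain ⟨g, x, rfl⟩ := exists_snoc g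
  rw [psi, psi, arr_snoc_cmp, arr_snoc_cmp, arr_snoc, Fin.snoc_last, Fin.snoc_last, widen_cmp,
    widen_cmp, cmp_assoc, cmp_assoc, ← cmp_congr (E.slide_mu _), cmp_congr (h.merge_token m x),
    cmp_congr (E.slide_tok (E.join i) x), cmp_assoc, cmp_congr (h.mu_join i)]

/-- Each token crosses together with its strand, and by `cross_join` the two joins may then be
exchanged. -/
theorem cr_arr {n m : ℕ} (c : Fin n → Fin m) (g : Fin n → G) (i j : Fin m) (x y : G) :
    E.cr n ⊚ E.arr (Fin.snoc (Fin.snoc c i : Fin (n + 1) → Fin m) j : Fin (n + 2) → Fin m)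
      (Fin.snoc (Fin.snoc g x : Fin (n + 1) → G) y : Fin (n + 2) → G) =
    E.arr (Fin.snoc (Fin.snoc c j : Fin (n + 1) → Fin m) i : Fin (n + 2) → Fin m)
      (Fin.snoc (Fin.snoc g y : Fin (n + 1) → G) x : Fin (n + 2) → G) := by
  simp only [arr_snoc, widen_cmp, cmp_assoc]
  rw [← cmp_congr (E.slide_cr _), cmp_congr (E.slide_tok (E.join i) y),
    cmp_congr (h.token_cross' m x), ← cmp_congr (h.token_cross m y), h.cross_join,
    ← cmp_congr (E.slide_tok (E.tok m y) x), ← cmp_congr (E.slide_tok (E.join j) x)]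

theorem exists_swp_arr {n m : ℕ} (j : Fin n) (c : Fin (n + 1) → Fin m) (g : Fin (n + 1) → G) :
    ∃ c' g', E.swp j ⊚ E.arr c g = E.arr c' g' := by
  induction n with
  | zero => exact j.elim0
  | succ n ih =>
    obtain ⟨c, i, rfl⟩ := exists_snoc c
    obtain ⟨g, x, rfl⟩ := exists_snoc g
    induction j using Fin.lastCases with
    | last =>
      obtain ⟨c, i', rfl⟩ := exists_snoc c
      obtain ⟨g, x', rfl⟩ := exists_snoc g
      exact ⟨_, _, by rw [swp_last, h.cr_arr]⟩
    | cast j =>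
      obtain ⟨c', g', e⟩ := ih j c g
      refine ⟨Fin.snoc c' i, Fin.snoc g' x, ?_⟩
      rw [swp_castSucc, arr_snoc, arr_snoc, ← cmp_assoc, ← widen_cmp, e]

/-- Splitting a strand whose two halves are joined to different blocks. -/
theorem del_arr_of_ne {n m : ℕ} (c : Fin n → Fin (m + 2)) (g : Fin n → G) :
    E.del n ⊚ E.psi (Fin.snoc (Fin.snoc c (Fin.last m).castSucc : Fin (n + 1) → Fin (m + 2))
        (Fin.last (m + 1)) : Fin (n + 2) → Fin (m + 2))
      (Fin.snoc (Fin.snoc g 1 : Fin (n + 1) → G) 1 : Fin (n + 2) → G) =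
    E.psi (Fin.snoc (collapse ∘ c) (Fin.last m) : Fin (n + 1) → Fin (m + 1))
      (Fin.snoc g 1 : Fin (n + 1) → G) := by
  rw [psi, psi, arr_snoc_cmp, arr_snoc_cmp, arr_snoc, h.token_one, id_cmp, h.token_one, id_cmp,
    id_cmp, widen_cmp, cmp_assoc, ← cmp_congr (E.slide_del _), join_castSucc,
    join_last, join_last, widen_cmp, cmp_assoc, pins, pins, ← h.arr_mu, widen_cmp,
    cmp_assoc]
  have e := congrArg (fun x => x ⊚ E.pins m) (h.split_join m)
  simp only [cmp_assoc] at e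
  rw [e]

/-- If the halves of the split strand meet again in one block, they form a bubble, which is 0 or a
single token. If they lie in different blocks, the strand connects these blocks, and after
normalisation of labels and positions `del_arr_of_ne` fuses them. -/
theorem del_psi {n m : ℕ} (c : Fin (n + 2) → Fin m) (g : Fin (n + 2) → G) :
    E.del n ⊚ E.psi c g = 0 ∨ ∃ (r : ℕ) (c' : Fin (n + 1) → Fin r) (g' : Fin (n + 1) → G),
      E.del n ⊚ E.psi c g = E.psi c' g' := by
  obtain ⟨c, j, rfl⟩ := exists_snoc c
  obtain ⟨g, y, rfl⟩ := exists_snoc g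
  obtain ⟨c, i, rfl⟩ := exists_snoc c
  obtain ⟨g, x, rfl⟩ := exists_snoc g
  by_cases hij : i = j
  · subst hij
    -- Two successive joins to the same block are a merge followed by one join (`mu_join`), which
    -- exposes the bubble.
    have e : E.del n ⊚ E.psi
        (Fin.snoc (Fin.snoc c i : Fin (n + 1) → Fin m) i : Fin (n + 2) → Fin m)
        (Fin.snoc (Fin.snoc g x : Fin (n + 1) → G) y : Fin (n + 2) → G) = widen (E.arr c g) ⊚
        (E.del m ⊚ widen (E.tok m x) ⊚ E.tok (m + 1) y ⊚ E.mu m) ⊚ E.join i ⊚ E.pins m := by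
      rw [psi, arr_snoc_cmp, arr_snoc]
      simp only [widen_cmp, cmp_assoc]
      rw [cmp_congr (h.mu_join i), cmp_congr (E.slide_tok (E.join i) y),
        ← cmp_congr (E.slide_del _)]
    by_cases hxy : x = y
    · subst hxy
      refine Or.inr ⟨m, Fin.snoc c i, Fin.snoc g x, ?_⟩
      rw [e, h.bubble_eq, psi, arr_snoc_cmp]
    · left
      rw [e, h.bubble_ne m hxy, zero_cmp, cmp_zero]
  · right
    match m, c, i, j, hij with
    | 0, _, i, _, _ => exact i.elim0
    | 1, _, i, j, hij => exact (hij (Subsingleton.elim i j)).elim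
    | m + 2, c, i, j, hij =>
      obtain ⟨σ, hi, hj⟩ := exists_perm hij
      refine ⟨m + 1, ?_, ?_, ?_⟩
      -- The new map and labels are left as metavariables and read off from the right-hand side of
      -- `del_arr_of_ne`.
      rotate_left 2
      · classical
        -- Multiplying the two blocks by these elements makes both labels of the split strand equal
        -- to 1, so that no tokens remain on its halves.
        let t : Fin (m + 2) → G := fun b => if b = i then x⁻¹ else y⁻¹
        rw [← h.psi_token _ _ t, comp₂_snoc (fun c g => t c * g), comp₂_snoc (fun c g => t c * g),
          ← h.psi_perm _ _ σ, comp_snoc, comp_snoc, hi, hj,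
          show t i * x = 1 by simp [t], show t j * y = 1 by simp [t, Ne.symm hij],
          h.del_arr_of_ne]

/-! ### The span of the closed diagrams -/

/-- An empty block is renumbered to be the last one and removed at the cost of a factor `d`. -/
theorem psi_mem_span {n m : ℕ} (c : Fin n → Fin m) (g : Fin n → G) :
    E.psi c g ∈ Submodule.span k {x : P.Hom n 0 | ∃ (m : ℕ) (c : Fin n → Fin m) (g : Fin n → G),
      Function.Surjective c ∧ x = E.psi c g} := by
  induction m with
  | zero => exact Submodule.subset_span ⟨0, c, g, fun b => b.elim0, rfl⟩
  | succ m ih =>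
    by_cases hc : Function.Surjective c
    · exact Submodule.subset_span ⟨m + 1, c, g, hc, rfl⟩
    · simp only [Function.Surjective, not_forall, not_exists] at hc
      obtain ⟨b, hb⟩ := hc
      have hl : ∀ a, Equiv.swap b (Fin.last m) (c a) ≠ Fin.last m := fun a e =>
        hb a ((Equiv.swap b (Fin.last m)).injective (e.trans (Equiv.swap_apply_left _ _).symm))
      rw [← h.psi_perm c g (Equiv.swap b (Fin.last m))]
      have : Equiv.swap b (Fin.last m) ∘ c =
          Fin.castSucc ∘ fun a => (Equiv.swap b (Fin.last m) (c a)).castPred (hl a) := by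
        funext a; simp
      rw [this, h.psi_castSucc]
      exact Submodule.smul_mem _ _ (ih _)

end IsModel

/-! ### Reduction to generators at the right end and adjacent crossings -/

theorem mu_zero : E.mu 0 = E.merge := eq_of_heq (pad_zero_heq _)
theorem del_zero : E.del 0 = E.split := eq_of_heq (pad_zero_heq _)
theorem cr_zero : E.cr 0 = E.cross := eq_of_heq (pad_zero_heq _)
theorem eta_zero : E.eta 0 = E.bpin := eq_of_heq (pad_zero_heq _)
theorem eps_zero : E.eps 0 = E.tpin := eq_of_heq (pad_zero_heq _)
theorem tok_zero (g : G) : E.tok 0 g = E.token g := eq_of_heq (pad_zero_heq _)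

/-- The morphisms generated under composition and linear combinations by the crossings of adjacent
strands and the other generators at the right end. -/
inductive Elem : ∀ {a b : ℕ}, P.Hom a b → Prop
  | id (a : ℕ) : Elem (P.id a)
  | cmp {a b c : ℕ} {f : P.Hom a b} {g : P.Hom b c} : Elem f → Elem g → Elem (f ⊚ g)
  | zero {a b : ℕ} : Elem (0 : P.Hom a b)
  | add {a b : ℕ} {f g : P.Hom a b} : Elem f → Elem g → Elem (f + g)
  | smul {a b : ℕ} (r : k) {f : P.Hom a b} : Elem f → Elem (r • f)
  | swp {m : ℕ} (j : Fin m) : Elem (E.swp j)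
  | mu (m : ℕ) : Elem (E.mu m)
  | del (m : ℕ) : Elem (E.del m)
  | eta (m : ℕ) : Elem (E.eta m)
  | eps (m : ℕ) : Elem (E.eps m)
  | tok (m : ℕ) (g : G) : Elem (E.tok m g)

theorem pad_swp (b : ℕ) {m : ℕ} (j : Fin m) : pad b (E.swp j) = E.swp (Fin.natAdd b j) := by
  induction m with
  | zero => exact j.elim0
  | succ m ih =>
    induction j using Fin.lastCases with
    | last =>
      rw [swp_last, Fin.natAdd_last]
      exact (eq_of_heq (pad_pad_heq b m E.cross)).trans (E.swp_last (b + m)).symm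
    | cast j =>
      rw [swp_castSucc, pad_widen, ih]
      exact (E.swp_castSucc (Fin.natAdd b j)).symm

namespace Elem

variable {E}

theorem cr (m : ℕ) : E.Elem (E.cr m) := by
  rw [← swp_last]; exact .swp _

theorem widen_cr (m : ℕ) : E.Elem (LinPRO.widen (E.cr m)) := by
  rw [← swp_last, ← swp_castSucc]; exact .swp _

/-- Strands added on the left leave a generator at the right end; only the number of strands before
it, or the position of the crossing, changes. -/
theorem pad {a b : ℕ} {f : P.Hom a b} (n : ℕ) (hf : E.Elem f) : E.Elem (LinPRO.pad n f) := by
  induction hf with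
  | id a => rw [pad_id]; exact .id _
  | cmp _ _ hf hg => rw [pad_cmp]; exact .cmp hf hg
  | zero => rw [pad_zero]; exact .zero
  | add _ _ hf hg => rw [pad_add]; exact .add hf hg
  | smul r _ hf => rw [pad_smul]; exact .smul r hf
  | swp j => rw [pad_swp]; exact .swp (Fin.natAdd n j)
  | mu m =>
    rw [show LinPRO.pad n (E.mu m) = E.mu (n + m) from eq_of_heq (pad_pad_heq _ _ _)]
    exact .mu (n + m)
  | del m =>
    rw [show LinPRO.pad n (E.del m) = E.del (n + m) from eq_of_heq (pad_pad_heq _ _ _)]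
    exact .del (n + m)
  | eta m =>
    rw [show LinPRO.pad n (E.eta m) = E.eta (n + m) from eq_of_heq (pad_pad_heq _ _ _)]
    exact .eta (n + m)
  | eps m =>
    rw [show LinPRO.pad n (E.eps m) = E.eps (n + m) from eq_of_heq (pad_pad_heq _ _ _)]
    exact .eps (n + m)
  | tok m g =>
    rw [show LinPRO.pad n (E.tok m g) = E.tok (n + m) g from eq_of_heq (pad_pad_heq _ _ _)]
    exact .tok (n + m) g

variable [Group G] {d : k}

/-- A strand added on the right of a generator is carried to its left by crossings, using naturality
of the crossing; the generator is then again at the right end. -/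
theorem widen {a b : ℕ} {f : P.Hom a b} (h : E.IsModel d) (hf : E.Elem f) :
    E.Elem (LinPRO.widen f) := by
  induction hf with
  | id a => rw [widen_id]; exact .id _
  | cmp _ _ hf hg => rw [widen_cmp]; exact .cmp hf hg
  | zero => rw [widen_zero]; exact .zero
  | add _ _ hf hg => rw [widen_add]; exact .add hf hg
  | smul r _ hf => rw [widen_smul]; exact .smul r hf
  | swp j => rw [← swp_castSucc]; exact .swp _
  | mu m =>
    rw [← cmp_id (LinPRO.widen (E.mu m)), ← h.cross_cross, ← cmp_congr (h.cross_merge m), cmp_assoc]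
    exact .cmp (.cr _) (.cmp (.widen_cr m) (.cmp (.mu _) (.cr _)))
  | del m =>
    rw [← id_cmp (LinPRO.widen (E.del m)), ← h.cross_cross, cmp_assoc, ← h.split_cross]
    exact .cmp (.cr _) (.cmp (.del _) (.cmp (.widen_cr m) (.cr _)))
  | eta m => rw [← h.bpin_cross]; exact .cmp (.eta _) (.cr _)
  | eps m => rw [← h.cross_tpin]; exact .cmp (.cr _) (.eps _)
  | tok m g =>
    rw [← cmp_id (LinPRO.widen (E.tok m g)), ← h.cross_cross, cmp_congr (h.token_cross m g)]
    exact .cmp (.cr _) (.cmp (.tok _ _) (.cr _))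

/-- A tensor product is `f` with strands added on the right followed by `g` with strands added on
the left; the strands on the right are added one by one. -/
theorem tensor {a b c e : ℕ} {f : P.Hom a b} {g : P.Hom c e} (h : E.IsModel d) (hf : E.Elem f)
    (hg : E.Elem g) : E.Elem (P.tensor f g) := by
  rw [tensor_eq_cmp]
  refine .cmp ?_ (hg.pad b)
  clear hg g
  induction c with
  | zero => rw [tensor_id_zero]; exact hf
  | succ c ih => rw [tensor_id_succ]; exact widen h ih

theorem eval (h : E.IsModel d) {a b : ℕ} (f : Term k G a b) : E.Elem (E.eval f) := by
  induction f with
  | strand a => exact .id a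
  | comp f g hf hg => exact .cmp hf hg
  | tensor f g hf hg => exact tensor h hf hg
  | zero => exact .zero
  | add f g hf hg => exact .add hf hg
  | smul r f hf => exact .smul r hf
  | merge => rw [Gens.eval, ← mu_zero]; exact .mu 0
  | split => rw [Gens.eval, ← del_zero]; exact .del 0
  | cross => rw [Gens.eval, ← cr_zero]; exact .cr 0
  | bpin => rw [Gens.eval, ← eta_zero]; exact .eta 0
  | tpin => rw [Gens.eval, ← eps_zero]; exact .eps 0
  | token g => rw [Gens.eval, ← tok_zero]; exact .tok 0 g

/-- Precomposition with generated morphisms preserves the span of the closed diagrams. -/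
theorem cmp_mem_span (h : E.IsModel d) {a b : ℕ} {f : P.Hom a b} (hf : E.Elem f) {x : P.Hom b 0}
    (hx : x ∈ Submodule.span k {x : P.Hom b 0 | ∃ (m : ℕ) (c : Fin b → Fin m) (g : Fin b → G),
      Function.Surjective c ∧ x = E.psi c g}) :
    f ⊚ x ∈ Submodule.span k {x : P.Hom a 0 | ∃ (m : ℕ) (c : Fin a → Fin m) (g : Fin a → G),
      Function.Surjective c ∧ x = E.psi c g} := by
  induction hf with
  | cmp _ _ hf hg => rw [cmp_assoc]; exact hf (hg hx)
  | zero => rw [zero_cmp]; exact Submodule.zero_mem _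
  | add _ _ hf hg => rw [add_cmp]; exact Submodule.add_mem _ (hf hx) (hg hx)
  | smul r _ hf => rw [smul_cmp]; exact Submodule.smul_mem _ _ (hf hx)
  -- What remains are the identity and the generators. By linearity `x` may be taken to be a single
  -- `psi`, and the alternatives below are the rules for the individual cases.
  | _ =>
    induction hx using Submodule.span_induction with
    | zero => rw [cmp_zero]; exact Submodule.zero_mem _
    | add _ _ _ _ hx hy => rw [cmp_add]; exact Submodule.add_mem _ hx hy
    | smul r _ _ hx => rw [cmp_smul]; exact Submodule.smul_mem _ _ hx
    | mem x hx =>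
      obtain ⟨m, c, g, -, rfl⟩ := hx
      first
      | rw [id_cmp]; exact h.psi_mem_span c g
      | rw [h.mu_psi]; exact h.psi_mem_span _ _
      | rw [h.eta_psi]; exact h.psi_mem_span _ _
      | rw [h.eps_psi]; exact h.psi_mem_span _ _
      | rw [h.tok_psi]; exact h.psi_mem_span _ _
      | rcases h.del_psi c g with e | ⟨_, _, _, e⟩ <;> rw [e]
        · exact Submodule.zero_mem _
        · exact h.psi_mem_span _ _
      | obtain ⟨c', g', e⟩ := h.exists_swp_arr ‹_› c g
        rw [psi, ← cmp_assoc, e]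
        exact h.psi_mem_span c' g'

end Elem

variable {E} in
/-- The morphisms to the unit object are spanned by the closed diagrams. -/
theorem IsModel.eval_mem_span [Group G] {d : k} (h : E.IsModel d) {n : ℕ} (f : Term k G n 0) :
    E.eval f ∈ Submodule.span k {x : P.Hom n 0 | ∃ (m : ℕ) (c : Fin n → Fin m) (g : Fin n → G),
      Function.Surjective c ∧ x = E.psi c g} := by
  rw [← cmp_id (E.eval f)]
  refine (Elem.eval h f).cmp_mem_span h ?_
  -- The identity of the unit object is the `psi` of the empty map, with no blocks.
  refine Submodule.subset_span ⟨0, id, fun a => a.elim0, Function.surjective_id, ?_⟩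
  exact (id_cmp _).symm

/-! ### Bending the last strand -/

/-- Bending the last top strand down. -/
def bend {a b : ℕ} (f : P.Hom a (b + 1)) : P.Hom (a + 1) b := widen f ⊚ E.cup b

/-- Bending the last bottom strand up. -/
def unbend {a b : ℕ} (f : P.Hom (a + 1) b) : P.Hom a (b + 1) := E.cap a ⊚ widen f

-- This is `zigzag'` after sliding `f` through the cap. The other composite is not needed:
-- injectivity uses this identity in the source of the comparison map, surjectivity uses it among
-- diagrams.
variable {E} in
theorem IsModel.unbend_bend [Group G] {d : k} (h : E.IsModel d) {a b : ℕ} (f : P.Hom a (b + 1)) :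
    E.unbend (E.bend f) = f := by
  rw [unbend, bend, widen_cmp, ← cmp_congr (E.slide_cap f), h.zigzag', cmp_id]

end Gens

end GroupPartition

namespace GroupPartition

universe u v w

open LinPRO

/-! ### Diagrams given by labelled maps -/

section Maps

variable {A B C T : Type w} {G : Type v} [Group G] {k : Type u} [CommRing k]

/-- The diagram of a labelled map from the bottom to the top row. -/
def funD (c : A → B) (g : A → G) : GDiagram G (A ⊕ B) :=
  GDiagram.mk (Setoid.ker (Sum.elim c id)) (Sum.elim g fun _ => 1)

/-- The diagram of a labelled map from the top to the bottom row. -/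
def cofunD (c : B → A) (g : B → G) : GDiagram G (A ⊕ B) :=
  GDiagram.mk (Setoid.ker (Sum.elim id c)) (Sum.elim (fun _ => 1) g)

theorem ker_rel {V W : Type*} {f : V → W} {x y : V} : (Setoid.ker f) x y ↔ f x = f y := Iff.rfl

/-- The composite of diagrams whose stack has the fibres of `f` as components. -/
theorem compDiagram_eq (d : k) {T : Type*} {X : GDiagram G (A ⊕ B)} {Y : GDiagram G (B ⊕ C)}
    (f : A ⊕ (B ⊕ C) → T) (s : T → A ⊕ (B ⊕ C))
    (hX : ∀ a b, X.part a b → f (lower a) = f (lower b))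
    (hY : ∀ a b, Y.part a b → f (upper a) = f (upper b))
    (hs : ∀ x, stack X.part Y.part x (s (f x)))
    (ho : ∀ x, ∃ y, f (outer y) = f x) {l : A ⊕ (B ⊕ C) → G} (hl : Glued X Y l) :
    compDiagram d X Y = Finsupp.single (GDiagram.mk (Setoid.ker (f ∘ outer)) (l ∘ outer)) 1 := by
  -- `f` is constant on components, and each vertex is connected to the representative `s` of its
  -- fibre, so the components are exactly the nonempty fibres.
  have hst : stack X.part Y.part = Setoid.ker f := by
    apply le_antisymm
    · exact fun a b h => stack_const f hX hY a b h
    · intro a b h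
      have h : f a = f b := h
      exact Setoid.trans' _ (hs a) (h ▸ Setoid.symm' _ (hs b))
  rw [compDiagram_of_glued d hl, starPart, alpha, hst]
  -- By `ho` every component reaches an outer row, hence no factor `d` occurs.
  have : IsEmpty (Missed (Setoid.ker f) (outer : A ⊕ C → _)) := by
    refine ⟨fun ⟨q, hq⟩ => ?_⟩
    induction q using Quotient.inductionOn with
    | h x =>
      obtain ⟨y, hy⟩ := ho x
      exact hq y (Quotient.sound hy)
  rw [Nat.card_of_isEmpty, pow_zero]
  rfl

/-- Each component of the stack contains exactly one top vertex, and labelling the stack with 1 on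
the top row forces the label `g' b` in the middle and the stated product at the bottom. -/
theorem funD_comp (d : k) (c : A → B) (g : A → G) (c' : B → C) (g' : B → G) :
    compDiagram d (funD c g) (funD c' g') =
      Finsupp.single (funD (c' ∘ c) (fun a => g' (c a) * g a)) 1 := by
  rw [compDiagram_eq d (Sum.elim (c' ∘ c) (Sum.elim c' id)) (fun x => Sum.inr (Sum.inr x))
    (l := Sum.elim (fun a => g' (c a) * g a) (Sum.elim g' fun _ => 1))]
  · congr 2
    · congr 1; funext x; rcases x with x | x <;> rfl
    · funext x; rcases x with x | x <;> rfl
  · rintro (a | a) (b | b) h <;> exact congrArg c' h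
  · exact fun a b h => h
  · have key : ∀ b : B, stack (funD c g).part (funD c' g').part (Sum.inr (Sum.inl b))
        (Sum.inr (Sum.inr (c' b))) := fun b =>
      stack_upper (Q := (funD c' g').part) (a := Sum.inl b) (b := Sum.inr (c' b)) rfl
    rintro (a | b | x)
    · exact Setoid.trans' _ (stack_lower (P := (funD c g).part) (a := Sum.inl a)
        (b := Sum.inr (c a)) rfl) (key (c a))
    · exact key b
    · exact Setoid.refl' _ _
  · intro x
    exact ⟨Sum.inr (Sum.elim (c' ∘ c) (Sum.elim c' id) x), rfl⟩
  · refine ⟨GDiagram.isLabel_mk.2 ⟨g' ∘ Sum.elim c id, fun a b h => congrArg g' h, ?_⟩,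
      GDiagram.isLabel_mk_self _ _⟩
    rintro (a | b) <;> simp [lower]

theorem cofunD_comp (d : k) (c : B → A) (g : B → G) (c' : C → B) (g' : C → G) :
    compDiagram d (cofunD c g) (cofunD c' g') =
      Finsupp.single (cofunD (c ∘ c') (fun a => g (c' a) * g' a)) 1 := by
  rw [compDiagram_eq d (Sum.elim id (Sum.elim c (c ∘ c'))) (fun x => Sum.inl x)
    (l := Sum.elim (fun _ => 1) (Sum.elim g (fun a => g (c' a) * g' a)))]
  · congr 2
    · congr 1; funext x; rcases x with x | x <;> rfl
    · funext x; rcases x with x | x <;> rfl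
  · rintro (a | a) (b | b) h <;> exact h
  · rintro (a | a) (b | b) h <;> exact congrArg c h
  · have key : ∀ b : B, stack (cofunD c g).part (cofunD c' g').part (Sum.inr (Sum.inl b))
        (Sum.inl (c b)) := fun b =>
      stack_lower (P := (cofunD c g).part) (a := Sum.inr b) (b := Sum.inl (c b)) rfl
    rintro (a | b | x)
    · exact Setoid.refl' _ _
    · exact key b
    · exact Setoid.trans' _ (stack_upper (Q := (cofunD c' g').part) (a := Sum.inr x)
        (b := Sum.inl (c' x)) rfl) (key (c' x))
  · intro x
    exact ⟨Sum.inl (Sum.elim id (Sum.elim c (c ∘ c')) x), rfl⟩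
  · refine ⟨GDiagram.isLabel_mk.2 ⟨fun _ => 1, fun _ _ _ => rfl, ?_⟩,
      GDiagram.isLabel_mk.2 ⟨g ∘ Sum.elim id c', fun a b h => congrArg g h, ?_⟩⟩
    · rintro (a | b) <;> simp [lower]
    · rintro (a | b) <;> simp [upper]

/-- The diagram of a labelled map followed by the diagram of a labelled map backwards, jointly
surjective. -/
theorem funD_comp_cofunD (d : k) (c : A → B) (g : A → G) (c' : C → B) (g' : C → G)
    (hc : ∀ b, (∃ a, c a = b) ∨ ∃ a, c' a = b) :
    compDiagram d (funD c g) (cofunD c' g') =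
      Finsupp.single (GDiagram.mk (Setoid.ker (Sum.elim c c')) (Sum.elim g g')) 1 := by
  rw [compDiagram_eq d (Sum.elim c (Sum.elim id c')) (fun x => Sum.inr (Sum.inl x))
    (l := Sum.elim g (Sum.elim (fun _ => 1) g'))]
  · congr 2
    · congr 1; funext x; rcases x with x | x <;> rfl
    · funext x; rcases x with x | x <;> rfl
  · rintro (a | a) (b | b) h <;> exact h
  · rintro (a | a) (b | b) h <;> exact h
  · rintro (a | b | x)
    · exact stack_lower (P := (funD c g).part) (a := Sum.inl a) (b := Sum.inr (c a)) rfl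
    · exact Setoid.refl' _ _
    · exact stack_upper (Q := (cofunD c' g').part) (a := Sum.inr x) (b := Sum.inl (c' x)) rfl
  · intro x
    -- A middle vertex missed by both maps would be a component of its own inside the middle row and
    -- would contribute a factor `d`.
    rcases hc (Sum.elim c (Sum.elim id c') x) with ⟨a, ha⟩ | ⟨a, ha⟩
    · exact ⟨Sum.inl a, ha⟩
    · exact ⟨Sum.inr a, ha⟩
  · refine ⟨GDiagram.isLabel_mk.2 ⟨fun _ => 1, fun _ _ _ => rfl, ?_⟩, ?_⟩
    · rintro (a | b) <;> simp [lower]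
    · exact GDiagram.isLabel_mk_self _ _

/-- The diagram of a labelled map backwards followed by the diagram of a labelled map, the stack
being connected. -/
theorem cofunD_comp_funD (d : k) (c : B → A) (c' : B → C) (g : B → G) (x : G) (b₀ : B)
    (hb : ∀ b, c b = c b₀ ∨ c' b = c' b₀) (hc : Function.Surjective c)
    (hc' : Function.Surjective c') (hg : ∀ b, g b = x) :
    compDiagram d (cofunD c g) (funD c' fun _ => 1) =
      Finsupp.single (GDiagram.mk ⊤ (Sum.elim (fun _ => 1) fun _ => x)) 1 := by
  obtain rfl : g = fun _ => x := funext hg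
  rw [compDiagram_eq d (fun _ => ()) (fun _ => Sum.inr (Sum.inl b₀))
    (l := Sum.elim (fun _ => 1) (Sum.elim (fun _ => x) (fun _ => x)))]
  · congr 2
    · ext y z; exact iff_of_true rfl trivial
    · funext y; rcases y with y | y <;> rfl
  · exact fun _ _ _ => rfl
  · exact fun _ _ _ => rfl
  · have key : ∀ b : B, stack (cofunD c fun _ => x).part (funD c' fun _ => (1 : G)).part
        (Sum.inr (Sum.inl b)) (Sum.inr (Sum.inl b₀)) := by
      intro b
      rcases hb b with h | h
      · exact stack_lower (P := (cofunD c fun _ => x).part) (a := Sum.inr b) (b := Sum.inr b₀) h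
      · exact stack_upper (Q := (funD c' fun _ => (1 : G)).part) (a := Sum.inl b)
          (b := Sum.inl b₀) h
    rintro (a | b | e)
    · obtain ⟨b, rfl⟩ := hc a
      exact Setoid.trans' _ (stack_lower (P := (cofunD c fun _ => x).part) (a := Sum.inl (c b))
        (b := Sum.inr b) rfl) (key b)
    · exact key b
    · obtain ⟨b, rfl⟩ := hc' e
      exact Setoid.trans' _ (stack_upper (Q := (funD c' fun _ => (1 : G)).part)
        (a := Sum.inr (c' b)) (b := Sum.inl b) rfl) (key b)
  · intro _
    exact ⟨Sum.inl (c b₀), rfl⟩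
  · refine ⟨?_, GDiagram.isLabel_mk.2 ⟨fun _ => x, fun _ _ _ => rfl, ?_⟩⟩
    · refine GDiagram.isLabel_mk.2 ⟨fun _ => 1, fun _ _ _ => rfl, ?_⟩
      rintro (a | b) <;> simp [lower]
    · rintro (a | b) <;> simp [upper]

theorem idDiagram_eq_funD : idDiagram G A = funD id fun _ => 1 := by
  rw [idDiagram, funD]
  congr 1
  funext x; rcases x with x | x <;> rfl

theorem idDiagram_eq_cofunD : idDiagram G A = cofunD id fun _ => 1 := by
  rw [idDiagram, cofunD]
  congr 1
  funext x; rcases x with x | x <;> rfl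

/-- The diagram of a labelled bijection is that of the inverse bijection, read backwards. -/
theorem funD_eq_cofunD (σ : A ≃ B) (g : A → G) :
    funD σ g = cofunD σ.symm fun b => (g (σ.symm b))⁻¹ := by
  -- Every part consists of `a` and `σ a`; multiplying it by the inverse of `g a` moves the label
  -- from the bottom vertex to the top one.
  refine GDiagram.mk_eq_mk.2 ⟨?_, Sum.elim (fun a => (g a)⁻¹) (fun b => (g (σ.symm b))⁻¹), ?_, ?_⟩
  · ext x y
    rw [ker_rel, ker_rel, ← σ.symm.injective.eq_iff]
    rcases x with x | x <;> rcases y with y | y <;> simp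
  · rintro (a | a) (b | b) h
    · cases σ.injective h; rfl
    · cases (show σ a = b from h); simp
    · cases (show a = σ b from h); simp
    · cases (show a = b from h); rfl
  · rintro (a | a) <;> simp

theorem mk_top_eq_funD [Subsingleton B] (c : A → B) (g : A → G) :
    GDiagram.mk (⊤ : Setoid (A ⊕ B)) (Sum.elim g fun _ => 1) = funD c g := by
  rw [funD]
  congr 1
  ext x y
  exact iff_of_true trivial (Subsingleton.elim (Sum.elim c id x) _)

theorem mk_top_eq_cofunD [Subsingleton A] (c : B → A) (g : B → G) :
    GDiagram.mk (⊤ : Setoid (A ⊕ B)) (Sum.elim (fun _ => 1) g) = cofunD c g := by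
  rw [cofunD]
  congr 1
  ext x y
  exact iff_of_true trivial (Subsingleton.elim (Sum.elim id c x) _)

end Maps

section TensorMaps

variable {G : Type v} [Group G] {k : Type u} [CommRing k] {a b a' b' : ℕ}

/-- Tagging the values by their side keeps left and right vertices in different parts. This makes
the juxtaposition of diagrams of maps again the diagram of a map. -/
theorem juxtPart_ker {T T' : Type*} (f : Fin a ⊕ Fin b → T) (f' : Fin a' ⊕ Fin b' → T') :
    juxtPart (Setoid.ker f) (Setoid.ker f') =
      Setoid.ker (juxt (Sum.inl ∘ f : _ → T ⊕ T') (Sum.inr ∘ f')) := by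
  obtain ⟨h1, h2, h3⟩ := disjoint_rel (leftV_injective (a' := a') (b' := b'))
    (rightV_injective (a := a) (b := b)) cover_juxt leftV_ne_rightV (Setoid.ker f) (Setoid.ker f')
  ext x y
  rw [ker_rel]
  rcases cover_juxt x with ⟨x, rfl⟩ | ⟨x, rfl⟩ <;> rcases cover_juxt y with ⟨y, rfl⟩ | ⟨y, rfl⟩
  · rw [juxtPart, h1]; simp
  · rw [juxtPart]; simp [h3]
  · rw [juxtPart, Setoid.comm']; simp [h3]
  · rw [juxtPart, h2]; simp

theorem tensorDiagram_mk (P : Setoid (Fin a ⊕ Fin b)) (g : Fin a ⊕ Fin b → G)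
    (P' : Setoid (Fin a' ⊕ Fin b')) (g' : Fin a' ⊕ Fin b' → G) :
    tensorDiagram (GDiagram.mk P g) (GDiagram.mk P' g') =
      GDiagram.mk (juxtPart P P') (juxt g g') := rfl

theorem ker_comp_injective {V W T : Type*} (f : V → W) {e : W → T} (he : Function.Injective e) :
    Setoid.ker (e ∘ f) = Setoid.ker f := by
  ext x y
  exact he.eq_iff

theorem append_const {T : Type*} (x : T) :
    Fin.append (fun _ : Fin a => x) (fun _ : Fin b => x) = fun _ => x := by
  funext i
  induction i using Fin.addCases <;> simp

theorem tensor_funD (c : Fin a → Fin b) (g : Fin a → G) (c' : Fin a' → Fin b') (g' : Fin a' → G) :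
    tensorDiagram (funD c g) (funD c' g') =
      funD (Fin.append (Fin.castAdd b' ∘ c) (Fin.natAdd b ∘ c')) (Fin.append g g') := by
  rw [funD, funD, tensorDiagram_mk, funD, juxtPart_ker,
    ← ker_comp_injective _ (finSumFinEquiv (m := b) (n := b')).injective]
  congr 1
  · congr 1
    funext x
    rcases cover_juxt x with ⟨x | x, rfl⟩ | ⟨x | x, rfl⟩ <;> simp <;> simp [leftV, rightV]
  · funext x
    rcases cover_juxt x with ⟨x | x, rfl⟩ | ⟨x | x, rfl⟩ <;> simp <;> simp [leftV, rightV]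

theorem tensor_cofunD (c : Fin b → Fin a) (g : Fin b → G) (c' : Fin b' → Fin a')
    (g' : Fin b' → G) :
    tensorDiagram (cofunD c g) (cofunD c' g') =
      cofunD (Fin.append (Fin.castAdd a' ∘ c) (Fin.natAdd a ∘ c')) (Fin.append g g') := by
  rw [cofunD, cofunD, tensorDiagram_mk, cofunD, juxtPart_ker,
    ← ker_comp_injective _ (finSumFinEquiv (m := a) (n := a')).injective]
  congr 1
  · congr 1
    funext x
    rcases cover_juxt x with ⟨x | x, rfl⟩ | ⟨x | x, rfl⟩ <;> simp <;> simp [leftV, rightV]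
  · funext x
    rcases cover_juxt x with ⟨x | x, rfl⟩ | ⟨x | x, rfl⟩ <;> simp <;> simp [leftV, rightV]

end TensorMaps

end GroupPartition

namespace GroupPartition

universe u v w

open LinPRO

/-! ### The generators in the category of diagrams -/

section DiagramModel

variable (k : Type u) [CommRing k] (G : Type v) [Group G] (d : k)

/-- The generators as diagrams. -/
noncomputable def diagramGens : Gens (parPRO k G d) G where
  merge := onePart k fun _ => (1 : G)
  split := onePart k fun _ => (1 : G)
  cross := crossDiagram k G
  bpin := onePart k fun _ => (1 : G)
  tpin := onePart k fun _ => (1 : G)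
  token g := onePart k (Sum.elim (fun _ => g) fun _ => 1)

variable {k G} {a b c a' b' : ℕ}

/-- The diagram of a labelled map, as a morphism. -/
noncomputable def mapHom (f : Fin a → Fin b) (g : Fin a → G) : (parPRO k G d).Hom a b :=
  Finsupp.single (funD f g) 1

/-- The diagram of a labelled map read backwards, as a morphism. -/
noncomputable def comapHom (f : Fin b → Fin a) (g : Fin b → G) : (parPRO k G d).Hom a b :=
  Finsupp.single (cofunD f g) 1

variable {d}

theorem single_cmp (X : Diagram G a b) (Y : Diagram G b c) :
    LinPRO.cmp (P := parPRO k G d) (Finsupp.single X 1 : Diagram G a b →₀ k)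
      (Finsupp.single Y 1 : Diagram G b c →₀ k) = (compDiagram d X Y : Diagram G a c →₀ k) := by
  refine (compLin_single d X Y 1 1).trans ?_
  rw [mul_one, one_smul]

theorem mapHom_cmp (f : Fin a → Fin b) (g : Fin a → G) (f' : Fin b → Fin c) (g' : Fin b → G) :
    (mapHom d f g : (parPRO k G d).Hom a b) ⊚ mapHom d f' g' =
      mapHom d (f' ∘ f) fun i => g' (f i) * g i :=
  (single_cmp _ _).trans (funD_comp d f g f' g')

theorem comapHom_cmp (f : Fin b → Fin a) (g : Fin b → G) (f' : Fin c → Fin b) (g' : Fin c → G) :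
    (comapHom d f g : (parPRO k G d).Hom a b) ⊚ comapHom d f' g' =
      comapHom d (f ∘ f') fun i => g (f' i) * g' i :=
  (single_cmp _ _).trans (cofunD_comp d f g f' g')

theorem mapHom_tensor (f : Fin a → Fin b) (g : Fin a → G) (f' : Fin a' → Fin b')
    (g' : Fin a' → G) :
    (parPRO k G d).tensor (mapHom d f g) (mapHom d f' g') =
      mapHom d (Fin.append (Fin.castAdd b' ∘ f) (Fin.natAdd b ∘ f')) (Fin.append g g') := by
  refine (tensorLin_single _ _ 1 1).trans ?_
  rw [tensor_funD, mul_one]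
  rfl

theorem comapHom_tensor (f : Fin b → Fin a) (g : Fin b → G) (f' : Fin b' → Fin a')
    (g' : Fin b' → G) :
    (parPRO k G d).tensor (comapHom d f g) (comapHom d f' g') =
      comapHom d (Fin.append (Fin.castAdd a' ∘ f) (Fin.natAdd a ∘ f')) (Fin.append g g') := by
  refine (tensorLin_single _ _ 1 1).trans ?_
  rw [tensor_cofunD, mul_one]
  rfl

theorem id_eq_mapHom (a : ℕ) : (parPRO k G d).id a = mapHom d id fun _ => 1 :=
  congrArg (fun X => Finsupp.single X (1 : k)) idDiagram_eq_funD

theorem id_eq_comapHom (a : ℕ) : (parPRO k G d).id a = comapHom d id fun _ => 1 :=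
  congrArg (fun X => Finsupp.single X (1 : k)) idDiagram_eq_cofunD

theorem onePart_eq_mapHom {b : ℕ} [Subsingleton (Fin b)] (f : Fin a → Fin b) (g : Fin a → G) :
    onePart k (Sum.elim g fun _ => 1) = mapHom d f g :=
  congrArg (fun X => Finsupp.single X (1 : k)) (mk_top_eq_funD f g)

theorem onePart_eq_comapHom {a : ℕ} [Subsingleton (Fin a)] (f : Fin b → Fin a) (g : Fin b → G) :
    onePart k (Sum.elim (fun _ => 1) g) = comapHom d f g :=
  congrArg (fun X => Finsupp.single X (1 : k)) (mk_top_eq_cofunD f g)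

theorem mapHom_congr {f f' : Fin a → Fin b} {g g' : Fin a → G} (hf : ∀ i, f i = f' i)
    (hg : ∀ i, g i = g' i) : mapHom (k := k) d f g = mapHom d f' g' := by
  rw [funext hf, funext hg]

theorem comapHom_congr {f f' : Fin b → Fin a} {g g' : Fin b → G} (hf : ∀ i, f i = f' i)
    (hg : ∀ i, g i = g' i) : comapHom (k := k) d f g = comapHom d f' g' := by
  rw [funext hf, funext hg]

theorem const_eq_elim {S T U : Type*} (x : U) :
    (fun _ : S ⊕ T => x) = Sum.elim (fun _ => x) fun _ => x := by
  funext y; rcases y with y | y <;> rfl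

theorem merge_eq : (diagramGens k G d).merge = mapHom d (fun _ => 0) fun _ => 1 :=
  (congrArg (onePart k) (const_eq_elim _)).trans (onePart_eq_mapHom _ _)

theorem bpin_eq : (diagramGens k G d).bpin = mapHom d Fin.elim0 fun _ => 1 :=
  (congrArg (onePart k) (const_eq_elim _)).trans (onePart_eq_mapHom _ _)

theorem split_eq : (diagramGens k G d).split = comapHom d (fun _ => 0) fun _ => 1 :=
  (congrArg (onePart k) (const_eq_elim _)).trans (onePart_eq_comapHom _ _)

theorem tpin_eq : (diagramGens k G d).tpin = comapHom d Fin.elim0 fun _ => 1 :=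
  (congrArg (onePart k) (const_eq_elim _)).trans (onePart_eq_comapHom _ _)

theorem token_eq (g : G) : (diagramGens k G d).token g = mapHom d id fun _ => g :=
  onePart_eq_mapHom _ _

theorem mapHom_equiv (σ : Fin a ≃ Fin b) (g : Fin a → G) :
    (mapHom d σ g : (parPRO k G d).Hom a b) = comapHom d σ.symm fun b => (g (σ.symm b))⁻¹ :=
  congrArg (fun X => Finsupp.single X (1 : k)) (funD_eq_cofunD σ g)

/-- Tokens occur together with splits as well as with merges, so they are also needed as backward
maps; moving the label to the top vertex inverts it. -/
theorem token_eq' (g : G) : (diagramGens k G d).token g = comapHom d id fun _ => g⁻¹ :=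
  (token_eq g).trans (mapHom_equiv (Equiv.refl _) _)

theorem cross_eq' : (diagramGens k G d).cross = comapHom d Fin.rev fun _ => 1 :=
  congrArg (fun g => Finsupp.single (GDiagram.mk _ g) (1 : k)) (const_eq_elim (1 : G))

theorem cross_eq : (diagramGens k G d).cross = mapHom d Fin.rev fun _ => 1 := by
  rw [cross_eq', show (Fin.rev : Fin 2 → Fin 2) = Fin.revPerm from rfl, mapHom_equiv]
  simp

theorem mapHom_comp (f : Fin a → Fin b) (g : Fin a → G) (f' : Fin b → Fin c) (g' : Fin b → G) :
    (parPRO k G d).comp (mapHom d f g) (mapHom d f' g') =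
      mapHom d (f' ∘ f) fun i => g' (f i) * g i := mapHom_cmp f g f' g'

theorem comapHom_comp (f : Fin b → Fin a) (g : Fin b → G) (f' : Fin c → Fin b) (g' : Fin c → G) :
    (parPRO k G d).comp (comapHom d f g) (comapHom d f' g') =
      comapHom d (f ∘ f') fun i => g (f' i) * g' i := comapHom_cmp f g f' g'

theorem comapHom_comp_mapHom (f : Fin b → Fin a) (f' : Fin b → Fin c) (g : Fin b → G) (x : G)
    (i : Fin b) (hi : ∀ j, f j = f i ∨ f' j = f' i) (hf : Function.Surjective f)
    (hf' : Function.Surjective f') (hg : ∀ j, g j = x) :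
    (parPRO k G d).comp (comapHom d f g) (mapHom d f' fun _ => 1) =
      (Finsupp.single (GDiagram.mk ⊤ (Sum.elim (fun _ => 1) fun _ => x)) 1 :
        Diagram G a c →₀ k) :=
  (single_cmp _ _).trans (cofunD_comp_funD d f f' g x i hi hf hf' hg)

theorem mapHom_cmp_comapHom (f : Fin a → Fin b) (g : Fin a → G) (f' : Fin c → Fin b)
    (g' : Fin c → G) (hf : ∀ i, (∃ j, f j = i) ∨ ∃ j, f' j = i) :
    LinPRO.cmp (P := parPRO k G d) (mapHom d f g) (comapHom d f' g') =
      (Finsupp.single (GDiagram.mk (Setoid.ker (Sum.elim f f')) (Sum.elim g g')) 1 :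
        Diagram G a c →₀ k) :=
  (single_cmp _ _).trans (funD_comp_cofunD d f g f' g' hf)

theorem merge_split : (parPRO k G d).comp (diagramGens k G d).merge (diagramGens k G d).split =
    (Finsupp.single (GDiagram.mk ⊤ (Sum.elim (fun _ => 1) fun _ => 1)) 1 :
        Diagram G 2 2 →₀ k) := by
  rw [merge_eq, split_eq]
  refine (mapHom_cmp_comapHom _ _ _ _ (by decide)).trans ?_
  congr 2
  ext x y
  exact iff_of_true (Subsingleton.elim (α := Fin 1) _ _) trivial

/-- Relations in merges, bottom pins and crossings are identities between maps of finite sets, those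
in splits, top pins and crossings are such identities read backwards, and tokens only add labels.
The Frobenius and bubble relations mix both directions and are computed from the connected stack of
a backward and a forward map. -/
theorem diagram_rel {a b : ℕ} {f f' : Term k G a b} (h : GenRel k G f f') :
    (diagramGens k G d).eval f = (diagramGens k G d).eval f' := by
  cases h
  case unit | cross_cross | braid | bpin_cross | cross_merge | comm =>
    simp only [Gens.eval, merge_eq, bpin_eq, cross_eq, id_eq_mapHom, mapHom_tensor, mapHom_comp]
    refine mapHom_congr ?_ ?_
    · decide
    · simp only [append_const, mul_one, implies_true]
  case counit_left | counit_right | cross_tpin | split_cross =>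
    simp only [Gens.eval, split_eq, tpin_eq, cross_eq', id_eq_comapHom, comapHom_tensor,
      comapHom_comp]
    refine comapHom_congr ?_ ?_
    · decide
    · simp only [append_const, mul_one, implies_true]
  case token_mul g h =>
    simp only [Gens.eval, token_eq, mapHom_comp]
    rfl
  case token_one =>
    simp only [Gens.eval, token_eq, id_eq_mapHom]
  case token_cross g =>
    simp only [Gens.eval, token_eq, cross_eq, id_eq_mapHom, mapHom_tensor, mapHom_comp]
    refine mapHom_congr ?_ ?_
    · decide
    · intro i
      fin_cases i <;> simp <;> rfl
  case bpin_token g =>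
    simp only [Gens.eval, token_eq, bpin_eq, mapHom_comp]
    exact mapHom_congr (fun i => i.elim0) (fun i => i.elim0)
  case token_split g =>
    simp only [Gens.eval, token_eq', split_eq, comapHom_tensor, comapHom_comp]
    refine comapHom_congr ?_ ?_
    · decide
    · simp only [append_const, mul_one, one_mul, implies_true]
  case frobenius_left =>
    rw [Gens.eval, Gens.eval, Gens.eval, Gens.eval, Gens.eval, Gens.eval, Gens.eval, Gens.eval,
      merge_split, split_eq, id_eq_comapHom, comapHom_tensor, ← id_eq_comapHom, id_eq_mapHom,
      merge_eq, mapHom_tensor]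
    simp only [append_const]
    -- The first `1` is the common label in `G`, the second is the central one of the three
    -- intermediate vertices: each of the other two shares a part with it in one of the two
    -- diagrams. Both sides of the relation are the diagram with a single part.
    rw [comapHom_comp_mapHom _ _ _ 1 1 (by decide) (by decide) (by decide) fun _ => rfl]
  case frobenius_right =>
    rw [Gens.eval, Gens.eval, Gens.eval, Gens.eval, Gens.eval, Gens.eval, Gens.eval, Gens.eval,
      merge_split, split_eq, id_eq_comapHom, comapHom_tensor, ← id_eq_comapHom, id_eq_mapHom,
      merge_eq, mapHom_tensor]
    simp only [append_const]
    rw [comapHom_comp_mapHom _ _ _ 1 1 (by decide) (by decide) (by decide) fun _ => rfl]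
  case bubble_eq g =>
    simp only [Gens.eval, token_eq', split_eq, comapHom_tensor, comapHom_comp, append_const,
      one_mul, merge_eq]
    -- Equal tokens give both vertices of the bubble the same label, the inverse of `g`, and the
    -- result is the token read backwards.
    rw [comapHom_comp_mapHom _ _ _ g⁻¹ 0 (by decide) (by decide) (by decide) fun _ => rfl]
    exact congrArg (fun X => Finsupp.single X (1 : k)) (mk_top_eq_cofunD _ _)
  case bubble_ne g h hgh =>
    simp only [Gens.eval, token_eq', split_eq, comapHom_tensor, comapHom_comp,
      one_mul, merge_eq]
    refine (single_cmp _ _).trans (compDiagram_of_not_glued d ?_)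
    -- A common labelling `l` takes equal values at the two middle vertices because of the merge,
    -- while the split with its tokens makes these values `s * g⁻¹` and `s * h⁻¹` for one `s`; this
    -- forces `g = h`.
    rintro ⟨l, h1, h2⟩
    obtain ⟨s, hs, es⟩ := GDiagram.isLabel_mk.1 h1
    obtain ⟨t, ht, et⟩ := GDiagram.isLabel_mk.1 h2
    have e0 : l (Sum.inr (Sum.inl (0 : Fin 2))) = s (Sum.inr (0 : Fin 2)) * g⁻¹ :=
      es (Sum.inr (0 : Fin 2))
    have e1 : l (Sum.inr (Sum.inl (1 : Fin 2))) = s (Sum.inr (1 : Fin 2)) * h⁻¹ :=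
      es (Sum.inr (1 : Fin 2))
    have e2 : l (Sum.inr (Sum.inl (0 : Fin 2))) = t (Sum.inl (0 : Fin 2)) * 1 :=
      et (Sum.inl (0 : Fin 2))
    have e3 : l (Sum.inr (Sum.inl (1 : Fin 2))) = t (Sum.inl (1 : Fin 2)) * 1 :=
      et (Sum.inl (1 : Fin 2))
    rw [← ht (Sum.inl (0 : Fin 2)) (Sum.inl (1 : Fin 2)) rfl, ← e2, e0,
      hs (Sum.inr (0 : Fin 2)) (Sum.inr (1 : Fin 2)) rfl] at e3
    exact hgh (inv_injective (mul_left_cancel (e3.symm.trans e1)))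

theorem diagramGens_isModel : (diagramGens k G d).IsModel d where
  rel := diagram_rel
  lolly := by
    rw [bpin_eq, tpin_eq]
    refine (single_cmp _ _).trans ?_
    have hl : Glued (funD (Fin.elim0 : Fin 0 → Fin 1) fun _ => (1 : G))
        (cofunD (Fin.elim0 : Fin 0 → Fin 1) fun _ => (1 : G)) fun _ => 1 := by
      constructor
      · exact congrArg (GDiagram.mk _) (const_eq_elim _).symm
      · exact congrArg (GDiagram.mk _) (const_eq_elim _).symm
    rw [compDiagram_of_glued d hl]
    -- The stack has a single vertex and empty outer rows, so its one component counts and gives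
    -- exactly one factor `d`.
    have ha : alpha (funD (Fin.elim0 : Fin 0 → Fin 1) fun _ => (1 : G)).part
        (cofunD (Fin.elim0 : Fin 0 → Fin 1) fun _ => (1 : G)).part = 1 := by
      rw [alpha, Nat.card_eq_one_iff_unique]
      refine ⟨⟨?_⟩, ⟨⟨Quotient.mk _ (Sum.inr (Sum.inl 0)), ?_⟩⟩⟩
      · rintro ⟨x, hx⟩ ⟨y, hy⟩
        apply Subtype.ext
        induction x using Quotient.inductionOn with | h x => ?_
        induction y using Quotient.inductionOn with | h y => ?_
        rcases x with x | x | x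
        · exact x.elim0
        · rcases y with y | y | y
          · exact y.elim0
          · obtain rfl := Subsingleton.elim x y
            rfl
          · exact y.elim0
        · exact x.elim0
      · rintro (x | x) <;> exact x.elim0
    rw [ha, pow_one, Subsingleton.elim (GDiagram.mk _ _) (idDiagram G (Fin 0))]
    refine Eq.trans ?_ (Finsupp.smul_single d (idDiagram G (Fin 0)) (1 : k)).symm
    rw [smul_eq_mul, mul_one]

end DiagramModel

end GroupPartition

namespace GroupPartition

universe u v w

open LinPRO Gens

/-! ### The images of the closed diagrams -/

section DiagramModel

variable {k : Type u} [CommRing k] {G : Type v} [Group G] {d : k} {a b : ℕ}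

theorem pad_mapHom (m : ℕ) (f : Fin a → Fin b) (g : Fin a → G) :
    pad m (mapHom d f g : (parPRO k G d).Hom a b) =
      mapHom d (Fin.append (Fin.castAdd b) (Fin.natAdd m ∘ f)) (Fin.append (fun _ => 1) g) := by
  rw [pad, id_eq_mapHom, mapHom_tensor]
  rfl

theorem pad_comapHom (m : ℕ) (f : Fin b → Fin a) (g : Fin b → G) :
    pad m (comapHom d f g : (parPRO k G d).Hom a b) =
      comapHom d (Fin.append (Fin.castAdd a) (Fin.natAdd m ∘ f)) (Fin.append (fun _ => 1) g) := by
  rw [pad, id_eq_comapHom, comapHom_tensor]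
  rfl

theorem append_eq_snoc {T : Type*} {m : ℕ} (f : Fin m → T) (g : Fin 1 → T) :
    Fin.append f g = (Fin.snoc f (g 0) : Fin (m + 1) → T) := by
  funext i
  induction i using Fin.lastCases with
  | last => rw [Fin.snoc_last]; exact Fin.append_right f g 0
  | cast i => rw [Fin.snoc_castSucc]; exact Fin.append_left f g i

theorem append_eq_snoc_snoc {T : Type*} {m : ℕ} (f : Fin m → T) (g : Fin 2 → T) :
    Fin.append f g =
      (Fin.snoc (Fin.snoc f (g 0) : Fin (m + 1) → T) (g 1) : Fin (m + 2) → T) := by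
  funext i
  induction i using Fin.lastCases with
  | last => rw [Fin.snoc_last]; exact Fin.append_right f g 1
  | cast i =>
    rw [Fin.snoc_castSucc]
    induction i using Fin.lastCases with
    | last => rw [Fin.snoc_last]; exact Fin.append_right f g 0
    | cast i => rw [Fin.snoc_castSucc]; exact Fin.append_left f g i

theorem append_elim0 {T : Type*} {m : ℕ} (f : Fin m → T) (g : Fin 0 → T) :
    Fin.append f g = f := by
  funext i
  exact Fin.append_left f g i

theorem snoc_const {T : Type*} {m : ℕ} (x : T) :
    (Fin.snoc (fun _ : Fin m => x) x : Fin (m + 1) → T) = fun _ => x := by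
  funext i
  induction i using Fin.lastCases <;> simp

theorem widen_mapHom (f : Fin a → Fin b) (g : Fin a → G) :
    widen (mapHom d f g : (parPRO k G d).Hom a b) =
      mapHom d (Fin.snoc (Fin.castSucc ∘ f) (Fin.last b) : Fin (a + 1) → Fin (b + 1))
        (Fin.snoc g 1 : Fin (a + 1) → G) := by
  rw [widen, id_eq_mapHom, mapHom_tensor, append_eq_snoc, append_eq_snoc]
  rfl

theorem diagram_eta (m : ℕ) : (diagramGens k G d).eta m = mapHom d Fin.castSucc fun _ => 1 := by
  rw [eta, bpin_eq, pad_mapHom, append_elim0, append_elim0]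
  rfl

theorem diagram_eps (m : ℕ) : (diagramGens k G d).eps m = comapHom d Fin.castSucc fun _ => 1 := by
  rw [eps, tpin_eq, pad_comapHom, append_elim0, append_elim0]
  rfl

theorem diagram_tok (m : ℕ) (g : G) : (diagramGens k G d).tok m g =
    mapHom d id (Fin.snoc (fun _ => 1) g : Fin (m + 1) → G) := by
  rw [tok, token_eq, pad_mapHom, append_eq_snoc, append_eq_snoc]
  refine mapHom_congr (fun i => ?_) fun _ => rfl
  induction i using Fin.lastCases with
  | last => rw [Fin.snoc_last]; rfl
  | cast i => rw [Fin.snoc_castSucc]; rfl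

theorem diagram_mu (m : ℕ) : (diagramGens k G d).mu m = mapHom d collapse fun _ => 1 := by
  rw [mu, merge_eq, pad_mapHom, append_eq_snoc_snoc, append_const]
  refine mapHom_congr (fun i => ?_) fun _ => rfl
  induction i using Fin.lastCases with
  | last => rw [Fin.snoc_last, collapse_last]; rfl
  | cast i =>
    rw [Fin.snoc_castSucc, collapse_castSucc]
    induction i using Fin.lastCases with
    | last => rw [Fin.snoc_last]; rfl
    | cast i => rw [Fin.snoc_castSucc]; rfl

theorem diagram_cr (m : ℕ) : (diagramGens k G d).cr m =
    mapHom d (Fin.snoc (Fin.snoc (Fin.castSucc ∘ Fin.castSucc) (Fin.last (m + 1)) :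
      Fin (m + 1) → Fin (m + 2)) (Fin.last m).castSucc : Fin (m + 2) → Fin (m + 2))
      fun _ => 1 := by
  rw [cr, cross_eq, pad_mapHom, append_eq_snoc_snoc, append_const]
  rfl

theorem diagram_join {m : ℕ} (i : Fin m) : (diagramGens k G d).join i =
    mapHom d (Fin.snoc id i : Fin (m + 1) → Fin m) fun _ => 1 := by
  induction m with
  | zero => exact i.elim0
  | succ m ih =>
    induction i using Fin.lastCases with
    | last =>
      rw [join_last, diagram_mu]
      refine mapHom_congr (fun i => ?_) fun _ => rfl
      induction i using Fin.lastCases <;> simp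
    | cast i =>
      rw [join_castSucc, ih, widen_mapHom, diagram_cr, mapHom_cmp, snoc_const]
      refine mapHom_congr (fun j => ?_) fun _ => mul_one _
      induction j using Fin.lastCases with
      | last => simp
      | cast j =>
        induction j using Fin.lastCases <;> simp

theorem diagram_bpins (m : ℕ) : (diagramGens k G d).bpins m = mapHom d Fin.elim0 fun _ => 1 := by
  induction m with
  | zero =>
    rw [bpins, id_eq_mapHom]
    exact mapHom_congr (fun i => i.elim0) fun i => i.elim0
  | succ m ih =>
    rw [bpins, ih, diagram_eta, mapHom_cmp]
    exact mapHom_congr (fun i => i.elim0) fun i => i.elim0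

theorem diagram_pins (m : ℕ) : (diagramGens k G d).pins m = comapHom d Fin.elim0 fun _ => 1 := by
  induction m with
  | zero =>
    rw [pins, id_eq_comapHom]
    exact comapHom_congr (fun i => i.elim0) fun i => i.elim0
  | succ m ih =>
    rw [pins, ih, diagram_eps, comapHom_cmp]
    exact comapHom_congr (fun i => i.elim0) fun i => i.elim0

/-- Tokens and joins are themselves diagrams of labelled maps, and adding a strand preserves this
form, so the claim is a composition of maps, one vertex at a time. -/
theorem diagram_arr {n m : ℕ} (c : Fin n → Fin m) (g : Fin n → G) :
    (diagramGens k G d).arr c g = mapHom d c g := by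
  induction n with
  | zero =>
    refine (diagram_bpins m).trans ?_
    exact mapHom_congr (fun i => i.elim0) fun i => i.elim0
  | succ n ih =>
    obtain ⟨c, i, rfl⟩ := exists_snoc c
    obtain ⟨g, x, rfl⟩ := exists_snoc g
    rw [arr_snoc, ih, widen_mapHom, diagram_tok, diagram_join, mapHom_cmp, mapHom_cmp]
    refine mapHom_congr (fun j => ?_) (fun j => ?_) <;> induction j using Fin.lastCases <;> simp

/-- The diagram of a labelled partition with the given blocks, without top vertices. -/
def closedDiagram {n m : ℕ} (c : Fin n → Fin m) (g : Fin n → G) : Diagram G n 0 :=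
  GDiagram.mk (Setoid.ker (Sum.elim c Fin.elim0)) (Sum.elim g Fin.elim0)

/-- Surjectivity ensures that closing the blocks creates no component inside the middle row, so the
coefficient is 1 and not a power of `d`. -/
theorem diagram_psi {n m : ℕ} (c : Fin n → Fin m) (g : Fin n → G) (hc : Function.Surjective c) :
    (diagramGens k G d).psi c g = (Finsupp.single (closedDiagram c g) 1 : Diagram G n 0 →₀ k) := by
  rw [psi, diagram_arr, diagram_pins]
  refine (mapHom_cmp_comapHom _ _ _ _ fun i => Or.inl (hc i)).trans ?_
  congr 2
  congr 1
  funext i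
  exact i.elim0

/-- Without top vertices a partition is the kernel of a surjection onto its set of parts; it only
remains to number the parts. -/
theorem exists_closedDiagram {n : ℕ} (X : Diagram G n 0) :
    ∃ (m : ℕ) (c : Fin n → Fin m) (g : Fin n → G),
      Function.Surjective c ∧ X = closedDiagram c g := by
  classical
  obtain ⟨l, hl⟩ := X.exists_label
  have : Finite (Quotient (X.part.comap (Sum.inl : Fin n → _))) := Quotient.finite _
  obtain ⟨m, ⟨e⟩⟩ := Finite.exists_equiv_fin (Quotient (X.part.comap (Sum.inl : Fin n → _)))
  refine ⟨m, fun i => e (Quotient.mk _ i), l ∘ Sum.inl, ?_, ?_⟩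
  · exact e.surjective.comp Quotient.mk_surjective
  · refine GDiagram.ext_label (g := l) ?_ hl ?_
    · ext x y
      rcases x with x | x
      · rcases y with y | y
        · exact (Quotient.eq (r := X.part.comap (Sum.inl : Fin n → _))).symm.trans
            e.injective.eq_iff.symm
        · exact y.elim0
      · exact x.elim0
    · have : l = Sum.elim (l ∘ Sum.inl) Fin.elim0 := by
        funext x
        rcases x with x | x
        · rfl
        · exact x.elim0
      conv_rhs => rw [this]
      exact GDiagram.isLabel_mk_self _ _

end DiagramModel

/-! ### The diagram determines the morphism in every model -/

section Model

variable {k : Type u} [CommRing k] {P : LinPRO.{u, w} k} {G : Type v} [Group G] {E : Gens P G}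
  {d : k}

/-- Labelled partitions with the same diagram give the same morphism. -/
theorem Gens.IsModel.psi_eq_of_closedDiagram_eq (h : E.IsModel d) {n m m' : ℕ} {c : Fin n → Fin m}
    {c' : Fin n → Fin m'} {g g' : Fin n → G} (hc : Function.Surjective c)
    (hc' : Function.Surjective c') (e : closedDiagram c g = closedDiagram c' g') :
    E.psi c g = E.psi c' g' := by
  obtain ⟨hp, t, ht, et⟩ := GDiagram.mk_eq_mk.1 e
  have hcc : ∀ i j, c i = c j ↔ c' i = c' j := fun i j => by
    have := congrArg (fun S : Setoid (Fin n ⊕ Fin 0) => S (Sum.inl i) (Sum.inl j)) hp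
    exact iff_of_eq this
  have hsc : ∀ i, c' (Function.surjInv hc (c i)) = c' i := fun i =>
    (hcc _ _).1 (Function.surjInv_eq hc (c i))
  -- `c` and `c'` have the same fibres, so sending the block of a vertex under `c` to its block
  -- under `c'` is a bijection of blocks.
  let σ : Fin m ≃ Fin m' := Equiv.ofBijective (fun b => c' (Function.surjInv hc b)) ⟨fun b b' hb => by
      have := (hcc _ _).2 hb
      rwa [Function.surjInv_eq hc, Function.surjInv_eq hc] at this, fun b' => by
      obtain ⟨i, rfl⟩ := hc' b'
      exact ⟨c i, hsc i⟩⟩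
  obtain rfl : m = m' := Fin.equiv_iff_eq.1 ⟨σ⟩
  have hσ : c' = σ ∘ c := funext fun i => (hsc i).symm
  -- The factor `t` relating the two labellings is constant on parts, so it becomes a function of
  -- the block by evaluation at a chosen vertex of the block.
  rw [hσ, h.psi_perm, ← h.psi_token c g fun b => t (Sum.inl (Function.surjInv hc b))]
  congr 1
  funext i
  refine ((et (Sum.inl i)).trans ?_).symm
  rw [ht (Sum.inl i) (Sum.inl (Function.surjInv hc (c i)))]
  · rfl
  · exact (Function.surjInv_eq hc (c i)).symm

end Model

end GroupPartition

namespace GroupPartition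

universe u v w w'

open LinPRO

/-! ### Evaluation respects the relations -/

section Eval

variable {k : Type u} [CommRing k] {P : LinPRO.{u, w} k} {G : Type v}

theorem Gens.eval_castHom (E : Gens P G) {a b a' b' : ℕ} (ha : a = a') (hb : b = b')
    (f : Term k G a b) : E.eval (castHom ha hb f) = castHom ha hb (E.eval f) := by
  subst ha hb; rfl

variable [Group G] {E : Gens P G} {d : k}

theorem Gens.IsModel.eval_eq (h : E.IsModel d) {a b : ℕ} {f g : Term k G a b} (hr : Rel k G f g) :
    E.eval f = E.eval g := by
  induction hr with
  | gen hg => exact h.rel hg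
  | refl f => rfl
  | symm _ h => exact h.symm
  | trans _ _ h h' => exact h.trans h'
  | congr_comp _ _ h h' => simp only [Gens.eval, h, h']
  | congr_tensor _ _ h h' => simp only [Gens.eval, h, h']
  | congr_add _ _ h h' => simp only [Gens.eval, h, h']
  | congr_smul r _ h => simp only [Gens.eval, h]
  | add_assoc f g h => exact add_assoc _ _ _
  | add_comm f g => exact add_comm _ _
  | zero_add f => exact zero_add _
  | one_smul f => exact one_smul _ _
  | zero_smul f => exact zero_smul _ _
  | mul_smul r s f => exact mul_smul _ _ _
  | smul_add r f g => exact smul_add _ _ _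
  | add_smul r s f => exact add_smul _ _ _
  | add_comp f f' g => exact add_cmp _ _ _
  | comp_add f g g' => exact cmp_add _ _ _
  | smul_comp r f g => exact smul_cmp _ _ _
  | comp_smul r f g => exact cmp_smul _ _ _
  | add_tensor f f' g => exact LinearMap.map_add₂ P.tensor _ _ _
  | tensor_add f g g' => exact map_add _ _ _
  | smul_tensor r f g => exact LinearMap.map_smul₂ P.tensor _ _ _
  | tensor_smul r f g => exact map_smul _ _ _
  | id_comp f => exact P.id_comp _
  | comp_id f => exact P.comp_id _
  | comp_assoc f g h => exact P.assoc _ _ _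
  | tensor_id a b => exact P.tensor_id a b
  | interchange f g f' g' => exact P.interchange _ _ _ _
  | tensor_assoc f g h => exact (E.eval_castHom _ _ _).trans (P.tensor_assoc _ _ _)
  | unit_tensor f => exact (E.eval_castHom _ _ _).trans (P.unit_tensor _)
  | tensor_unit f => exact (E.eval_castHom _ _ _).trans (P.tensor_unit _)

end Eval

/-! ### Maps between families of generators -/

/-- A linear strict monoidal functor, the identity on objects, that maps generators to
generators. -/
structure GensHom {k : Type u} [CommRing k] {P : LinPRO.{u, w} k} {Q : LinPRO.{u, w'} k}
    {G : Type v} (E : Gens P G) (E' : Gens Q G) where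
  map : ∀ {a b : ℕ}, P.Hom a b →ₗ[k] Q.Hom a b
  map_id : ∀ a, map (P.id a) = Q.id a
  map_cmp : ∀ {a b c} (f : P.Hom a b) (g : P.Hom b c), map (f ⊚ g) = map f ⊚ map g
  map_tensor : ∀ {a b a' b'} (f : P.Hom a b) (g : P.Hom a' b'),
    map (P.tensor f g) = Q.tensor (map f) (map g)
  map_merge : map E.merge = E'.merge
  map_split : map E.split = E'.split
  map_cross : map E.cross = E'.cross
  map_bpin : map E.bpin = E'.bpin
  map_tpin : map E.tpin = E'.tpin
  map_token : ∀ g, map (E.token g) = E'.token g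

namespace GensHom

variable {k : Type u} [CommRing k] {P : LinPRO.{u, w} k} {Q : LinPRO.{u, w'} k} {G : Type v}
  {E : Gens P G} {E' : Gens Q G} (F : GensHom E E')

theorem map_widen {a b : ℕ} (f : P.Hom a b) : F.map (widen f) = widen (F.map f) := by
  rw [widen, F.map_tensor, F.map_id]; rfl

theorem map_pad (m : ℕ) {a b : ℕ} (f : P.Hom a b) : F.map (pad m f) = pad m (F.map f) := by
  rw [pad, F.map_tensor, F.map_id]; rfl

theorem map_mu (m : ℕ) : F.map (E.mu m) = E'.mu m := by
  rw [Gens.mu, F.map_pad, F.map_merge]; rfl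

theorem map_del (m : ℕ) : F.map (E.del m) = E'.del m := by
  rw [Gens.del, F.map_pad, F.map_split]; rfl

theorem map_cr (m : ℕ) : F.map (E.cr m) = E'.cr m := by
  rw [Gens.cr, F.map_pad, F.map_cross]; rfl

theorem map_eta (m : ℕ) : F.map (E.eta m) = E'.eta m :=
  (F.map_pad m E.bpin).trans (congrArg (pad m) F.map_bpin)

theorem map_eps (m : ℕ) : F.map (E.eps m) = E'.eps m :=
  (F.map_pad m E.tpin).trans (congrArg (pad m) F.map_tpin)

theorem map_tok (m : ℕ) (g : G) : F.map (E.tok m g) = E'.tok m g := by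
  rw [Gens.tok, F.map_pad, F.map_token]; rfl

theorem map_join {m : ℕ} (i : Fin m) : F.map (E.join i) = E'.join i := by
  induction m with
  | zero => exact i.elim0
  | succ m ih =>
    induction i using Fin.lastCases with
    | last => rw [Gens.join_last, Gens.join_last, F.map_mu]
    | cast i =>
      rw [Gens.join_castSucc, Gens.join_castSucc, F.map_cmp, F.map_cr, F.map_widen, ih]

theorem map_pins (m : ℕ) : F.map (E.pins m) = E'.pins m := by
  induction m with
  | zero => exact F.map_id 0
  | succ m ih => rw [Gens.pins, F.map_cmp, F.map_eps, ih]; rfl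

theorem map_bpins (m : ℕ) : F.map (E.bpins m) = E'.bpins m := by
  induction m with
  | zero => exact F.map_id 0
  | succ m ih => rw [Gens.bpins, F.map_cmp, F.map_eta, ih]; rfl

theorem map_arr {n m : ℕ} (c : Fin n → Fin m) (g : Fin n → G) :
    F.map (E.arr c g) = E'.arr c g := by
  induction n with
  | zero => exact F.map_bpins m
  | succ n ih =>
    rw [Gens.arr, F.map_cmp, F.map_cmp, F.map_widen, ih, F.map_tok, F.map_join]; rfl

theorem map_psi {n m : ℕ} (c : Fin n → Fin m) (g : Fin n → G) :
    F.map (E.psi c g) = E'.psi c g := by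
  rw [Gens.psi, F.map_cmp, F.map_arr, F.map_pins]; rfl

theorem map_bend {a b : ℕ} (f : P.Hom a (b + 1)) : F.map (E.bend f) = E'.bend (F.map f) := by
  rw [Gens.bend, F.map_cmp, F.map_widen, Gens.cup, F.map_cmp, F.map_mu, F.map_eps]; rfl

theorem map_unbend {a b : ℕ} (f : P.Hom (a + 1) b) : F.map (E.unbend f) = E'.unbend (F.map f) := by
  rw [Gens.unbend, F.map_cmp, F.map_widen, Gens.cap, F.map_cmp, F.map_eta, F.map_del]; rfl

end GensHom

/-! ### Bijectivity on morphisms -/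

section Bijective

variable {k : Type u} [CommRing k] {P : LinPRO.{u, w} k} {G : Type v} [Group G] {E : Gens P G}
  {d : k}

/-- The linear extension `S` of "diagram to normal form" satisfies F ∘ S = 1 and is onto by the
spanning result. So S is bijective and F is its inverse; linear independence of the normal forms
comes from the diagrams being a basis of the target. -/
theorem GensHom.bijective_zero (F : GensHom E (diagramGens k G d)) (h : E.IsModel d)
    (hs : ∀ {a b : ℕ} (x : P.Hom a b), ∃ f, E.eval f = x) (n : ℕ) :
    Function.Bijective (F.map : P.Hom n 0 →ₗ[k] (parPRO k G d).Hom n 0) := by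
  choose m c g hc hX using fun X : Diagram G n 0 => exists_closedDiagram X
  let S : (Diagram G n 0 →₀ k) →ₗ[k] P.Hom n 0 :=
    Finsupp.linearCombination k fun X => E.psi (c X) (g X)
  have hS : ∀ X, S (Finsupp.single X 1) = E.psi (c X) (g X) := fun X => by
    simp [S]
  have hFS : ∀ x, F.map (S x) = x := by
    intro x
    induction x using Finsupp.induction_linear with
    | zero => rw [map_zero, map_zero]; rfl
    | add x y hx hy => rw [map_add, map_add, hx, hy]; rfl
    | single X r =>
      rw [show (Finsupp.single X r : Diagram G n 0 →₀ k) = r • Finsupp.single X 1 by simp, map_smul,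
        map_smul, hS, F.map_psi, diagram_psi _ _ (hc X), ← hX X]
      rfl
  have hSs : Function.Surjective S := by
    intro x
    obtain ⟨f, rfl⟩ := hs x
    have := h.eval_mem_span f
    refine (Submodule.span_le (p := LinearMap.range S)).2 ?_ this
    rintro _ ⟨m', c', g', hc', rfl⟩
    refine ⟨Finsupp.single (closedDiagram c' g') 1, ?_⟩
    rw [hS]
    -- The map and labels chosen for this diagram need not be `c'` and `g'`, but equal diagrams give
    -- equal normal forms.
    exact h.psi_eq_of_closedDiagram_eq (hc _) hc' (hX _).symm
  refine ⟨fun x y hxy => ?_, fun x => ⟨S x, hFS x⟩⟩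
  obtain ⟨x, rfl⟩ := hSs x
  obtain ⟨y, rfl⟩ := hSs y
  rw [hFS, hFS] at hxy
  rw [hxy]

/-- Induction on the number of top strands by bending the last one. Injectivity uses that unbending
inverts bending in the source model, surjectivity that it does so among diagrams. -/
theorem GensHom.bijective (F : GensHom E (diagramGens k G d)) (h : E.IsModel d)
    (hs : ∀ {a b : ℕ} (x : P.Hom a b), ∃ f, E.eval f = x) (a b : ℕ) :
    Function.Bijective (F.map : P.Hom a b →ₗ[k] (parPRO k G d).Hom a b) := by
  induction b generalizing a with
  | zero => exact F.bijective_zero h hs a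
  | succ b ih =>
    constructor
    · intro x y hxy
      rw [← h.unbend_bend x, ← h.unbend_bend y]
      congr 1
      refine (ih (a + 1)).1 ?_
      rw [F.map_bend, F.map_bend, hxy]
    · intro y
      obtain ⟨x, hx⟩ := (ih (a + 1)).2 ((diagramGens k G d).bend y)
      refine ⟨E.unbend x, ?_⟩
      rw [F.map_unbend, hx, diagramGens_isModel.unbend_bend]

end Bijective

open CategoryTheory MonoidalCategory

/-! ### The quotient category as a model -/

section Lolly

variable (k : Type u) [CommRing k] (G : Type v) [Group G] (d : k)

variable {k G d} in
/-- The quotient map on morphisms. -/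
def lollyProj {a b : ℕ} (f : (presPRO k G).Hom a b) : ParLolly.go k G d a ⟶ ParLolly.go k G d b :=
  (TensorQuotient.proj k (LollyRel k G d)).map (X := (⟨a⟩ : Par k G)) (Y := ⟨b⟩) f

theorem lollyProj_surjective {a b : ℕ} :
    Function.Surjective (lollyProj (d := d) : (presPRO k G).Hom a b → _) :=
  fun x => Quot.exists_rep x

theorem lollyProj_castHom {a b a' b' : ℕ} (ha : a = a') (hb : b = b') (f : (presPRO k G).Hom a b) :
    (castHom (H := fun a b => ParLolly.go k G d a ⟶ ParLolly.go k G d b) ha hb (lollyProj f)) =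
      lollyProj (castHom ha hb f) := by
  subst ha hb; rfl

/-- The tensor product of morphisms of the quotient. -/
def lollyTensor {a b c e : ℕ} (f : ParLolly.go k G d a ⟶ ParLolly.go k G d b)
    (g : ParLolly.go k G d c ⟶ ParLolly.go k G d e) :
    ParLolly.go k G d (a + c) ⟶ ParLolly.go k G d (b + e) := f ⊗ₘ g

-- In the quotient a tensor product is by definition a right whiskering followed by a left
-- whiskering; `tensor_eq_cmp` says that the same formula holds before taking the quotient.
variable {k G d} in
theorem lollyTensor_proj {a b c e : ℕ} (f : (presPRO k G).Hom a b) (g : (presPRO k G).Hom c e) :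
    lollyTensor k G d (lollyProj f) (lollyProj g) = lollyProj ((presPRO k G).tensor f g) :=
  (congrArg lollyProj (tensor_eq_cmp f g)).symm

/-- The quotient as a strict linear monoidal category on the natural numbers. -/
noncomputable def lollyPRO : LinPRO.{u, max u v} k where
  Hom a b := ParLolly.go k G d a ⟶ ParLolly.go k G d b
  grp a b := inferInstance
  mod a b := inferInstance
  id a := 𝟙 _
  comp := LinearMap.mk₂ k (fun f g => f ≫ g) (fun _ _ _ => Preadditive.add_comp ..)
    (fun _ _ _ => Linear.smul_comp ..) (fun _ _ _ => Preadditive.comp_add ..)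
    (fun _ _ _ => Linear.comp_smul ..)
  tensor := LinearMap.mk₂ k (fun f g => lollyTensor k G d f g)
    (fun _ _ _ => MonoidalPreadditive.add_tensor ..)
    (fun _ _ _ => by simp [lollyTensor, MonoidalCategory.tensorHom_def])
    (fun _ _ _ => MonoidalPreadditive.tensor_add ..)
    (fun _ _ _ => by simp [lollyTensor, MonoidalCategory.tensorHom_def])
  id_comp f := Category.id_comp f
  comp_id f := Category.comp_id f
  assoc f g h := Category.assoc f g h
  tensor_id a b := id_tensorHom_id (C := ParLolly k G d) (ParLolly.go k G d a) (ParLolly.go k G d b)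
  interchange f g f' g' := tensorHom_comp_tensorHom (C := ParLolly k G d) f f' g g'
  tensor_assoc f g h := by
    -- Every morphism of the quotient lifts to the presented category, from which the strict
    -- associativity descends.
    obtain ⟨f, rfl⟩ := lollyProj_surjective k G d f
    obtain ⟨g, rfl⟩ := lollyProj_surjective k G d g
    obtain ⟨h, rfl⟩ := lollyProj_surjective k G d h
    change castHom (H := fun a b => ParLolly.go k G d a ⟶ ParLolly.go k G d b) _ _
      (lollyTensor k G d (lollyTensor k G d (lollyProj f) (lollyProj g)) (lollyProj h)) =
        lollyTensor k G d (lollyProj f) (lollyTensor k G d (lollyProj g) (lollyProj h))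
    rw [lollyTensor_proj, lollyTensor_proj, lollyTensor_proj, lollyTensor_proj, lollyProj_castHom,
      ← (presPRO k G).tensor_assoc]
  unit_tensor f := by
    obtain ⟨f, rfl⟩ := lollyProj_surjective k G d f
    exact (congrArg _ (lollyTensor_proj ((presPRO k G).id 0) f)).trans
      ((lollyProj_castHom k G d _ _ _).trans (congrArg lollyProj ((presPRO k G).unit_tensor f)))
  tensor_unit f := by
    obtain ⟨f, rfl⟩ := lollyProj_surjective k G d f
    exact (congrArg _ (lollyTensor_proj f ((presPRO k G).id 0))).trans
      ((lollyProj_castHom k G d _ _ _).trans (congrArg lollyProj ((presPRO k G).tensor_unit f)))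

/-- The generators of the quotient. -/
noncomputable def lollyGens : Gens (lollyPRO k G d) G where
  merge := ParLolly.mk Term.merge
  split := ParLolly.mk Term.split
  cross := ParLolly.mk Term.cross
  bpin := ParLolly.mk Term.bpin
  tpin := ParLolly.mk Term.tpin
  token g := ParLolly.mk (Term.token g)

variable {k G d}

theorem lollyGens_eval {a b : ℕ} (f : Term k G a b) :
    (lollyGens k G d).eval f = ParLolly.mk f := by
  induction f with
  | comp f g hf hg => rw [Gens.eval, hf, hg]; rfl
  | tensor f g hf hg => rw [Gens.eval, hf, hg]; exact lollyTensor_proj _ _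
  | add f g hf hg => rw [Gens.eval, hf, hg]; rfl
  | smul r f hf => rw [Gens.eval, hf]; rfl
  | _ => rfl

theorem lollyGens_eval_surjective {a b : ℕ} (x : (lollyPRO k G d).Hom a b) :
    ∃ f, (lollyGens k G d).eval f = x := by
  obtain ⟨⟨f⟩, rfl⟩ := lollyProj_surjective k G d x
  exact ⟨f, lollyGens_eval f⟩

theorem lollyGens_isModel : (lollyGens k G d).IsModel d where
  rel h := by
    rw [lollyGens_eval, lollyGens_eval]
    exact congrArg lollyProj (PresHom.sound (Rel.gen h))
  lolly := TensorQuotient.map_eq k (LollyRel k G d) (TensorClosure.of LollyRel.lolly)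

/-! ### The comparison functor and its inverse -/

/-- Evaluation in the category of diagrams, as a functor on the presented category. -/
noncomputable def presFunctor : Par k G ⥤ ParD k G d where
  obj X := ⟨X.n⟩
  map f := Quotient.lift (diagramGens k G d).eval (fun _ _ h => diagramGens_isModel.eval_eq h) f
  map_id _ := rfl
  map_comp := by rintro X Y Z ⟨f⟩ ⟨g⟩; rfl

/-- Evaluation is linear and compatible with composition and whiskering, so it respects the
generated congruence as soon as it respects the lolly relation. -/
theorem presFunctor_rel {X Y : Par k G} {f g : X ⟶ Y}
    (h : TensorClosure k (LollyRel k G d) f g) :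
    (presFunctor (d := d)).map f = presFunctor.map g := by
  induction h with
  | of h => cases h; exact diagramGens_isModel.lolly
  | refl f => rfl
  | symm _ h => exact h.symm
  | trans _ _ h h' => exact h.trans h'
  | precomp f _ h => rw [Functor.map_comp, Functor.map_comp, h]
  | postcomp f _ h => rw [Functor.map_comp, Functor.map_comp, h]
  | @add X Y f f' g g' _ _ h h' =>
    obtain ⟨f⟩ := f; obtain ⟨f'⟩ := f'; obtain ⟨g⟩ := g; obtain ⟨g'⟩ := g'
    exact congrArg₂ (fun x y : (parPRO k G d).Hom X.n Y.n => x + y) h h'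
  | @smul X Y r f f' _ h =>
    obtain ⟨f⟩ := f; obtain ⟨f'⟩ := f'
    exact congrArg (fun x : (parPRO k G d).Hom X.n Y.n => r • x) h
  | @whiskerLeft X Y Z f f' _ h =>
    obtain ⟨f⟩ := f; obtain ⟨f'⟩ := f'
    exact congrArg ((parPRO k G d).tensor ((parPRO k G d).id X.n)) h
  | @whiskerRight Y Z f f' X _ h =>
    obtain ⟨f⟩ := f; obtain ⟨f'⟩ := f'
    exact congrArg (fun x => (parPRO k G d).tensor x ((parPRO k G d).id X.n)) h

/-- The comparison functor from the quotient of the presented category to the category of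
diagrams. -/
noncomputable def diagramFunctor : ParLolly k G d ⥤ ParD k G d :=
  CategoryTheory.Quotient.lift _ presFunctor fun _ _ _ _ h => presFunctor_rel h

instance : (diagramFunctor (k := k) (G := G) (d := d)).Additive where
  map_add := by rintro X Y ⟨⟨f⟩⟩ ⟨⟨g⟩⟩; rfl

instance : (diagramFunctor (k := k) (G := G) (d := d)).Linear k where
  map_smul := by rintro X Y ⟨⟨f⟩⟩ r; rfl

/-- The comparison functor on morphisms. -/
noncomputable def diagramHom : GensHom (lollyGens k G d) (diagramGens k G d) where
  map {a b} :=
    { toFun := fun f => diagramFunctor.map (X := ParLolly.go k G d a) (Y := ParLolly.go k G d b) f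
      map_add' := fun _ _ => Functor.map_add _
      map_smul' := fun _ _ => Functor.map_smul .. }
  map_id a := rfl
  map_cmp f g := diagramFunctor.map_comp ..
  map_tensor f g := by
    obtain ⟨f, rfl⟩ := lollyGens_eval_surjective f
    obtain ⟨g, rfl⟩ := lollyGens_eval_surjective g
    change diagramFunctor.map ((lollyGens k G d).eval (f.tensor g)) = _
    rw [lollyGens_eval, lollyGens_eval, lollyGens_eval]
    rfl
  map_merge := rfl
  map_split := rfl
  map_cross := rfl
  map_bpin := rfl
  map_tpin := rfl
  map_token _ := rfl

theorem diagramHom_bijective (a b : ℕ) : Function.Bijective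
    ((diagramHom (k := k) (G := G) (d := d)).map (a := a) (b := b)) :=
  diagramHom.bijective lollyGens_isModel lollyGens_eval_surjective a b

/-- The comparison functor is bijective on morphisms. -/
noncomputable def diagramEquiv (a b : ℕ) :
    (ParLolly.go k G d a ⟶ ParLolly.go k G d b) ≃ₗ[k] (Diagram G a b →₀ k) :=
  LinearEquiv.ofBijective (diagramHom.map (a := a) (b := b)) (diagramHom_bijective a b)

/-- The inverse of the comparison functor. -/
noncomputable def diagramInverse : ParD k G d ⥤ ParLolly k G d where
  obj X := ParLolly.go k G d X.n
  map f := (diagramEquiv _ _).symm f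
  map_id X := (diagramEquiv _ _).symm_apply_eq.2 (diagramFunctor.map_id (ParLolly.go k G d X.n)).symm
  map_comp f g := (diagramEquiv _ _).symm_apply_eq.2 (by
    refine Eq.trans ?_ (diagramFunctor.map_comp ((diagramEquiv _ _).symm f)
      ((diagramEquiv _ _).symm g)).symm
    exact congrArg₂ (fun x y => (parPRO k G d).comp x y)
      ((diagramEquiv _ _).apply_symm_apply f).symm ((diagramEquiv _ _).apply_symm_apply g).symm)

end Lolly

end GroupPartition

namespace GroupPartition

universe u v w

open LinPRO CategoryTheory MonoidalCategory

/-! ### Strict monoidality and the isomorphism -/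

section Iso

variable {k : Type u} [CommRing k] {G : Type v} [Group G] {d : k}

theorem diagramFunctor_comp_inverse :
    (diagramFunctor : ParLolly k G d ⥤ ParD k G d) ⋙ diagramInverse = 𝟭 _ :=
  CategoryTheory.Functor.ext (fun _ => rfl) fun X Y f =>
    ((diagramEquiv X.as.n Y.as.n).symm_apply_apply f).trans
      ((Category.id_comp _).trans (Category.comp_id _)).symm

theorem diagramInverse_comp_functor :
    (diagramInverse : ParD k G d ⥤ ParLolly k G d) ⋙ diagramFunctor = 𝟭 _ :=
  CategoryTheory.Functor.ext (fun _ => rfl) fun X Y f =>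
    ((diagramEquiv X.n Y.n).apply_symm_apply f).trans
      ((Category.id_comp (X := X) _).trans (Category.comp_id (Y := Y) _)).symm

/-- The comparison functor is strictly monoidal. -/
noncomputable def diagramCoreMonoidal :
    (diagramFunctor : ParLolly k G d ⥤ ParD k G d).CoreMonoidal where
  εIso := Iso.refl _
  μIso X Y := Iso.refl _
  μIso_hom_natural_left := by
    rintro X Y ⟨⟨f⟩⟩ Z
    exact (Category.comp_id _).trans (Category.id_comp _).symm
  μIso_hom_natural_right := by
    rintro X Y Z ⟨⟨f⟩⟩
    exact (Category.comp_id _).trans (Category.id_comp _).symm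
  associativity X Y Z := by
    -- Both associators come from the same equality of natural numbers, and functors preserve
    -- `eqToHom`. All structure morphisms are identities, so afterwards only identities have to be
    -- removed.
    have h : diagramFunctor.map (α_ X Y Z).hom = (α_ (diagramFunctor.obj X)
        (diagramFunctor.obj Y) (diagramFunctor.obj Z)).hom :=
      eqToHom_map (presFunctor (d := d)) (congrArg LinPRO.Ob.mk (add_assoc X.as.n Y.as.n Z.as.n))
    have h₁ : 𝟙 (diagramFunctor.obj X ⊗ diagramFunctor.obj Y) ▷ diagramFunctor.obj Z = 𝟙 _ :=
      id_whiskerRight ..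
    have h₂ : diagramFunctor.obj X ◁ 𝟙 (diagramFunctor.obj Y ⊗ diagramFunctor.obj Z) = 𝟙 _ :=
      whiskerLeft_id ..
    refine (congrArg₂ (· ≫ ·) h₁ (congrArg (𝟙 _ ≫ ·) h)).trans ?_
    refine Eq.trans ?_ (congrArg (fun f => (α_ _ _ _).hom ≫ f ≫ 𝟙 _) h₂).symm
    refine (Category.id_comp (obj := ParD k G d) _).trans
      ((Category.id_comp (obj := ParD k G d) _).trans ?_)
    exact (Category.comp_id (obj := ParD k G d) _).symm.trans
      (congrArg ((α_ _ _ _).hom ≫ ·) (Category.comp_id (obj := ParD k G d) (𝟙 _)).symm)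
  left_unitality X := by
    have h : diagramFunctor.map (λ_ X).hom = (λ_ (diagramFunctor.obj X)).hom :=
      eqToHom_map (presFunctor (d := d)) (congrArg LinPRO.Ob.mk (zero_add X.as.n))
    have h₁ : 𝟙 (𝟙_ (ParD k G d)) ▷ diagramFunctor.obj X = 𝟙 _ := id_whiskerRight ..
    refine Eq.trans ?_ (congrArg₂ (· ≫ ·) h₁ (congrArg (𝟙 _ ≫ ·) h)).symm
    simp
  right_unitality X := by
    have h : diagramFunctor.map (ρ_ X).hom = (ρ_ (diagramFunctor.obj X)).hom :=
      eqToHom_map (presFunctor (d := d)) (congrArg LinPRO.Ob.mk (add_zero X.as.n))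
    have h₁ : diagramFunctor.obj X ◁ 𝟙 (𝟙_ (ParD k G d)) = 𝟙 _ := whiskerLeft_id ..
    refine Eq.trans ?_ (congrArg₂ (· ≫ ·) h₁ (congrArg (𝟙 _ ≫ ·) h)).symm
    simp

/-- The comparison functor as an isomorphism of linear monoidal categories. -/
noncomputable def diagramIso : LinearMonoidalIso k (ParLolly k G d) (ParD k G d) where
  functor := diagramFunctor
  inverse := diagramInverse
  functor_inverse := diagramFunctor_comp_inverse
  inverse_functor := diagramInverse_comp_functor
  additive := inferInstance
  linear := inferInstance
  monoidal := diagramCoreMonoidal.toMonoidal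
  obj_unit := rfl
  obj_tensor _ _ := rfl
  ε_eq := rfl
  μ_eq _ _ := rfl

end Iso
end GroupPartition

theorem theorem4p3 {k : Type*} [CommRing k] {G : Type*} [Group G] (d : k) :
    ∃ (Φ : LinearMonoidalIso k (ParLolly k G d) (ParD k G d))
      (hΦ : ∀ n : ℕ, Φ.functor.obj (ParLolly.go k G d n) = ⟨n⟩),
      image hΦ (ParLolly.mk Term.merge) = onePart k (fun _ => (1 : G)) ∧
      image hΦ (ParLolly.mk Term.split) = onePart k (fun _ => (1 : G)) ∧
      image hΦ (ParLolly.mk Term.cross) = crossDiagram k G ∧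
      image hΦ (ParLolly.mk Term.bpin) = onePart k (fun _ => (1 : G)) ∧
      image hΦ (ParLolly.mk Term.tpin) = onePart k (fun _ => (1 : G)) ∧
      (∀ g : G, image hΦ (ParLolly.mk (Term.token g)) =
        onePart k (Sum.elim (fun _ => g) (fun _ => 1))) ∧
      ∀ a b : ℕ, ∃ B : Module.Basis (Diagram G a b) k
          (ParLolly.go k G d a ⟶ ParLolly.go k G d b),
        ∀ X : Diagram G a b, image hΦ (B X) = Finsupp.single X 1 := by
  -- The objects correspond definitionally, so the `eqToHom` factors in `image` are identities and
  -- the image is the value of the linear equivalence. For the generators this value is computed by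
  -- definition, and the basis is the preimage of the standard basis.
  have key {a b : ℕ} (f : ParLolly.go k G d a ⟶ ParLolly.go k G d b) :
      image (F := diagramIso.functor) (fun _ => rfl) f = diagramEquiv a b f :=
    (CategoryTheory.Category.id_comp _).trans (CategoryTheory.Category.comp_id _)
  exact ⟨diagramIso, fun _ => rfl, key _, key _, key _, key _, key _, fun _ => key _,
    fun a b => ⟨Module.Basis.ofRepr (diagramEquiv a b), fun X =>
      (key _).trans ((diagramEquiv a b).apply_symm_apply _)⟩⟩
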